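/- **Setting.** Let $\eta=\mathrm{diag}(-1,1,1,1)$, let $(x^0,x^1,x^2,x^3)=(t,\vec x)$ be coordinates on $\mathbb R\times\mathbb R^3$, $r=|\vec x|$, and let $g_{\mu\nu}$ be a Lorentzian metric (signature $-+++$) of class $C^3$ on an open set $\Omega\subset\mathbb R\times\mathbb R^3$. Let $R_0,u_0\in\mathbb R$ and let $f$ be a $C^1$ function on $\{|\vec x|>R_0\}$ such that $\nabla f-\vec x/|\vec x|\to0$ as $|\vec x|\to\infty$ (so that $u=t-f(\vec x)$ satisfies $du\to dt-dr$). Assume that $\Omega$ contains all $(t,\vec x)$ with $|\vec x|>R_0$ such that either $t=0$ or $0\le t\le u_0+f(\vec x)$. For a function $v$ defined near infinity in $\mathbb R^3$ and of class $C^k$ there, write $v=O_{H^k}(r^{\alpha})$ if, for some $R$, $\sum_{\ell\le k}\int_{|\vec x|>R}(1+|\vec x|)^{-2\alpha-3+2\ell}|\nabla^\ell v|^2\,d^3x<\infty$. Assume that on $\{t=0\}$ $$g_{\mu\nu}-\eta_{\mu\nu}=O_{H^3}(r^{-1/2}),\qquad K_{ij}=O_{H^2}(r^{-3/2}),$$ where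 $K_{ij}=\nabla_i n_j$ is the extrinsic curvature of $\{t=0\}$ and $n$ its future unit normal. Write $\gamma_{ij}=g_{ij}|_{t=0}$ and suppose that the ADM four-momentum $p_\mu$ of the data $(\gamma,K)$ is defined, that is, that the following limits exist in $\mathbb R$: $$p_0=\lim_{R\to\infty}\frac1{16\pi}\int_{|\vec x|=R}(\partial_j\gamma_{ij}-\partial_i\gamma_{jj})\frac{x^i}{R}\,dA,\qquad p_i=\lim_{R\to\infty}\frac1{8\pi}\int_{|\vec x|=R}(K_{ij}-\mathrm{tr}_\gamma K\,\gamma_{ij})\frac{x^j}{R}\,dA .$$ For a vector field $X$ set, with $e=\sqrt{|\det g|}/\sqrt{|\det\eta|}$, $\Delta^{\alpha\nu}=e\,g^{\alpha\nu}-\eta^{\alpha\nu}$, $A^{[\nu\lambda]}=\frac12(A^{\nu\lambda}-A^{\lambda\nu})$, and a semicolon denoting the covariant derivative of $\eta$, $$\mathbb U^{\nu\lambda}=\mathbb U^{\nu\lambda}{}_\beta X^\beta+\frac1{8\pi}\Delta^{\alpha[\nu}X^{\lambda]}{}_{;\alpha},\qquad \mathbb U^{\nu\lambda}{}_\beta=\frac{2|\det\eta|}{16\pi\sqrt{|\det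 g|}}\,g_{\beta\gamma}\bigl(e^2g^{\gamma[\nu}g^{\lambda]\kappa}\bigr)_{;\kappa},$$ and $H(X,S)=\frac12\int_S\mathbb U^{\alpha\beta}dS_{\alpha\beta}$, where $dS_{\alpha\beta}=\partial_\alpha\lrcorner\,\partial_\beta\lrcorner\,dx^0\wedge dx^1\wedge dx^2\wedge dx^3$ and $dS_\beta=\partial_\beta\lrcorner\,dx^0\wedge dx^1\wedge dx^2\wedge dx^3$. For $u\le u_0$ let $S_{u+f,R}=\{|\vec x|=R,\ t=u+f(\vec x)\}$, oriented by the spherical coordinates $(\theta,\varphi)$, and $T(R,u)=\{|\vec x|=R,\ 0\le t\le u+f(\vec x)\}$, oriented by $(t,\theta,\varphi)$; these are contained in $\Omega$ for $R$ large. The Trautman four-momentum at retarded time $u$ is $$p^T_\mu(u)=\lim_{R\to\infty}H(\partial_\mu,S_{u+f,R})$$ whenever this limit exists. **Proposition.** For each $\mu\in\{0,1,2,3\}$, and with $\mathbb U$ calculated for $X=\partial_\mu$, the following are equivalent: 1. $p^T_\mu(u)$ exists in $\mathbb R$ for all $u\le u_0$, and $\lim_{u\to-\infty}p^T_\mu(u)=p_\mu$;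 2. $\lim_{R\to\infty}\int_{T(R,u)}\partial_\alpha\mathbb U^{\alpha\beta}dS_\beta$ exists in $\mathbb R$ for all $u\le u_0$, and $$\lim_{u\to-\infty}\Bigl(\lim_{R\to\infty}\int_{T(R,u)}\partial_\alpha\mathbb U^{\alpha\beta}\,dS_\beta\Bigr)=0 .$$ -/

import Mathlib

open Filter Topology MeasureTheory

noncomputable section

/-! ### Coordinates -/

/-- Space, with its Euclidean norm `r = ‖x‖`. -/
abbrev Space3 : Type := EuclideanSpace ℝ (Fin 3)

/-- Coordinates `(x⁰, x¹, x², x³) = (t, x)` of a space-time point. -/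
abbrev Event : Type := Fin 4 → ℝ

/-- The event with time coordinate `t` and space coordinates `x`. -/
def event (t : ℝ) (x : Space3) : Event := Fin.cons t (fun i => x i)

/-- A matrix-valued function on (a subset of) space-time, thought of as `g_{μν}`. -/
abbrev MetricField : Type := Event → Matrix (Fin 4) (Fin 4) ℝ

/-- The coordinate vector `∂_μ`. -/
def coordVec (μ : Fin 4) : Event := Pi.single μ 1

/-- The partial derivative `∂_μ F` on space-time. -/
def pd (μ : Fin 4) (F : Event → ℝ) (q : Event) : ℝ := fderiv ℝ F q (coordVec μ)

/-- The partial derivative `∂_i F` on space. -/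
def spd (i : Fin 3) (F : Space3 → ℝ) (x : Space3) : ℝ :=
  fderiv ℝ F x (EuclideanSpace.single i 1)

/-- The Minkowski metric `diag(-1, 1, 1, 1)`. -/
def minkowski : Matrix (Fin 4) (Fin 4) ℝ := Matrix.diagonal ![-1, 1, 1, 1]

/-- Symmetric bilinear forms of signature `(-, +, +, +)`: those congruent to the Minkowski form. -/
def IsLorentzian (G : Matrix (Fin 4) (Fin 4) ℝ) : Prop :=
  ∃ A : Matrix (Fin 4) (Fin 4) ℝ, IsUnit A.det ∧ G = A.transpose * minkowski * A

/-! ### The superpotential -/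

/-- `e = √|det g| / √|det η|`. -/
def densityRatio (g : MetricField) (q : Event) : ℝ :=
  √|(g q).det| / √|minkowski.det|

/-- `U^{νλ}_β = 2 |det η| / (16 π √|det g|) g_{βγ} (e² g^{γ[ν} g^{λ]κ})_{;κ}`. In the coordinates
used here the Minkowski covariant derivative is the partial derivative, and
`A^{[νλ]} = (A^{νλ} - A^{λν}) / 2`. -/
def freud (g : MetricField) (ν l β : Fin 4) (q : Event) : ℝ :=
  2 * |minkowski.det| / (16 * Real.pi * √|(g q).det|) *
    ∑ γ, g q β γ * ∑ κ, pd κ (fun y => densityRatio g y ^ 2 *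
      (((g y)⁻¹ γ ν * (g y)⁻¹ l κ - (g y)⁻¹ γ l * (g y)⁻¹ ν κ) / 2)) q

/-- `Δ^{αν} = e g^{αν} - η^{αν}`. -/
def metricDefect (g : MetricField) (α ν : Fin 4) (q : Event) : ℝ :=
  densityRatio g q * (g q)⁻¹ α ν - minkowski⁻¹ α ν

/-- `U^{νλ} = U^{νλ}_β X^β + (1 / 8π) Δ^{α[ν} X^{λ]}_{;α}`. -/
def superpotential (g : MetricField) (X : Event → Event) (ν l : Fin 4) (q : Event) : ℝ :=
  (∑ β, freud g ν l β q * X q β) +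
    1 / (8 * Real.pi) * ∑ α, (metricDefect g α ν q * pd α (fun y => X y l) q
      - metricDefect g α l q * pd α (fun y => X y ν) q) / 2

/-- The vector field `∂_μ`. -/
def translation (μ : Fin 4) : Event → Event := fun _ => coordVec μ

/-! ### Surface integrals -/

/-- The volume form `dx⁰ ∧ dx¹ ∧ dx² ∧ dx³`. -/
def vol4 (a b c d : Event) : ℝ := (Matrix.of ![a, b, c, d]).det

/-- The point of the sphere of radius `R` with spherical coordinates `(θ, φ)`. -/
def spherePt (R θ φ : ℝ) : Space3 :=
  !₂[R * (Real.sin θ * Real.cos φ), R * (Real.sin θ * Real.sin φ), R * Real.cos θ]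

/-- `½ ∫_S V^{αβ} dS_{αβ}` with `dS_{αβ} = ∂_α ⌟ ∂_β ⌟ dx⁰ ∧ dx¹ ∧ dx² ∧ dx³`, so that
`dS_{αβ}(v, w) = vol(∂_β, ∂_α, v, w)`, over the surface `S = {|x| = R, t = τ(x)}`, which is
parameterized, and oriented, by the spherical coordinates `(θ, φ)`. -/
def surfaceIntegral (V : Fin 4 → Fin 4 → Event → ℝ) (τ : Space3 → ℝ) (R : ℝ) : ℝ :=
  1 / 2 * ∫ θ in (0 : ℝ)..Real.pi, ∫ φ in (0 : ℝ)..(2 * Real.pi),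
    ∑ α, ∑ β, V α β (event (τ (spherePt R θ φ)) (spherePt R θ φ)) *
      vol4 (coordVec β) (coordVec α)
        (deriv (fun s => event (τ (spherePt R s φ)) (spherePt R s φ)) θ)
        (deriv (fun s => event (τ (spherePt R θ s)) (spherePt R θ s)) φ)

/-- `H(X, S)` for the surface `S = {|x| = R, t = τ(x)}`. -/
def charge (g : MetricField) (X : Event → Event) (τ : Space3 → ℝ) (R : ℝ) : ℝ :=
  surfaceIntegral (superpotential g X) τ R

/-- `∫_T ∂_α V^{αβ} dS_β` with `dS_β = ∂_β ⌟ dx⁰ ∧ dx¹ ∧ dx² ∧ dx³`, over the timelike cylinder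
`T = {|x| = R, 0 ≤ t ≤ τ(x)}` (with `τ ≥ 0` on the sphere `|x| = R`), parameterized, and oriented,
by `(t, θ, φ)`. -/
def cylinderFlux (V : Fin 4 → Fin 4 → Event → ℝ) (τ : Space3 → ℝ) (R : ℝ) : ℝ :=
  ∫ θ in (0 : ℝ)..Real.pi, ∫ φ in (0 : ℝ)..(2 * Real.pi),
    ∫ t in (0 : ℝ)..τ (spherePt R θ φ),
      ∑ β, (∑ α, pd α (V α β) (event t (spherePt R θ φ))) *
        vol4 (coordVec β) (deriv (fun s => event s (spherePt R θ φ)) t)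
          (deriv (fun s => event t (spherePt R s φ)) θ)
          (deriv (fun s => event t (spherePt R θ s)) φ)

/-! ### Initial data on `{t = 0}` and the ADM four-momentum -/

/-- The components `g_{μν}` restricted to `{t = 0}`. -/
def atTimeZero (g : MetricField) (μ ν : Fin 4) (x : Space3) : ℝ := g (event 0 x) μ ν

/-- The metric `γ_{ij}` induced on `{t = 0}`. -/
def spatialMetric (g : MetricField) (x : Space3) : Matrix (Fin 3) (Fin 3) ℝ :=
  fun i j => atTimeZero g i.succ j.succ x

/-- The Christoffel symbol `Γ^0_{ij}` of `g`, with `i`, `j` spatial. -/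
def christoffelTime (g : MetricField) (i j : Fin 3) (q : Event) : ℝ :=
  1 / 2 * ∑ σ, (g q)⁻¹ 0 σ * (pd i.succ (fun y => g y σ j.succ) q
    + pd j.succ (fun y => g y σ i.succ) q - pd σ (fun y => g y i.succ j.succ) q)

/-- The extrinsic curvature `K_{ij} = ∇_i n_j` of `{t = 0}`, with `n` the future unit normal:
`n_μ dx^μ = -N dt`, `N = (-g^{00})^{-1/2}`, whence `K_{ij} = N Γ^0_{ij}`. -/
def extrinsicCurvature (g : MetricField) (i j : Fin 3) (x : Space3) : ℝ :=
  (√(-(g (event 0 x))⁻¹ 0 0))⁻¹ * christoffelTime g i j (event 0 x)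

/-- The trace of the extrinsic curvature with respect to the induced metric. -/
def meanCurvature (g : MetricField) (x : Space3) : ℝ :=
  ∑ i, ∑ j, (spatialMetric g x)⁻¹ i j * extrinsicCurvature g i j x

/-- The part of space outside a closed ball. -/
def outside (R : ℝ) : Set Space3 := {x | R < ‖x‖}

/-- `v = O_{H^k}(r^α)` for functions of class `C^k` near infinity: outside of some ball the
weighted Sobolev norm `∑_{l ≤ k} ∫ (1 + r)^{-2α - 3 + 2l} |∇^l v|² d³x` is finite. -/
def IsOSobolev (k : ℕ) (α : ℝ) (v : Space3 → ℝ) : Prop :=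
  ∃ R : ℝ, ContDiffOn ℝ k v (outside R) ∧ ∀ l : ℕ, l ≤ k →
    IntegrableOn (fun x => (1 + ‖x‖) ^ (-2 * α - 3 + 2 * (l : ℝ)) * ‖iteratedFDeriv ℝ l v x‖ ^ 2)
      (outside R) volume

/-- Integral over the sphere `|x| = R` with respect to its area measure. -/
def sphereIntegral (F : Space3 → ℝ) (R : ℝ) : ℝ :=
  ∫ θ in (0 : ℝ)..Real.pi, ∫ φ in (0 : ℝ)..(2 * Real.pi),
    F (spherePt R θ φ) * (R ^ 2 * Real.sin θ)

/-- The ADM energy integral `(1 / 16π) ∫_{|x| = R} (∂_j γ_{ij} - ∂_i γ_{jj}) (x^i / R) dA`. -/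
def admEnergy (g : MetricField) (R : ℝ) : ℝ :=
  1 / (16 * Real.pi) * sphereIntegral (fun x => ∑ i : Fin 3, ∑ j : Fin 3,
    (spd j (fun y => spatialMetric g y i j) x - spd i (fun y => spatialMetric g y j j) x)
      * (x i / R)) R

/-- The ADM momentum integral `(1 / 8π) ∫_{|x| = R} (K_{ij} - (tr K) γ_{ij}) (x^j / R) dA`. -/
def admMomentum (g : MetricField) (i : Fin 3) (R : ℝ) : ℝ :=
  1 / (8 * Real.pi) * sphereIntegral (fun x => ∑ j : Fin 3,
    (extrinsicCurvature g i j x - meanCurvature g x * spatialMetric g x i j) * (x j / R)) R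

/-- `p = (p_0, p_1, p_2, p_3)` is the ADM four-momentum of the initial data induced on
`{t = 0}`. -/
def IsADMFourMomentum (g : MetricField) (p : Fin 4 → ℝ) : Prop :=
  Tendsto (admEnergy g) atTop (𝓝 (p 0)) ∧
    ∀ i : Fin 3, Tendsto (admMomentum g i) atTop (𝓝 (p i.succ))

/-! ### The Trautman four-momentum and the limiting flux -/

/-- `P` is the component `p^T_μ(u) = lim_{R → ∞} H(∂_μ, S_{u + f, R})` of the Trautman
four-momentum at retarded time `u`, where the retarded time coordinate is `t - f(x)`. -/
def IsTrautmanMomentum (g : MetricField) (f : Space3 → ℝ) (μ : Fin 4) (u P : ℝ) : Prop :=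
  Tendsto (fun R => charge g (translation μ) (fun x => u + f x) R) atTop (𝓝 P)

/-- `Φ` is the limit, as `R → ∞`, of the flux of `∂_α U^{αβ}` through the cylinder
`T(R, u) = {|x| = R, 0 ≤ t ≤ u + f(x)}`, with `U` the superpotential of `∂_μ`. -/
def IsLimitFlux (g : MetricField) (f : Space3 → ℝ) (μ : Fin 4) (u Φ : ℝ) : Prop :=
  Tendsto (fun R => cylinderFlux (superpotential g (translation μ)) (fun x => u + f x) R)
    atTop (𝓝 Φ)

end

open Asymptotics

/-! ### The Sobolev embedding of H² into L^∞ on balls of three-dimensional space -/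

section Sobolev

variable {F E : Type*} [NormedAddCommGroup F] [NormedSpace ℝ F] [NormedAddCommGroup E]
  [NormedSpace ℝ E]

/-! The superpotential is antisymmetric, so `½ U^{αβ} dS_{αβ}` is a 2-form whose exterior derivative
is `∂_α U^{αβ} dS_β`. The cylinder `T(R,u)` has boundary spheres at `t = 0` and at `t = u + f`, and
Stokes' theorem on it says that, for `R` large, the charge on `S_{u+f,R}` minus the charge on the
sphere `{t = 0, |x| = R}` is the flux through `T(R,u)` (`eventually_charge_sub_eq_flux`). Once the
charges on `{t = 0}` are known to tend to `p_μ` (`tendsto_charge_zero`), the Trautman momentum at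
`u` exists exactly when the limiting flux exists, and the two differ by the constant `p_μ`. The
equivalence follows by letting `u → -∞`.

The substance is the limit on `{t = 0}`. The weighted Sobolev embedding
(`isLittleO_of_weighted_sobolev`) turns the integral hypotheses into pointwise decay: `g - η =
o(r^{-1/2})`, while the spatial derivatives of `g` and the extrinsic curvature are `o(r^{-3/2})`.
The time derivatives of lapse and shift are not controlled at all. They do no harm: by Jacobi's
identity for complementary minors, `U^{0i}_μ` is a sum of derivatives of 2 × 2 minors of `g` in
which only spatial components are differentiated in time (`freud_zero_succ`), and those time
derivatives are recovered from the extrinsic curvature (`timeDeriv_isLittleO`).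

All the quantities may therefore be linearized at `η`. The errors are products `o(r^{-1/2}) ·
o(r^{-3/2}) = o(r^{-2})`, whose flux through a sphere of area `4πR²` tends to zero
(`tendsto_sphereFlux_zero`). The linearized `-U^{0i}_0` is the ADM energy density. The linearized
`-U^{0i}_k` is the ADM momentum density plus a curl built from the shift, and a curl has no flux
through a closed sphere (`sphereFlux_curl_eq_zero`). -/

lemma norm_fderiv_fderiv_eq (v : F → E) (x : F) :
    ‖fderiv ℝ (fderiv ℝ v) x‖ = ‖iteratedFDeriv ℝ 2 v x‖ := by
  rw [← norm_iteratedFDeriv_fderiv, ← norm_iteratedFDeriv_fderiv, norm_iteratedFDeriv_zero]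

lemma norm_fderiv_eq_iterated (v : F → E) (x : F) :
    ‖fderiv ℝ v x‖ = ‖iteratedFDeriv ℝ 1 v x‖ := by
  rw [← norm_iteratedFDeriv_fderiv, norm_iteratedFDeriv_zero]

lemma continuousOn_norm_iteratedFDeriv {v : F → E} {U : Set F} {n : ℕ} (hU : IsOpen U)
    (hv : ContDiffOn ℝ n v U) {l : ℕ} (hl : l ≤ n) :
    ContinuousOn (fun x => ‖iteratedFDeriv ℝ l v x‖) U := by
  have h := (hv.continuousOn_iteratedFDerivWithin (m := l) (by exact_mod_cast hl)
    hU.uniqueDiffOn).norm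
  refine h.congr fun x hx => ?_
  simp only [iteratedFDerivWithin_of_isOpen l hU hx]

/-- Second order Taylor estimate, along the path `σ ↦ x + σ² y`. -/
lemma norm_le_taylor_sq [CompleteSpace E] {v : F → E} {U : Set F} (hU : IsOpen U)
    (hv : ContDiffOn ℝ 2 v U) {x y : F}
    (hxy : ∀ σ ∈ Set.Icc (0 : ℝ) 1, x + σ ^ 2 • y ∈ U) :
    ‖v x‖ ≤ ‖iteratedFDeriv ℝ 0 v (x + y)‖ + ‖y‖ * ‖iteratedFDeriv ℝ 1 v (x + y)‖
      + ‖y‖ ^ 2 * ∫ σ in (0 : ℝ)..1, 2 * σ ^ 3 * ‖iteratedFDeriv ℝ 2 v (x + σ ^ 2 • y)‖ := by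
  have hv1 : ContDiffOn ℝ 1 (fderiv ℝ v) U := hv.fderiv_of_isOpen hU (by norm_num)
  have hpath : Continuous fun σ : ℝ => x + σ ^ 2 • y := by fun_prop
  have hD2 : ContinuousOn (fderiv ℝ (fderiv ℝ v)) U :=
    hv1.continuousOn_fderiv_of_isOpen hU le_rfl
  have hmaps : Set.MapsTo (fun σ : ℝ => x + σ ^ 2 • y) (Set.uIcc 0 1) U := by
    intro σ hσ
    rw [Set.uIcc_of_le zero_le_one] at hσ
    exact hxy σ hσ
  have hc2 : ContinuousOn (fun σ : ℝ => fderiv ℝ (fderiv ℝ v) (x + σ ^ 2 • y)) (Set.uIcc 0 1) :=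
    hD2.comp hpath.continuousOn hmaps
  -- The terms `2σ Dv(y)` cancel. The path is quadratic in `σ` because of the later change of
  -- variables in three dimensions: the squared weight `(2σ³)²` exactly balances the Jacobian
  -- `σ^{-6}` of `y ↦ σ² y`. With the linear path the weight `σ²` would meet the Jacobian `σ^{-3}`,
  -- and the `σ`-integral would diverge logarithmically.
  have hder : ∀ σ ∈ Set.uIcc (0 : ℝ) 1, HasDerivAt
      (fun σ : ℝ => v (x + σ ^ 2 • y) - σ ^ 2 • fderiv ℝ v (x + σ ^ 2 • y) y)
      (-((2 * σ ^ 3) • fderiv ℝ (fderiv ℝ v) (x + σ ^ 2 • y) y y)) σ := by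
    intro σ hσ
    have hz := hmaps hσ
    have hp : HasDerivAt (fun σ : ℝ => x + σ ^ 2 • y) ((2 * σ) • y) σ := by
      have := ((hasDerivAt_pow 2 σ).smul_const y).const_add x
      simpa using this
    have h1 : HasDerivAt (fun σ : ℝ => v (x + σ ^ 2 • y)) (fderiv ℝ v (x + σ ^ 2 • y) ((2 * σ) • y))
        σ := ((hv.differentiableOn (by norm_num)).differentiableAt
          (hU.mem_nhds hz)).hasFDerivAt.comp_hasDerivAt σ hp
    have h2 : HasDerivAt (fun σ : ℝ => fderiv ℝ v (x + σ ^ 2 • y))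
        (fderiv ℝ (fderiv ℝ v) (x + σ ^ 2 • y) ((2 * σ) • y)) σ :=
      ((hv1.differentiableOn (by norm_num)).differentiableAt
          (hU.mem_nhds hz)).hasFDerivAt.comp_hasDerivAt σ hp
    have h3 := h2.clm_apply (hasDerivAt_const σ y)
    have h4 : HasDerivAt (fun σ : ℝ => v (x + σ ^ 2 • y) - σ ^ 2 • fderiv ℝ v (x + σ ^ 2 • y) y)
      _ σ := h1.sub ((hasDerivAt_pow 2 σ).smul h3)
    refine h4.congr_deriv ?_
    have e1 : (fderiv ℝ (fderiv ℝ v) (x + σ ^ 2 • y)) ((2 * σ) • y) y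
        = (2 * σ) • fderiv ℝ (fderiv ℝ v) (x + σ ^ 2 • y) y y := by
      rw [map_smul]; rfl
    rw [e1]
    simp only [map_smul, map_zero, add_zero, smul_smul, Nat.cast_ofNat, Nat.add_one_sub_one,
      pow_one]
    rw [show σ ^ 2 * (2 * σ) = 2 * σ ^ 3 by ring]
    abel
  have hcint : ContinuousOn (fun σ : ℝ =>
      -((2 * σ ^ 3) • fderiv ℝ (fderiv ℝ v) (x + σ ^ 2 • y) y y)) (Set.uIcc 0 1) := by
    have : ContinuousOn (fun σ : ℝ => (2 * σ ^ 3)) (Set.uIcc 0 1) := by fun_prop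
    exact (this.smul ((hc2.clm_apply continuousOn_const).clm_apply continuousOn_const)).neg
  have hftc := intervalIntegral.integral_eq_sub_of_hasDerivAt hder hcint.intervalIntegrable
  have hvx : v x = v (x + y) - fderiv ℝ v (x + y) y
      - ∫ σ in (0 : ℝ)..1, -((2 * σ ^ 3) • fderiv ℝ (fderiv ℝ v) (x + σ ^ 2 • y) y y) := by
    rw [hftc]; simp
  have hI : ‖∫ σ in (0 : ℝ)..1, -((2 * σ ^ 3) • fderiv ℝ (fderiv ℝ v) (x + σ ^ 2 • y) y y)‖
      ≤ ‖y‖ ^ 2 * ∫ σ in (0 : ℝ)..1, 2 * σ ^ 3 * ‖iteratedFDeriv ℝ 2 v (x + σ ^ 2 • y)‖ := by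
    rw [← intervalIntegral.integral_const_mul]
    refine intervalIntegral.norm_integral_le_of_norm_le zero_le_one ?_ ?_
    · refine Eventually.of_forall fun σ hσ => ?_
      rw [norm_neg, norm_smul, ← norm_fderiv_fderiv_eq, Real.norm_of_nonneg (by
        have := hσ.1.le; positivity)]
      have := (fderiv ℝ (fderiv ℝ v) (x + σ ^ 2 • y)).le_opNorm₂ y y
      have h0 := hσ.1.le
      calc _ ≤ 2 * σ ^ 3 * (‖fderiv ℝ (fderiv ℝ v) (x + σ ^ 2 • y)‖ * ‖y‖ * ‖y‖) := by gcongr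
        _ = _ := by ring
    · refine ContinuousOn.intervalIntegrable ?_
      have hc3 := (continuousOn_norm_iteratedFDeriv hU hv le_rfl).comp hpath.continuousOn hmaps
      have : ContinuousOn (fun σ : ℝ => (2 * σ ^ 3)) (Set.uIcc 0 1) := by fun_prop
      exact continuousOn_const.mul (this.mul hc3)
  rw [norm_iteratedFDeriv_zero, ← norm_fderiv_eq_iterated]
  calc ‖v x‖ ≤ ‖v (x + y) - fderiv ℝ v (x + y) y‖ + _ := by rw [hvx]; exact norm_sub_le _ _
    _ ≤ ‖v (x + y)‖ + ‖fderiv ℝ v (x + y) y‖ + _ := by gcongr; exact norm_sub_le _ _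
    _ ≤ _ := by
      gcongr
      rw [mul_comm]
      exact ContinuousLinearMap.le_opNorm _ _

/-- The difference of the two sides is the variance of `G` on the unit interval. -/
lemma sq_intervalIntegral_le {G : ℝ → ℝ} (hG : ContinuousOn G (Set.uIcc 0 1)) :
    (∫ σ in (0 : ℝ)..1, G σ) ^ 2 ≤ ∫ σ in (0 : ℝ)..1, G σ ^ 2 := by
  set m := ∫ σ in (0 : ℝ)..1, G σ
  have h0 : 0 ≤ ∫ σ in (0 : ℝ)..1, (G σ - m) ^ 2 :=
    intervalIntegral.integral_nonneg zero_le_one fun _ _ => sq_nonneg _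
  have h1 : IntervalIntegrable (fun σ => G σ ^ 2) volume 0 1 := (hG.pow 2).intervalIntegrable
  have h2 : IntervalIntegrable (fun σ => 2 * m * G σ) volume 0 1 :=
    (continuousOn_const.mul hG).intervalIntegrable
  have h3 : ∫ σ in (0 : ℝ)..1, (G σ - m) ^ 2 = (∫ σ in (0 : ℝ)..1, G σ ^ 2) - 2 * m * m + m ^ 2 := by
    have : ∀ σ, (G σ - m) ^ 2 = G σ ^ 2 - 2 * m * G σ + m ^ 2 := fun σ => by ring
    simp_rw [this]
    rw [intervalIntegral.integral_add (h1.sub h2) intervalIntegrable_const,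
      intervalIntegral.integral_sub h1 h2, intervalIntegral.integral_const_mul]
    simp [m]
  nlinarith

lemma setIntegral_closedBall_eq (x : Space3) (ρ : ℝ) (G : Space3 → ℝ) :
    ∫ z in Metric.closedBall x ρ, G z = ∫ y in Metric.closedBall 0 ρ, G (x + y) := by
  have hmp := measurePreserving_add_left (volume : Measure Space3) x
  rw [← hmp.setIntegral_preimage_emb (MeasurableEquiv.addLeft x).measurableEmbedding]
  congr 2
  ext y; simp

lemma smul_mem_closedBall_zero {σ ρ : ℝ} (hσ : σ ∈ Set.Icc (0 : ℝ) 1) {y : Space3}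
    (hy : y ∈ Metric.closedBall (0 : Space3) ρ) : σ ^ 2 • y ∈ Metric.closedBall (0 : Space3) ρ := by
  simp only [mem_closedBall_zero_iff] at hy ⊢
  rw [norm_smul, Real.norm_of_nonneg (sq_nonneg σ)]
  have : σ ^ 2 ≤ 1 := pow_le_one₀ hσ.1 hσ.2
  nlinarith [norm_nonneg y]

open scoped Pointwise in
-- The Jacobian of the dilation cancels `σ^6`, and the dilated ball lies inside the original one.
lemma setIntegral_dilation_le {G : Space3 → ℝ} {ρ σ : ℝ} (hG0 : ∀ y, 0 ≤ G y)
    (hG : IntegrableOn G (Metric.closedBall 0 ρ)) (hσ : σ ∈ Set.Ioc (0 : ℝ) 1) :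
    σ ^ 6 * ∫ y in Metric.closedBall 0 ρ, G (σ ^ 2 • y) ≤ ∫ y in Metric.closedBall 0 ρ, G y := by
  have hσ2 : 0 < σ ^ 2 := pow_pos hσ.1 2
  rw [Measure.setIntegral_comp_smul_of_pos volume G _ hσ2]
  have hsub : σ ^ 2 • Metric.closedBall (0 : Space3) ρ ⊆ Metric.closedBall 0 ρ := by
    rintro _ ⟨y, hy, rfl⟩
    exact smul_mem_closedBall_zero ⟨hσ.1.le, hσ.2⟩ hy
  have hfr : Module.finrank ℝ Space3 = 3 := by simp
  rw [hfr, smul_eq_mul]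
  have hcancel : ∀ I : ℝ, σ ^ 6 * (((σ ^ 2) ^ 3)⁻¹ * I) = I := fun I => by
    have : σ ≠ 0 := hσ.1.ne'
    field_simp
  rw [hcancel]
  exact setIntegral_mono_set hG (Eventually.of_forall hG0) hsub.eventuallyLE

/-- The Sobolev embedding `H² ⊂ L^∞` in three dimensions, scaled to a ball of radius `ρ`. -/
lemma sobolev_closedBall [CompleteSpace E] {v : Space3 → E} {U : Set Space3} (hU : IsOpen U)
    (hv : ContDiffOn ℝ 2 v U) {x : Space3} {ρ : ℝ} (hρ : 0 < ρ)
    (hball : Metric.closedBall x ρ ⊆ U) :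
    volume.real (Metric.closedBall x ρ) * ‖v x‖ ^ 2 ≤
      3 * ((∫ z in Metric.closedBall x ρ, ‖iteratedFDeriv ℝ 0 v z‖ ^ 2)
        + ρ ^ 2 * (∫ z in Metric.closedBall x ρ, ‖iteratedFDeriv ℝ 1 v z‖ ^ 2)
        + 4 * ρ ^ 4 * ∫ z in Metric.closedBall x ρ, ‖iteratedFDeriv ℝ 2 v z‖ ^ 2) := by
  set B : Set Space3 := Metric.closedBall 0 ρ with hB
  have hBc : IsCompact B := isCompact_closedBall _ _
  have htrans := setIntegral_closedBall_eq x ρ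
  have hvol : volume.real (Metric.closedBall x ρ) = volume.real B := by
    have h := htrans (fun _ => 1)
    rwa [setIntegral_const, setIntegral_const, smul_eq_mul, smul_eq_mul, mul_one, mul_one] at h
  have hmem : ∀ y ∈ B, x + y ∈ U := fun y hy => hball (by
    rw [Metric.mem_closedBall, dist_self_add_left]
    exact mem_closedBall_zero_iff.1 hy)
  have hmemσ : ∀ σ ∈ Set.Icc (0 : ℝ) 1, ∀ y ∈ B, σ ^ 2 • y ∈ B :=
    fun σ hσ y hy => smul_mem_closedBall_zero hσ hy
  have hcl : ∀ l ≤ 2, ContinuousOn (fun y => ‖iteratedFDeriv ℝ l v (x + y)‖ ^ 2) B := by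
    intro l hl
    exact ((continuousOn_norm_iteratedFDeriv hU hv hl).comp (by fun_prop) hmem).pow 2
  have hil : ∀ l ≤ 2, IntegrableOn (fun y => ‖iteratedFDeriv ℝ l v (x + y)‖ ^ 2) B :=
    fun l hl => (hcl l hl).integrableOn_compact hBc
  set S : Space3 → ℝ → ℝ := fun y σ => 4 * σ ^ 6 * ‖iteratedFDeriv ℝ 2 v (x + σ ^ 2 • y)‖ ^ 2
  have hScont : ContinuousOn (Function.uncurry S) (B ×ˢ Set.Icc (0 : ℝ) 1) := by
    have h1 : ContinuousOn (fun p : Space3 × ℝ => ‖iteratedFDeriv ℝ 2 v (x + p.2 ^ 2 • p.1)‖)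
        (B ×ˢ Set.Icc (0 : ℝ) 1) :=
      (continuousOn_norm_iteratedFDeriv hU hv le_rfl).comp (by fun_prop)
        fun p hp => hmem _ (hmemσ _ hp.2 _ hp.1)
    have h2 : ContinuousOn (fun p : Space3 × ℝ => 4 * p.2 ^ 6) (B ×ˢ Set.Icc (0 : ℝ) 1) := by
      fun_prop
    exact h2.mul (h1.pow 2)
  have hSint : Integrable (Function.uncurry S)
      ((volume.restrict B).prod (volume.restrict (Set.Ioc (0 : ℝ) 1))) := by
    rw [Measure.prod_restrict]
    exact (hScont.integrableOn_compact (hBc.prod isCompact_Icc)).mono_set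
      (Set.prod_mono le_rfl Set.Ioc_subset_Icc_self)
  set J : ℕ → ℝ := fun l => ∫ y in B, ‖iteratedFDeriv ℝ l v (x + y)‖ ^ 2 with hJ
  -- Taylor's estimate, squared with `(a + b + c)² ≤ 3 (a² + b² + c²)`; the integral remainder is
  -- squared under the integral sign. Averaging over `y ∈ B` then gives the result.
  have hpt : ∀ y ∈ B, ‖v x‖ ^ 2 ≤ 3 * (‖iteratedFDeriv ℝ 0 v (x + y)‖ ^ 2
      + ρ ^ 2 * ‖iteratedFDeriv ℝ 1 v (x + y)‖ ^ 2
      + ρ ^ 4 * ∫ σ in Set.Ioc (0 : ℝ) 1, S y σ) := by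
    intro y hy
    have hn : ‖y‖ ≤ ρ := mem_closedBall_zero_iff.1 hy
    have ht := norm_le_taylor_sq hU hv (x := x) (y := y) fun σ hσ => hmem _ (hmemσ σ hσ y hy)
    set a := ‖iteratedFDeriv ℝ 0 v (x + y)‖
    set b := ‖iteratedFDeriv ℝ 1 v (x + y)‖
    have hcG : ContinuousOn (fun σ : ℝ => 2 * σ ^ 3 * ‖iteratedFDeriv ℝ 2 v (x + σ ^ 2 • y)‖)
        (Set.uIcc 0 1) := by
      rw [Set.uIcc_of_le zero_le_one]
      have h1 : ContinuousOn (fun p : ℝ => ‖iteratedFDeriv ℝ 2 v (x + p ^ 2 • y)‖)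
          (Set.Icc (0 : ℝ) 1) :=
        (continuousOn_norm_iteratedFDeriv hU hv le_rfl).comp (by fun_prop)
          fun p hp => hmem _ (hmemσ _ hp _ hy)
      have h2 : ContinuousOn (fun p : ℝ => 2 * p ^ 3) (Set.Icc (0 : ℝ) 1) := by fun_prop
      exact h2.mul h1
    have hsq := sq_intervalIntegral_le hcG
    set c := ∫ σ in (0 : ℝ)..1, 2 * σ ^ 3 * ‖iteratedFDeriv ℝ 2 v (x + σ ^ 2 • y)‖
    have hc0 : 0 ≤ c := intervalIntegral.integral_nonneg zero_le_one fun σ hσ => by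
      have := hσ.1; positivity
    have hS : ∫ σ in Set.Ioc (0 : ℝ) 1, S y σ = ∫ σ in (0 : ℝ)..1,
        (2 * σ ^ 3 * ‖iteratedFDeriv ℝ 2 v (x + σ ^ 2 • y)‖) ^ 2 := by
      rw [intervalIntegral.integral_of_le zero_le_one]
      congr 1; ext σ; simp only [S]; ring
    rw [hS]
    have ha : 0 ≤ a := norm_nonneg _
    have hb : 0 ≤ b := norm_nonneg _
    have h1 : ‖v x‖ ≤ a + ρ * b + ρ ^ 2 * c := ht.trans (by gcongr)
    calc ‖v x‖ ^ 2 ≤ (a + ρ * b + ρ ^ 2 * c) ^ 2 := by gcongr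
      _ ≤ 3 * (a ^ 2 + ρ ^ 2 * b ^ 2 + ρ ^ 4 * c ^ 2) := by
        nlinarith [sq_nonneg (a - ρ * b), sq_nonneg (a - ρ ^ 2 * c),
          sq_nonneg (ρ * b - ρ ^ 2 * c)]
      _ ≤ _ := by gcongr
  have hS2 : Integrable (fun y => ∫ σ in Set.Ioc (0 : ℝ) 1, S y σ) (volume.restrict B) :=
    hSint.integral_prod_left
  have hfub : ∫ y in B, ∫ σ in Set.Ioc (0 : ℝ) 1, S y σ ≤ 4 * J 2 := by
    rw [integral_integral_swap hSint]
    have hle : ∀ σ ∈ Set.Ioc (0 : ℝ) 1, ∫ y in B, S y σ ≤ 4 * J 2 := by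
      intro σ hσ
      have h := setIntegral_dilation_le (fun z => sq_nonneg _) (hil 2 le_rfl) hσ
      simp only [S]
      rw [integral_const_mul]
      linarith
    calc _ ≤ ∫ σ in Set.Ioc (0 : ℝ) 1, 4 * J 2 := by
          refine setIntegral_mono_on hSint.integral_prod_right
            (integrableOn_const measure_Ioc_lt_top.ne) measurableSet_Ioc hle
      _ = _ := by simp
  rw [hvol, htrans, htrans, htrans]
  have hfin : volume B ≠ ⊤ := hBc.measure_ne_top
  calc volume.real B * ‖v x‖ ^ 2 = ∫ y in B, ‖v x‖ ^ 2 := by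
        rw [setIntegral_const, smul_eq_mul]
    _ ≤ ∫ y in B, 3 * (‖iteratedFDeriv ℝ 0 v (x + y)‖ ^ 2
      + ρ ^ 2 * ‖iteratedFDeriv ℝ 1 v (x + y)‖ ^ 2
      + ρ ^ 4 * ∫ σ in Set.Ioc (0 : ℝ) 1, S y σ) := by
        refine setIntegral_mono_on (integrableOn_const hfin) ?_ Metric.isClosed_closedBall.measurableSet hpt
        exact (((hil 0 (by norm_num)).add ((hil 1 (by norm_num)).const_mul _)).add
          (hS2.const_mul _)).const_mul _
    _ = 3 * (J 0 + ρ ^ 2 * J 1 + ρ ^ 4 * ∫ y in B, ∫ σ in Set.Ioc (0 : ℝ) 1, S y σ) := by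
        have h01 := integral_add (hil 0 (by norm_num)) ((hil 1 (by norm_num)).const_mul (ρ ^ 2))
        have h012 := integral_add ((hil 0 (by norm_num)).add
          ((hil 1 (by norm_num)).const_mul (ρ ^ 2))) (hS2.const_mul (ρ ^ 4))
        simp only [Pi.add_apply] at h012
        rw [integral_const_mul, h012, h01, integral_const_mul, integral_const_mul]
    _ ≤ 3 * (J 0 + ρ ^ 2 * J 1 + ρ ^ 4 * (4 * J 2)) := by gcongr
    _ = _ := by ring

end Sobolev

/-! ### Pointwise decay from weighted Sobolev norms -/

section WeightedSobolev

variable {E : Type*} [NormedAddCommGroup E] [NormedSpace ℝ E]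

lemma isOpen_outside (R : ℝ) : IsOpen (outside R) := isOpen_lt continuous_const continuous_norm

lemma outside_mem_cobounded (R : ℝ) : outside R ∈ Bornology.cobounded Space3 := by
  have := (tendsto_norm_cobounded_atTop (E := Space3)).eventually (eventually_gt_atTop R)
  exact this

lemma outside_antitone : Antitone outside := fun _ _ h _ hx => lt_of_le_of_lt h hx

lemma tendsto_setIntegral_outside {G : Space3 → ℝ} {R : ℝ} (hG : IntegrableOn G (outside R)) :
    Tendsto (fun r => ∫ x in outside r, G x) atTop (𝓝 0) := by
  have h := tendsto_setIntegral_of_antitone (μ := volume) (f := G) (s := outside)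
    (fun r => (isOpen_outside r).measurableSet) outside_antitone ⟨R, hG⟩
  have h0 : ⋂ r, outside r = ∅ := by
    ext x
    simp only [Set.mem_iInter, Set.mem_empty_iff_false, iff_false, not_forall]
    exact ⟨‖x‖, fun h => lt_irrefl ‖x‖ h⟩
  rwa [h0, setIntegral_empty] at h

/-- The range `[s/2, 3s]` contains `1 + ‖z‖` for `s = ‖x‖ ≥ 1` and `z` in the ball of radius `‖x‖/2`
about `x`. The worst case is the left or the right end, depending on the sign of `β`. -/
lemma rpow_comparable (β : ℝ) : ∃ k > 0, ∀ s t : ℝ, 0 < s → s / 2 ≤ t → t ≤ 3 * s →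
    k * s ^ β ≤ t ^ β := by
  rcases le_total 0 β with h | h
  · refine ⟨(1 / 2) ^ β, by positivity, fun s t hs h1 _ => ?_⟩
    rw [← Real.mul_rpow (by norm_num) hs.le]
    exact Real.rpow_le_rpow (by positivity) (by linarith) h
  · refine ⟨3 ^ β, by positivity, fun s t hs h1 h2 => ?_⟩
    rw [← Real.mul_rpow (by norm_num) hs.le]
    exact Real.rpow_le_rpow_of_nonpos (by linarith) h2 h

lemma closedBall_half_norm_subset {x : Space3} {r : ℝ} (hx : 0 < ‖x‖) (hr : r ≤ ‖x‖ / 3) :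
    Metric.closedBall x (‖x‖ / 2) ⊆ outside r := by
  intro z hz
  rw [Metric.mem_closedBall, dist_eq_norm] at hz
  have h1 := norm_sub_norm_le x z
  rw [norm_sub_rev] at h1
  show r < ‖z‖
  linarith

/-- On a ball of radius `‖x‖/2` about `x` the weight is comparable to its value at `x`. The bound is
by the tail of a convergent integral, which tends to zero; hence decay with `o` and not merely `O`.
-/
lemma setIntegral_ball_le_weighted {G : Space3 → ℝ} (hG0 : ∀ z, 0 ≤ G z) {R : ℝ} (β : ℝ)
    (hG : IntegrableOn (fun z => (1 + ‖z‖) ^ β * G z) (outside R)) :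
    ∃ C > 0, ∀ x : Space3, 1 ≤ ‖x‖ → R ≤ ‖x‖ / 3 →
      ‖x‖ ^ β * ∫ z in Metric.closedBall x (‖x‖ / 2), G z ≤
        C * ∫ z in outside (‖x‖ / 3), (1 + ‖z‖) ^ β * G z := by
  obtain ⟨k, hk, hkβ⟩ := rpow_comparable β
  refine ⟨k⁻¹, inv_pos.2 hk, fun x hx hR => ?_⟩
  have hx0 : 0 < ‖x‖ := by linarith
  have hsub := closedBall_half_norm_subset hx0 (le_refl (‖x‖ / 3))
  have hint : IntegrableOn (fun z => (1 + ‖z‖) ^ β * G z) (outside (‖x‖ / 3)) :=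
    hG.mono_set (outside_antitone hR)
  have hnn : ∀ z : Space3, 0 ≤ (1 + ‖z‖) ^ β * G z := fun z => by
    have := hG0 z; positivity
  have h1 : ∫ z in Metric.closedBall x (‖x‖ / 2), k * ‖x‖ ^ β * G z ≤
      ∫ z in Metric.closedBall x (‖x‖ / 2), (1 + ‖z‖) ^ β * G z := by
    refine setIntegral_mono_of_nonneg ?_ ?_ (hint.mono_set hsub)
    · exact fun z _ => by have := hG0 z; positivity
    · intro z hz
      rw [Metric.mem_closedBall, dist_eq_norm] at hz
      have h2 := norm_sub_norm_le x z
      have h3 := norm_sub_norm_le z x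
      rw [norm_sub_rev] at h2
      have := hkβ ‖x‖ (1 + ‖z‖) hx0 (by linarith) (by linarith)
      exact mul_le_mul_of_nonneg_right this (hG0 z)
  have h2 : ∫ z in Metric.closedBall x (‖x‖ / 2), (1 + ‖z‖) ^ β * G z ≤
      ∫ z in outside (‖x‖ / 3), (1 + ‖z‖) ^ β * G z :=
    setIntegral_mono_set hint (Eventually.of_forall hnn) hsub.eventuallyLE
  rw [integral_const_mul] at h1
  have h3 := h1.trans h2
  rw [mul_assoc] at h3
  rwa [inv_mul_eq_div, le_div_iff₀' hk]

/-- The weighted Sobolev embedding: functions with finite weighted `H²` norm near infinity decay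
pointwise. -/
theorem isLittleO_of_weighted_sobolev [CompleteSpace E] {v : Space3 → E} {R α : ℝ}
    (hv : ContDiffOn ℝ 2 v (outside R))
    (hint : ∀ l : ℕ, l ≤ 2 → IntegrableOn
      (fun x => (1 + ‖x‖) ^ (-2 * α - 3 + 2 * (l : ℝ)) * ‖iteratedFDeriv ℝ l v x‖ ^ 2)
      (outside R)) :
    v =o[Bornology.cobounded Space3] fun x => ‖x‖ ^ α := by
  choose C hC0 hC using fun l : Fin 3 => setIntegral_ball_le_weighted (fun z => sq_nonneg _) _
    (hint l (by omega))
  set T : Fin 3 → ℝ → ℝ := fun l r =>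
    ∫ z in outside r, (1 + ‖z‖) ^ (-2 * α - 3 + 2 * ((l : ℕ) : ℝ)) * ‖iteratedFDeriv ℝ l v z‖ ^ 2
    with hT
  have hTlim : ∀ l, Tendsto (T l) atTop (𝓝 0) := fun l =>
    tendsto_setIntegral_outside (hint l (by omega))
  set c := volume.real (Metric.ball (0 : Space3) 1) with hc
  have hc0 : 0 < c := ENNReal.toReal_pos (Metric.measure_ball_pos _ _ one_pos).ne'
    measure_ball_lt_top.ne
  -- The factor is `24 = 3 · 2³`: the 3 of the Sobolev inequality times the 8 in the volume `c
  -- (‖x‖/2)³`.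
  set Q : ℝ → ℝ := fun r => 24 / c * (C 0 * T 0 r + C 1 * T 1 r + C 2 * T 2 r) with hQ
  have hQlim : Tendsto Q atTop (𝓝 0) := by
    have := ((((hTlim 0).const_mul (C 0)).add ((hTlim 1).const_mul (C 1))).add
      ((hTlim 2).const_mul (C 2))).const_mul (24 / c)
    simpa using this
  have hbound : ∀ x : Space3, 1 ≤ ‖x‖ → R ≤ ‖x‖ / 3 →
      ‖v x‖ ^ 2 ≤ Q (‖x‖ / 3) * (‖x‖ ^ α) ^ 2 := by
    intro x hx hR
    have hx0 : 0 < ‖x‖ := by linarith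
    have hs := sobolev_closedBall (isOpen_outside R) hv (x := x) (ρ := ‖x‖ / 2) (by linarith)
      (closedBall_half_norm_subset hx0 hR)
    have hvol : volume.real (Metric.closedBall x (‖x‖ / 2)) = (‖x‖ / 2) ^ 3 * c := by
      rw [Measure.addHaar_real_closedBall _ _ (by positivity)]
      simp [hc]
    rw [hvol] at hs
    have h0 := hC 0 x hx hR
    have h1 := hC 1 x hx hR
    have h2 := hC 2 x hx hR
    -- Scaling: after multiplication by `‖x‖^(2α+3)` the weight of the `l`-th derivative is
    -- `‖x‖^(2l)`, the same power as `ρ^(2l)` in the Sobolev inequality on a ball with `ρ = ‖x‖/2`.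
    have hp : ∀ l : ℕ, ‖x‖ ^ (-2 * α - 3 + 2 * (l : ℝ)) * ((‖x‖ ^ α) ^ 2 * ‖x‖ ^ 3)
        = ‖x‖ ^ (2 * l) := by
      intro l
      rw [← Real.rpow_natCast, ← Real.rpow_natCast, ← Real.rpow_natCast, ← Real.rpow_mul hx0.le,
        ← Real.rpow_add hx0, ← Real.rpow_add hx0]
      congr 1; push_cast; ring
    have hp0 := hp 0
    have hp1 := hp 1
    have hp2 := hp 2
    simp only [Fin.val_zero, Fin.val_one, Fin.val_two] at h0 h1 h2
    set J0 := ∫ z in Metric.closedBall x (‖x‖ / 2), ‖iteratedFDeriv ℝ 0 v z‖ ^ 2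
    set J1 := ∫ z in Metric.closedBall x (‖x‖ / 2), ‖iteratedFDeriv ℝ 1 v z‖ ^ 2
    set J2 := ∫ z in Metric.closedBall x (‖x‖ / 2), ‖iteratedFDeriv ℝ 2 v z‖ ^ 2
    set A := (‖x‖ ^ α) ^ 2
    have hA : 0 ≤ A * ‖x‖ ^ 3 := by positivity
    have e0 : J0 ≤ A * ‖x‖ ^ 3 * (C 0 * T 0 (‖x‖ / 3)) := by
      have := mul_le_mul_of_nonneg_left h0 hA
      rw [← mul_assoc, mul_comm (A * _), hp0, mul_zero, pow_zero, one_mul] at this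
      exact this
    have e1 : ‖x‖ ^ 2 * J1 ≤ A * ‖x‖ ^ 3 * (C 1 * T 1 (‖x‖ / 3)) := by
      have := mul_le_mul_of_nonneg_left h1 hA
      rw [← mul_assoc, mul_comm (A * _), hp1] at this
      exact this
    have e2 : ‖x‖ ^ 4 * J2 ≤ A * ‖x‖ ^ 3 * (C 2 * T 2 (‖x‖ / 3)) := by
      have := mul_le_mul_of_nonneg_left h2 hA
      rw [← mul_assoc, mul_comm (A * _), hp2] at this
      exact this
    have hJ1 : 0 ≤ J1 := integral_nonneg fun _ => sq_nonneg _
    have hJ2 : 0 ≤ J2 := integral_nonneg fun _ => sq_nonneg _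
    have hJ1' : 0 ≤ ‖x‖ ^ 2 * J1 := by positivity
    have h3 : c * ‖x‖ ^ 3 * ‖v x‖ ^ 2 ≤ c * ‖x‖ ^ 3 * (Q (‖x‖ / 3) * A) := by
      have hq : c * ‖x‖ ^ 3 * (Q (‖x‖ / 3) * A) = 24 * (A * ‖x‖ ^ 3 * (C 0 * T 0 (‖x‖ / 3))
        + A * ‖x‖ ^ 3 * (C 1 * T 1 (‖x‖ / 3)) + A * ‖x‖ ^ 3 * (C 2 * T 2 (‖x‖ / 3))) := by
        simp only [hQ]; field_simp
      rw [hq]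
      have hs' : c * ‖x‖ ^ 3 * ‖v x‖ ^ 2 ≤ 24 * J0 + 6 * (‖x‖ ^ 2 * J1) + 6 * (‖x‖ ^ 4 * J2) := by
        linarith
      have hJ4 : 0 ≤ ‖x‖ ^ 4 * J2 := by positivity
      linarith
    exact le_of_mul_le_mul_left h3 (by positivity)
  rw [Asymptotics.isLittleO_iff]
  intro ε hε
  have hnorm := tendsto_norm_cobounded_atTop (E := Space3)
  have hQ' : ∀ᶠ x in Bornology.cobounded Space3, Q (‖x‖ / 3) < ε ^ 2 :=
    (hQlim.comp (hnorm.atTop_div_const (by norm_num : (0 : ℝ) < 3))).eventually_lt_const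
      (by positivity)
  filter_upwards [hQ', hnorm.eventually_ge_atTop 1, hnorm.eventually_ge_atTop (3 * R)]
    with x h1 h2 h3
  have h4 := hbound x h2 (by linarith)
  have hp : 0 ≤ ‖x‖ ^ α := by positivity
  rw [Real.norm_of_nonneg hp]
  refine le_of_sq_le_sq ?_ (by positivity)
  calc _ ≤ _ := h4
    _ ≤ ε ^ 2 * (‖x‖ ^ α) ^ 2 := by gcongr
    _ = _ := by ring

lemma IsOSobolev.isLittleO {α : ℝ} {v : Space3 → ℝ} (h : IsOSobolev 2 α v) :
    v =o[Bornology.cobounded Space3] fun x => ‖x‖ ^ α := by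
  obtain ⟨R, hv, hint⟩ := h
  exact isLittleO_of_weighted_sobolev hv hint

lemma IsOSobolev.of_le {k m : ℕ} {α : ℝ} {v : Space3 → ℝ} (h : IsOSobolev k α v) (hm : m ≤ k) :
    IsOSobolev m α v := by
  obtain ⟨R, hv, hint⟩ := h
  exact ⟨R, hv.of_le (by exact_mod_cast hm), fun l hl => hint l (hl.trans hm)⟩

/-- The weight of order `l + 1` at the rate `α` is the weight of order `l` at the rate `α - 1`, so
the derivative lies in the weighted H² space to which the embedding applies. -/
lemma IsOSobolev.fderiv_isLittleO {α : ℝ} {v : Space3 → ℝ} (h : IsOSobolev 3 α v) :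
    fderiv ℝ v =o[Bornology.cobounded Space3] fun x => ‖x‖ ^ (α - 1) := by
  obtain ⟨R, hv, hint⟩ := h
  refine isLittleO_of_weighted_sobolev (R := R)
    (hv.fderiv_of_isOpen (isOpen_outside R) (by norm_num)) fun l hl => ?_
  simp only [norm_iteratedFDeriv_fderiv]
  refine (hint (l + 1) (by omega)).congr_fun (fun x _ => ?_) (isOpen_outside R).measurableSet
  dsimp only
  congr 2
  push_cast; ring

end WeightedSobolev

/-! ### Spherical coordinates and the volume form -/

section SphereCalculus

/-- The derivative of `spherePt` in `θ`. -/
noncomputable def sphereDθ (R θ φ : ℝ) : Space3 :=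
  !₂[R * (Real.cos θ * Real.cos φ), R * (Real.cos θ * Real.sin φ), -(R * Real.sin θ)]

/-- The derivative of `spherePt` in `φ`. -/
noncomputable def sphereDφ (R θ φ : ℝ) : Space3 :=
  !₂[-(R * (Real.sin θ * Real.sin φ)), R * (Real.sin θ * Real.cos φ), 0]

lemma hasDerivAt_euclidean {a b c : ℝ → ℝ} {a' b' c' t : ℝ} (ha : HasDerivAt a a' t)
    (hb : HasDerivAt b b' t) (hc : HasDerivAt c c' t) :
    HasDerivAt (fun s => (!₂[a s, b s, c s] : Space3)) !₂[a', b', c'] t := by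
  have h : HasDerivAt (fun s => ![a s, b s, c s]) ![a', b', c'] t := by
    rw [hasDerivAt_pi]
    intro i
    fin_cases i
    · exact ha
    · exact hb
    · exact hc
  exact (PiLp.continuousLinearEquiv 2 ℝ
    (fun _ : Fin 3 => ℝ)).symm.toContinuousLinearMap.hasFDerivAt.comp_hasDerivAt t h

lemma hasDerivAt_spherePt_θ (R θ φ : ℝ) :
    HasDerivAt (fun s => spherePt R s φ) (sphereDθ R θ φ) θ := by
  refine hasDerivAt_euclidean (((Real.hasDerivAt_sin θ).mul_const _).const_mul R)
    (((Real.hasDerivAt_sin θ).mul_const _).const_mul R) ?_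
  simpa using (Real.hasDerivAt_cos θ).const_mul R

lemma hasDerivAt_spherePt_φ (R θ φ : ℝ) :
    HasDerivAt (fun s => spherePt R θ s) (sphereDφ R θ φ) φ := by
  refine hasDerivAt_euclidean ?_ (((Real.hasDerivAt_sin φ).const_mul _).const_mul R)
    (hasDerivAt_const _ _)
  simpa using ((Real.hasDerivAt_cos φ).const_mul (Real.sin θ)).const_mul R

lemma continuous_spherePt (R : ℝ) : Continuous fun p : ℝ × ℝ => spherePt R p.1 p.2 := by
  unfold spherePt
  fun_prop

lemma continuous_sphereDθ (R : ℝ) : Continuous fun p : ℝ × ℝ => sphereDθ R p.1 p.2 := by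
  unfold sphereDθ
  fun_prop

lemma continuous_sphereDφ (R : ℝ) : Continuous fun p : ℝ × ℝ => sphereDφ R p.1 p.2 := by
  unfold sphereDφ
  fun_prop

lemma norm_spherePt {R : ℝ} (hR : 0 ≤ R) (θ φ : ℝ) : ‖spherePt R θ φ‖ = R := by
  rw [EuclideanSpace.norm_eq, Real.sqrt_eq_iff_eq_sq (by positivity) hR]
  simp only [Fin.sum_univ_three, Real.norm_eq_abs, sq_abs, spherePt]
  simp
  have h1 := Real.sin_sq_add_cos_sq θ
  have h2 := Real.sin_sq_add_cos_sq φ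
  linear_combination R ^ 2 * Real.sin θ ^ 2 * h2 + R ^ 2 * h1

lemma event_zero (t : ℝ) (x : Space3) : event t x 0 = t := rfl
lemma event_succ (t : ℝ) (x : Space3) (i : Fin 3) : event t x i.succ = x i := rfl

lemma hasDerivAt_event {a : ℝ → ℝ} {x : ℝ → Space3} {a' s : ℝ} {x' : Space3}
    (ha : HasDerivAt a a' s) (hx : HasDerivAt x x' s) :
    HasDerivAt (fun s => event (a s) (x s)) (event a' x') s := by
  rw [hasDerivAt_pi]
  intro i
  refine Fin.cases ?_ (fun j => ?_) i
  · exact ha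
  · exact ((EuclideanSpace.proj (𝕜 := ℝ) j).hasFDerivAt.comp_hasDerivAt s hx)

lemma continuous_event : Continuous fun p : ℝ × Space3 => event p.1 p.2 := by
  rw [continuous_pi_iff]
  intro i
  refine Fin.cases ?_ (fun j => ?_) i
  · exact continuous_fst
  · exact (EuclideanSpace.proj (𝕜 := ℝ) j).continuous.comp continuous_snd

lemma fderiv_apply_eq_sum_pd (F : Event → ℝ) (q w : Event) :
    fderiv ℝ F q w = ∑ μ, w μ * pd μ F q := by
  conv_lhs => rw [← Finset.univ_sum_single w]
  rw [map_sum]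
  refine Finset.sum_congr rfl fun μ _ => ?_
  rw [pd, coordVec, ← smul_eq_mul, ← map_smul]
  congr 1
  ext ν
  by_cases h : ν = μ
  · subst h; simp
  · simp [h]

lemma hasDerivAt_comp_event {F : Event → ℝ} {a : ℝ → ℝ} {x : ℝ → Space3} {a' s : ℝ} {x' : Space3}
    (hF : DifferentiableAt ℝ F (event (a s) (x s)))
    (ha : HasDerivAt a a' s) (hx : HasDerivAt x x' s) :
    HasDerivAt (fun s => F (event (a s) (x s)))
      (a' * pd 0 F (event (a s) (x s)) + x' 0 * pd 1 F (event (a s) (x s))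
        + x' 1 * pd 2 F (event (a s) (x s)) + x' 2 * pd 3 F (event (a s) (x s))) s := by
  have h := hF.hasFDerivAt.comp_hasDerivAt s (hasDerivAt_event ha hx)
  rw [fderiv_apply_eq_sum_pd, Fin.sum_univ_four] at h
  exact h

lemma vol4_eq (a b v w : Event) : vol4 a b v w =
    (a 0 * b 1 - a 1 * b 0) * (v 2 * w 3 - v 3 * w 2)
    - (a 0 * b 2 - a 2 * b 0) * (v 1 * w 3 - v 3 * w 1)
    + (a 0 * b 3 - a 3 * b 0) * (v 1 * w 2 - v 2 * w 1)
    + (a 1 * b 2 - a 2 * b 1) * (v 0 * w 3 - v 3 * w 0)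
    - (a 1 * b 3 - a 3 * b 1) * (v 0 * w 2 - v 2 * w 0)
    + (a 2 * b 3 - a 3 * b 2) * (v 0 * w 1 - v 1 * w 0) := by
  simp [vol4, Matrix.det_succ_row_zero, Fin.sum_univ_succ, Fin.succAbove]
  ring

/-- Each unordered pair of indices is counted twice, and the minus sign comes from the reversed
order of `∂_β` and `∂_α` in `dS_{αβ}`. -/
lemma sum_sum_vol4 {V : Fin 4 → Fin 4 → ℝ} (hV : ∀ α β, V α β = -V β α) (v w : Event) :
    ∑ α, ∑ β, V α β * vol4 (coordVec β) (coordVec α) v w = -2 *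
      (V 0 1 * (v 2 * w 3 - v 3 * w 2) - V 0 2 * (v 1 * w 3 - v 3 * w 1)
      + V 0 3 * (v 1 * w 2 - v 2 * w 1) + V 1 2 * (v 0 * w 3 - v 3 * w 0)
      - V 1 3 * (v 0 * w 2 - v 2 * w 0) + V 2 3 * (v 0 * w 1 - v 1 * w 0)) := by
  have h00 := hV 0 0
  have h11 := hV 1 1
  have h22 := hV 2 2
  have h33 := hV 3 3
  simp only [Fin.sum_univ_four, vol4_eq, coordVec]
  simp [hV 1 0, hV 2 0, hV 3 0, hV 2 1, hV 3 1, hV 3 2]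
  ring

lemma sum_vol4_time {D : Fin 4 → ℝ} (v w : Event) (hv : v 0 = 0) (hw : w 0 = 0) :
    ∑ β, D β * vol4 (coordVec β) (coordVec 0) v w =
      -(D 1 * (v 2 * w 3 - v 3 * w 2) - D 2 * (v 1 * w 3 - v 3 * w 1)
      + D 3 * (v 1 * w 2 - v 2 * w 1)) := by
  simp only [Fin.sum_univ_four, vol4_eq, coordVec]
  simp [hv, hw]
  ring

end SphereCalculus

/-! ### Divergence theorems on the sphere and on a cylinder over it -/

section Stokes

open Real in
-- The fundamental theorem of calculus in each variable. In `φ` the boundary terms cancel by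
-- periodicity; in `θ` they cancel in the applications because `∂_φ x` vanishes at both poles.
lemma integral_sphere_divergence_eq_zero {P P' Q Q' : ℝ → ℝ → ℝ}
    (hP : ∀ θ φ, HasDerivAt (fun θ => P θ φ) (P' θ φ) θ)
    (hQ : ∀ θ φ, HasDerivAt (fun φ => Q θ φ) (Q' θ φ) φ)
    (hP' : Continuous fun p : ℝ × ℝ => P' p.1 p.2) (hQ' : Continuous fun p : ℝ × ℝ => Q' p.1 p.2)
    (hPend : ∀ φ, P π φ = P 0 φ) (hQend : ∀ θ, Q θ (2 * π) = Q θ 0) :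
    ∫ θ in (0 : ℝ)..π, ∫ φ in (0 : ℝ)..(2 * π), (P' θ φ + Q' θ φ) = 0 := by
  have hc1 : ∀ θ, Continuous fun φ => P' θ φ := fun θ => hP'.comp (by fun_prop : Continuous fun φ => (θ, φ))
  have hc2 : ∀ θ, Continuous fun φ => Q' θ φ := fun θ => hQ'.comp (by fun_prop : Continuous fun φ => (θ, φ))
  have hc3 : ∀ φ, Continuous fun θ => P' θ φ := fun φ => hP'.comp (by fun_prop : Continuous fun θ => (θ, φ))
  have hQ0 : ∀ θ, ∫ φ in (0 : ℝ)..(2 * π), Q' θ φ = 0 := fun θ => by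
    rw [intervalIntegral.integral_eq_sub_of_hasDerivAt (fun φ _ => hQ θ φ)
      ((hc2 θ).intervalIntegrable _ _), hQend, sub_self]
  have hP0 : ∀ φ, ∫ θ in (0 : ℝ)..π, P' θ φ = 0 := fun φ => by
    rw [intervalIntegral.integral_eq_sub_of_hasDerivAt (fun θ _ => hP θ φ)
      ((hc3 φ).intervalIntegrable _ _), hPend, sub_self]
  have h1 : ∀ θ, ∫ φ in (0 : ℝ)..(2 * π), (P' θ φ + Q' θ φ) = ∫ φ in (0 : ℝ)..(2 * π), P' θ φ :=
    fun θ => by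
      rw [intervalIntegral.integral_add ((hc1 θ).intervalIntegrable _ _)
        ((hc2 θ).intervalIntegrable _ _), hQ0, add_zero]
  simp_rw [h1]
  rw [intervalIntegral_intervalIntegral_swap]
  · simp [hP0]
  · have : Continuous (Function.uncurry P') := hP'
    exact (this.continuousOn.integrableOn_compact
      (isCompact_uIcc.prod isCompact_uIcc)).mono_set
      (Set.prod_mono Set.uIoc_subset_uIcc Set.uIoc_subset_uIcc)

lemma integral_swap_of_continuous {f : ℝ → ℝ → ℝ} (hf : Continuous fun p : ℝ × ℝ => f p.1 p.2)
    (a b c d : ℝ) :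
    ∫ x in a..b, ∫ y in c..d, f x y = ∫ y in c..d, ∫ x in a..b, f x y := by
  refine intervalIntegral_intervalIntegral_swap ?_
  have : Continuous (Function.uncurry f) := hf
  exact (this.continuousOn.integrableOn_compact
      (isCompact_uIcc.prod isCompact_uIcc)).mono_set
      (Set.prod_mono Set.uIoc_subset_uIcc Set.uIoc_subset_uIcc)

lemma integral_rotate_of_continuous {f : ℝ → ℝ → ℝ → ℝ}
    (hf : Continuous fun p : ℝ × ℝ × ℝ => f p.1 p.2.1 p.2.2) (a b c d k l : ℝ) :
    ∫ θ in a..b, ∫ φ in c..d, ∫ s in k..l, f s θ φ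
      = ∫ s in k..l, ∫ θ in a..b, ∫ φ in c..d, f s θ φ := by
  have h1 : ∀ θ, ∫ φ in c..d, ∫ s in k..l, f s θ φ = ∫ s in k..l, ∫ φ in c..d, f s θ φ := by
    intro θ
    exact integral_swap_of_continuous
      (hf.comp (by fun_prop : Continuous fun p : ℝ × ℝ => (p.2, θ, p.1))) _ _ _ _
  simp_rw [h1]
  refine integral_swap_of_continuous (f := fun θ s => ∫ φ in c..d, f s θ φ) ?_ _ _ _ _
  refine intervalIntegral.continuous_parametric_intervalIntegral_of_continuous'
    (f := fun (p : ℝ × ℝ) φ => f p.2 p.1 φ) ?_ _ _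
  exact hf.comp (by fun_prop : Continuous fun p : (ℝ × ℝ) × ℝ => (p.1.2, p.1.1, p.2))

open Real in
/-- The divergence theorem on the cylinder `[0, 1] × S²`, in coordinates `(s, θ, φ)`. -/
lemma integral_cylinder_divergence {M M' P P' Q Q' : ℝ → ℝ → ℝ → ℝ}
    (hM : ∀ s ∈ Set.Icc (0 : ℝ) 1, ∀ θ φ, HasDerivAt (fun s => M s θ φ) (M' s θ φ) s)
    (hP : ∀ s ∈ Set.Icc (0 : ℝ) 1, ∀ θ φ, HasDerivAt (fun θ => P s θ φ) (P' s θ φ) θ)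
    (hQ : ∀ s ∈ Set.Icc (0 : ℝ) 1, ∀ θ φ, HasDerivAt (fun φ => Q s θ φ) (Q' s θ φ) φ)
    (hM' : ContinuousOn (fun p : ℝ × ℝ × ℝ => M' p.1 p.2.1 p.2.2) (Set.Icc 0 1 ×ˢ Set.univ))
    (hP' : ContinuousOn (fun p : ℝ × ℝ × ℝ => P' p.1 p.2.1 p.2.2) (Set.Icc 0 1 ×ˢ Set.univ))
    (hQ' : ContinuousOn (fun p : ℝ × ℝ × ℝ => Q' p.1 p.2.1 p.2.2) (Set.Icc 0 1 ×ˢ Set.univ))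
    (hPend : ∀ s φ, P s π φ = P s 0 φ) (hQend : ∀ s θ, Q s θ (2 * π) = Q s θ 0) :
    ∫ θ in (0 : ℝ)..π, ∫ φ in (0 : ℝ)..(2 * π), ∫ s in (0 : ℝ)..1,
        (M' s θ φ + (P' s θ φ + Q' s θ φ))
      = ∫ θ in (0 : ℝ)..π, ∫ φ in (0 : ℝ)..(2 * π), (M 1 θ φ - M 0 θ φ) := by
  -- Regularity is known only for `s ∈ [0, 1]`. Clamping `s` to this interval yields integrands
  -- continuous for all values of the parameters, to which Fubini applies, without changing them on
  -- the domain of integration.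
  set κ : ℝ → ℝ := fun s => Set.projIcc (0 : ℝ) 1 zero_le_one s with hκ
  have hκc : Continuous κ := continuous_subtype_val.comp continuous_projIcc
  have hκmem : ∀ s, κ s ∈ Set.Icc (0 : ℝ) 1 := fun s => (Set.projIcc (0 : ℝ) 1 zero_le_one s).2
  have hκid : ∀ s ∈ Set.Icc (0 : ℝ) 1, κ s = s := fun s hs => by
    simp only [hκ, Set.projIcc_of_mem zero_le_one hs]
  have hcont : ∀ {G : ℝ → ℝ → ℝ → ℝ},
      ContinuousOn (fun p : ℝ × ℝ × ℝ => G p.1 p.2.1 p.2.2) (Set.Icc 0 1 ×ˢ Set.univ) →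
      Continuous fun p : ℝ × ℝ × ℝ => G (κ p.1) p.2.1 p.2.2 := by
    intro G hG
    exact hG.comp_continuous (f := fun p : ℝ × ℝ × ℝ => (κ p.1, p.2.1, p.2.2)) (by fun_prop)
      fun p => ⟨hκmem _, trivial⟩
  have hMc := hcont hM'
  have hPc := hcont hP'
  have hQc := hcont hQ'
  have hZc := hPc.add hQc
  have e1 : ∀ θ φ, ∫ s in (0 : ℝ)..1, (M' s θ φ + (P' s θ φ + Q' s θ φ))
      = (M 1 θ φ - M 0 θ φ) + ∫ s in (0 : ℝ)..1, (P' (κ s) θ φ + Q' (κ s) θ φ) := by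
    intro θ φ
    have hc : Continuous fun s : ℝ => (s, θ, φ) := by fun_prop
    have e2 : ∫ s in (0 : ℝ)..1, (M' s θ φ + (P' s θ φ + Q' s θ φ))
        = ∫ s in (0 : ℝ)..1, (M' (κ s) θ φ + (P' (κ s) θ φ + Q' (κ s) θ φ)) := by
      refine intervalIntegral.integral_congr fun s hs => ?_
      rw [Set.uIcc_of_le zero_le_one] at hs
      simp only [hκid s hs]
    refine e2.trans ((intervalIntegral.integral_add ((hMc.comp hc).intervalIntegrable _ _)
      ((hZc.comp hc).intervalIntegrable _ _)).trans ?_)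
    congr 1
    refine intervalIntegral.integral_eq_sub_of_hasDerivAt (f := fun s => M s θ φ) (fun s hs => ?_)
      ((hMc.comp hc).intervalIntegrable _ _)
    rw [Set.uIcc_of_le zero_le_one] at hs
    change HasDerivAt _ (M' (κ s) θ φ) s
    rw [hκid s hs]
    exact hM s hs θ φ
  -- Continuity of `M` is not assumed; that of the difference follows by writing it as the integral
  -- of the continuous `M'`.
  have hMd : Continuous fun p : ℝ × ℝ => M 1 p.1 p.2 - M 0 p.1 p.2 := by
    have h1 : (fun p : ℝ × ℝ => M 1 p.1 p.2 - M 0 p.1 p.2)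
        = fun p : ℝ × ℝ => ∫ s in (0 : ℝ)..1, M' (κ s) p.1 p.2 := by
      ext p
      refine (intervalIntegral.integral_eq_sub_of_hasDerivAt (f := fun s => M s p.1 p.2)
        (fun s hs => ?_) ((hMc.comp (by fun_prop : Continuous fun s : ℝ =>
          (s, p.1, p.2))).intervalIntegrable _ _)).symm
      rw [Set.uIcc_of_le zero_le_one] at hs
      change HasDerivAt _ (M' (κ s) p.1 p.2) s
      rw [hκid s hs]
      exact hM s hs _ _
    rw [h1]
    refine intervalIntegral.continuous_parametric_intervalIntegral_of_continuous'
      (f := fun (p : ℝ × ℝ) s => M' (κ s) p.1 p.2) ?_ _ _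
    exact hMc.comp (by fun_prop : Continuous fun p : (ℝ × ℝ) × ℝ => (p.2, p.1.1, p.1.2))
  have hId : Continuous fun p : ℝ × ℝ =>
      ∫ s in (0 : ℝ)..1, (P' (κ s) p.1 p.2 + Q' (κ s) p.1 p.2) := by
    refine intervalIntegral.continuous_parametric_intervalIntegral_of_continuous'
      (f := fun (p : ℝ × ℝ) s => P' (κ s) p.1 p.2 + Q' (κ s) p.1 p.2) ?_ _ _
    exact hZc.comp (by fun_prop : Continuous fun p : (ℝ × ℝ) × ℝ => (p.2, p.1.1, p.1.2))
  have e3 : ∀ θ, ∫ φ in (0 : ℝ)..(2 * π), ((M 1 θ φ - M 0 θ φ)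
        + ∫ s in (0 : ℝ)..1, (P' (κ s) θ φ + Q' (κ s) θ φ))
      = (∫ φ in (0 : ℝ)..(2 * π), (M 1 θ φ - M 0 θ φ))
        + ∫ φ in (0 : ℝ)..(2 * π), ∫ s in (0 : ℝ)..1, (P' (κ s) θ φ + Q' (κ s) θ φ) := by
    intro θ
    have hc : Continuous fun φ : ℝ => (θ, φ) := by fun_prop
    exact intervalIntegral.integral_add ((hMd.comp hc).intervalIntegrable _ _)
      ((hId.comp hc).intervalIntegrable _ _)
  simp_rw [e1, e3]
  rw [intervalIntegral.integral_add]
  · rw [integral_rotate_of_continuous (f := fun s θ φ => P' (κ s) θ φ + Q' (κ s) θ φ) hZc]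
    have h0 : ∀ s, ∫ θ in (0 : ℝ)..π, ∫ φ in (0 : ℝ)..(2 * π), (P' (κ s) θ φ + Q' (κ s) θ φ)
        = 0 := by
      intro s
      have hc : Continuous fun p : ℝ × ℝ => (s, p.1, p.2) := by fun_prop
      exact integral_sphere_divergence_eq_zero (hP _ (hκmem s)) (hQ _ (hκmem s))
        (hPc.comp hc) (hQc.comp hc) (hPend _) (hQend _)
    simp [h0]
  · exact (intervalIntegral.continuous_parametric_intervalIntegral_of_continuous'
      (f := fun θ φ => M 1 θ φ - M 0 θ φ) hMd _ _).intervalIntegrable _ _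
  · exact (intervalIntegral.continuous_parametric_intervalIntegral_of_continuous'
      (f := fun θ φ => ∫ s in (0 : ℝ)..1, (P' (κ s) θ φ + Q' (κ s) θ φ)) hId _ _
      ).intervalIntegrable _ _

end Stokes

/-! ### Stokes' theorem for an antisymmetric tensor on the timelike cylinder -/

section StokesForSuperpotentials

lemma hasDerivAt_sphereDφ_θ (R θ φ : ℝ) :
    HasDerivAt (fun s => sphereDφ R s φ)
      !₂[-(R * (Real.cos θ * Real.sin φ)), R * (Real.cos θ * Real.cos φ), 0] θ := by
  refine hasDerivAt_euclidean ?_ (((Real.hasDerivAt_sin θ).mul_const _).const_mul R)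
    (hasDerivAt_const _ _)
  exact (((Real.hasDerivAt_sin θ).mul_const _).const_mul R).neg

lemma hasDerivAt_sphereDθ_φ (R θ φ : ℝ) :
    HasDerivAt (fun s => sphereDθ R θ s)
      !₂[-(R * (Real.cos θ * Real.sin φ)), R * (Real.cos θ * Real.cos φ), 0] φ := by
  refine hasDerivAt_euclidean ?_ (((Real.hasDerivAt_sin φ).const_mul _).const_mul R)
    (hasDerivAt_const _ _)
  simpa using ((Real.hasDerivAt_cos φ).const_mul (Real.cos θ)).const_mul R

lemma hasDerivAt_coord {x : ℝ → Space3} {x' : Space3} {s : ℝ} (h : HasDerivAt x x' s)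
    (i : Fin 3) : HasDerivAt (fun s => x s i) (x' i) s :=
  (EuclideanSpace.proj (𝕜 := ℝ) i).hasFDerivAt.comp_hasDerivAt s h

lemma sphereDφ_eq_zero {R θ : ℝ} (h : Real.sin θ = 0) (φ : ℝ) : sphereDφ R θ φ = 0 := by
  ext i; fin_cases i <;> simp [sphereDφ, h]

lemma pd_neg (μ : Fin 4) (F : Event → ℝ) (q : Event) : pd μ (fun y => -F y) q = -pd μ F q := by
  simp only [pd, fderiv_fun_neg]; rfl

lemma continuousOn_pd {F : Event → ℝ} {Ω : Set Event} (hΩ : IsOpen Ω) (hF : ContDiffOn ℝ 1 F Ω)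
    (μ : Fin 4) : ContinuousOn (pd μ F) Ω :=
  (hF.continuousOn_fderiv_of_isOpen hΩ le_rfl).clm_apply continuousOn_const

lemma integral_sphere_sub {F G : ℝ → ℝ → ℝ} (hF : Continuous fun p : ℝ × ℝ => F p.1 p.2)
    (hG : Continuous fun p : ℝ × ℝ => G p.1 p.2) {a b c d : ℝ} :
    ∫ θ in a..b, ∫ φ in c..d, (F θ φ - G θ φ)
      = (∫ θ in a..b, ∫ φ in c..d, F θ φ) - ∫ θ in a..b, ∫ φ in c..d, G θ φ := by
  have h1 : ∀ θ, ∫ φ in c..d, (F θ φ - G θ φ) = (∫ φ in c..d, F θ φ) - ∫ φ in c..d, G θ φ := by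
    intro θ
    have hc : Continuous fun φ : ℝ => (θ, φ) := by fun_prop
    exact intervalIntegral.integral_sub ((hF.comp hc).intervalIntegrable _ _)
      ((hG.comp hc).intervalIntegrable _ _)
  simp_rw [h1]
  exact intervalIntegral.integral_sub
    ((intervalIntegral.continuous_parametric_intervalIntegral_of_continuous'
      (f := F) hF _ _).intervalIntegrable _ _)
    ((intervalIntegral.continuous_parametric_intervalIntegral_of_continuous'
      (f := G) hG _ _).intervalIntegrable _ _)

/-- Stokes' theorem for an antisymmetric tensor density on the cylinder
`{|x| = R, 0 ≤ t ≤ τ(x)}`. -/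
theorem surfaceIntegral_sub_eq_cylinderFlux {V : Fin 4 → Fin 4 → Event → ℝ} {Ω : Set Event}
    (hΩ : IsOpen Ω) (hV : ∀ α β, ContDiffOn ℝ 1 (V α β) Ω) (hanti : ∀ α β q, V α β q = -V β α q)
    {τ : Space3 → ℝ} {R₀ R : ℝ} (hτ : ContDiffOn ℝ 1 τ (outside R₀)) (hR0 : 0 ≤ R) (hR : R₀ < R)
    (hmem : ∀ x : Space3, ‖x‖ = R → ∀ s ∈ Set.Icc (0 : ℝ) 1, event (s * τ x) x ∈ Ω) :
    surfaceIntegral V τ R - surfaceIntegral V (fun _ => 0) R = cylinderFlux V τ R := by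
  have hx : ∀ θ φ, spherePt R θ φ ∈ outside R₀ := fun θ φ => by
    show R₀ < ‖_‖; rwa [norm_spherePt hR0]
  set X : ℝ → ℝ → Space3 := spherePt R
  set T : ℝ → ℝ → ℝ := fun θ φ => τ (X θ φ) with hT
  set Tθ : ℝ → ℝ → ℝ := fun θ φ => fderiv ℝ τ (X θ φ) (sphereDθ R θ φ)
  set Tφ : ℝ → ℝ → ℝ := fun θ φ => fderiv ℝ τ (X θ φ) (sphereDφ R θ φ)
  have hτd : ∀ θ φ, HasFDerivAt τ (fderiv ℝ τ (X θ φ)) (X θ φ) := fun θ φ =>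
    ((hτ.differentiableOn (by norm_num)).differentiableAt
      ((isOpen_outside R₀).mem_nhds (hx θ φ))).hasFDerivAt
  have hTθ : ∀ θ φ, HasDerivAt (fun θ => T θ φ) (Tθ θ φ) θ := fun θ φ =>
    (hτd θ φ).comp_hasDerivAt θ (hasDerivAt_spherePt_θ R θ φ)
  have hTφ : ∀ θ φ, HasDerivAt (fun φ => T θ φ) (Tφ θ φ) φ := fun θ φ =>
    (hτd θ φ).comp_hasDerivAt φ (hasDerivAt_spherePt_φ R θ φ)
  have hcf : Continuous fun p : ℝ × ℝ => fderiv ℝ τ (X p.1 p.2) :=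
    (hτ.continuousOn_fderiv_of_isOpen (isOpen_outside R₀) le_rfl).comp_continuous
      (continuous_spherePt R) fun p => hx _ _
  have hcT : Continuous fun p : ℝ × ℝ => T p.1 p.2 :=
    hτ.continuousOn.comp_continuous (continuous_spherePt R) fun p => hx _ _
  have hcTθ : Continuous fun p : ℝ × ℝ => Tθ p.1 p.2 := hcf.clm_apply (continuous_sphereDθ R)
  have hcTφ : Continuous fun p : ℝ × ℝ => Tφ p.1 p.2 := hcf.clm_apply (continuous_sphereDφ R)
  -- Rescaling time by its upper limit `τ` turns the cylinder with variable height into the product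
  -- of `[0, 1]` with the sphere.
  set Γ : ℝ → ℝ → ℝ → Event := fun s θ φ => event (s * T θ φ) (X θ φ) with hΓ
  have hΓmem : ∀ s ∈ Set.Icc (0 : ℝ) 1, ∀ θ φ, Γ s θ φ ∈ Ω := fun s hs θ φ =>
    hmem _ (norm_spherePt hR0 θ φ) s hs
  have hcΓ : Continuous fun p : ℝ × ℝ × ℝ => Γ p.1 p.2.1 p.2.2 := by
    refine continuous_event.comp (Continuous.prodMk (continuous_fst.mul ?_) ?_)
    · exact hcT.comp continuous_snd
    · exact (continuous_spherePt R).comp continuous_snd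
  have hcomp : ∀ {G : Event → ℝ}, ContinuousOn G Ω →
      ContinuousOn (fun p : ℝ × ℝ × ℝ => G (Γ p.1 p.2.1 p.2.2)) (Set.Icc 0 1 ×ˢ Set.univ) :=
    fun hG => hG.comp hcΓ.continuousOn fun p hp => hΓmem _ hp.1 _ _
  have hdiff : ∀ α β, ∀ s ∈ Set.Icc (0 : ℝ) 1, ∀ θ φ, DifferentiableAt ℝ (V α β) (Γ s θ φ) :=
    fun α β s hs θ φ => ((hV α β).differentiableOn (by norm_num)).differentiableAt
      (hΩ.mem_nhds (hΓmem s hs θ φ))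
  set vθ : Fin 3 → ℝ → ℝ → ℝ := fun i θ φ => sphereDθ R θ φ i with hvθ
  set vφ : Fin 3 → ℝ → ℝ → ℝ := fun i θ φ => sphereDφ R θ φ i with hvφ
  -- The mixed derivative `x_{θφ}`. It enters through `P'` and `Q'` with opposite signs and drops
  -- out of their sum.
  set w : Fin 3 → ℝ → ℝ → ℝ := fun i θ φ =>
    (!₂[-(R * (Real.cos θ * Real.sin φ)), R * (Real.cos θ * Real.cos φ), 0] : Space3) i with hw
  have hvφθ : ∀ i θ φ, HasDerivAt (fun θ => vφ i θ φ) (w i θ φ) θ := fun i θ φ =>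
    hasDerivAt_coord (hasDerivAt_sphereDφ_θ R θ φ) i
  have hvθφ : ∀ i θ φ, HasDerivAt (fun φ => vθ i θ φ) (w i θ φ) φ := fun i θ φ =>
    hasDerivAt_coord (hasDerivAt_sphereDθ_φ R θ φ) i
  set ds : Fin 4 → Fin 4 → ℝ → ℝ → ℝ → ℝ := fun α β s θ φ =>
    T θ φ * pd 0 (V α β) (Γ s θ φ) with hds
  set dθ : Fin 4 → Fin 4 → ℝ → ℝ → ℝ → ℝ := fun α β s θ φ =>
    s * Tθ θ φ * pd 0 (V α β) (Γ s θ φ) + vθ 0 θ φ * pd 1 (V α β) (Γ s θ φ)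
      + vθ 1 θ φ * pd 2 (V α β) (Γ s θ φ) + vθ 2 θ φ * pd 3 (V α β) (Γ s θ φ) with hdθ
  set dφ : Fin 4 → Fin 4 → ℝ → ℝ → ℝ → ℝ := fun α β s θ φ =>
    s * Tφ θ φ * pd 0 (V α β) (Γ s θ φ) + vφ 0 θ φ * pd 1 (V α β) (Γ s θ φ)
      + vφ 1 θ φ * pd 2 (V α β) (Γ s θ φ) + vφ 2 θ φ * pd 3 (V α β) (Γ s θ φ) with hdφ
  have Hs : ∀ α β, ∀ s ∈ Set.Icc (0 : ℝ) 1, ∀ θ φ,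
      HasDerivAt (fun s => V α β (Γ s θ φ)) (ds α β s θ φ) s := by
    intro α β s hs θ φ
    have h := hasDerivAt_comp_event (hdiff α β s hs θ φ)
      ((hasDerivAt_id s).mul_const (T θ φ)) (hasDerivAt_const s (X θ φ))
    simpa using h
  have Hθ : ∀ α β, ∀ s ∈ Set.Icc (0 : ℝ) 1, ∀ θ φ,
      HasDerivAt (fun θ => V α β (Γ s θ φ)) (dθ α β s θ φ) θ := fun α β s hs θ φ =>
    hasDerivAt_comp_event (hdiff α β s hs θ φ) ((hTθ θ φ).const_mul s)
      (hasDerivAt_spherePt_θ R θ φ)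
  have Hφ : ∀ α β, ∀ s ∈ Set.Icc (0 : ℝ) 1, ∀ θ φ,
      HasDerivAt (fun φ => V α β (Γ s θ φ)) (dφ α β s θ φ) φ := fun α β s hs θ φ =>
    hasDerivAt_comp_event (hdiff α β s hs θ φ) ((hTφ θ φ).const_mul s)
      (hasDerivAt_spherePt_φ R θ φ)
  -- With `ω` the 2-form `½ V^{αβ} dS_{αβ}` pulled back by `Γ`, these are `M = ω(∂_θ, ∂_φ)`, `P =
  -- ω(∂_φ, ∂_s)` and `Q = ω(∂_s, ∂_θ)`, so that `dω` has the component `∂_s M + ∂_θ P + ∂_φ Q`.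
  -- Derivatives of `τ` occur only in `M`, which is differentiated in `s` alone, where they are
  -- constant; hence `τ` of class C¹ suffices.
  set M : ℝ → ℝ → ℝ → ℝ := fun s θ φ => -(
      V 0 1 (Γ s θ φ) * (vθ 1 θ φ * vφ 2 θ φ - vθ 2 θ φ * vφ 1 θ φ)
      - V 0 2 (Γ s θ φ) * (vθ 0 θ φ * vφ 2 θ φ - vθ 2 θ φ * vφ 0 θ φ)
      + V 0 3 (Γ s θ φ) * (vθ 0 θ φ * vφ 1 θ φ - vθ 1 θ φ * vφ 0 θ φ)
      + V 1 2 (Γ s θ φ) * (s * (Tθ θ φ * vφ 2 θ φ - vθ 2 θ φ * Tφ θ φ))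
      - V 1 3 (Γ s θ φ) * (s * (Tθ θ φ * vφ 1 θ φ - vθ 1 θ φ * Tφ θ φ))
      + V 2 3 (Γ s θ φ) * (s * (Tθ θ φ * vφ 0 θ φ - vθ 0 θ φ * Tφ θ φ))) with hM
  set P : ℝ → ℝ → ℝ → ℝ := fun s θ φ => T θ φ * (V 2 3 (Γ s θ φ) * vφ 0 θ φ
      - V 1 3 (Γ s θ φ) * vφ 1 θ φ + V 1 2 (Γ s θ φ) * vφ 2 θ φ) with hP
  set Q : ℝ → ℝ → ℝ → ℝ := fun s θ φ => -(T θ φ * (V 2 3 (Γ s θ φ) * vθ 0 θ φ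
      - V 1 3 (Γ s θ φ) * vθ 1 θ φ + V 1 2 (Γ s θ φ) * vθ 2 θ φ)) with hQ
  set M' : ℝ → ℝ → ℝ → ℝ := fun s θ φ => -(
      ds 0 1 s θ φ * (vθ 1 θ φ * vφ 2 θ φ - vθ 2 θ φ * vφ 1 θ φ)
      - ds 0 2 s θ φ * (vθ 0 θ φ * vφ 2 θ φ - vθ 2 θ φ * vφ 0 θ φ)
      + ds 0 3 s θ φ * (vθ 0 θ φ * vφ 1 θ φ - vθ 1 θ φ * vφ 0 θ φ)
      + (ds 1 2 s θ φ * (s * (Tθ θ φ * vφ 2 θ φ - vθ 2 θ φ * Tφ θ φ))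
        + V 1 2 (Γ s θ φ) * (1 * (Tθ θ φ * vφ 2 θ φ - vθ 2 θ φ * Tφ θ φ)))
      - (ds 1 3 s θ φ * (s * (Tθ θ φ * vφ 1 θ φ - vθ 1 θ φ * Tφ θ φ))
        + V 1 3 (Γ s θ φ) * (1 * (Tθ θ φ * vφ 1 θ φ - vθ 1 θ φ * Tφ θ φ)))
      + (ds 2 3 s θ φ * (s * (Tθ θ φ * vφ 0 θ φ - vθ 0 θ φ * Tφ θ φ))
        + V 2 3 (Γ s θ φ) * (1 * (Tθ θ φ * vφ 0 θ φ - vθ 0 θ φ * Tφ θ φ)))) with hM'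
  set P' : ℝ → ℝ → ℝ → ℝ := fun s θ φ => Tθ θ φ * (V 2 3 (Γ s θ φ) * vφ 0 θ φ
      - V 1 3 (Γ s θ φ) * vφ 1 θ φ + V 1 2 (Γ s θ φ) * vφ 2 θ φ)
      + T θ φ * ((dθ 2 3 s θ φ * vφ 0 θ φ + V 2 3 (Γ s θ φ) * w 0 θ φ)
      - (dθ 1 3 s θ φ * vφ 1 θ φ + V 1 3 (Γ s θ φ) * w 1 θ φ)
      + (dθ 1 2 s θ φ * vφ 2 θ φ + V 1 2 (Γ s θ φ) * w 2 θ φ)) with hP'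
  set Q' : ℝ → ℝ → ℝ → ℝ := fun s θ φ => -(Tφ θ φ * (V 2 3 (Γ s θ φ) * vθ 0 θ φ
      - V 1 3 (Γ s θ φ) * vθ 1 θ φ + V 1 2 (Γ s θ φ) * vθ 2 θ φ)
      + T θ φ * ((dφ 2 3 s θ φ * vθ 0 θ φ + V 2 3 (Γ s θ φ) * w 0 θ φ)
      - (dφ 1 3 s θ φ * vθ 1 θ φ + V 1 3 (Γ s θ φ) * w 1 θ φ)
      + (dφ 1 2 s θ φ * vθ 2 θ φ + V 1 2 (Γ s θ φ) * w 2 θ φ))) with hQ'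
  have HM : ∀ s ∈ Set.Icc (0 : ℝ) 1, ∀ θ φ, HasDerivAt (fun s => M s θ φ) (M' s θ φ) s := by
    intro s hs θ φ
    have hlin : ∀ α β (c : ℝ), HasDerivAt (fun s => V α β (Γ s θ φ) * (s * c))
        (ds α β s θ φ * (s * c) + V α β (Γ s θ φ) * (1 * c)) s := fun α β c =>
      (Hs α β s hs θ φ).mul ((hasDerivAt_id s).mul_const c)
    exact (((((((Hs 0 1 s hs θ φ).mul_const _).sub ((Hs 0 2 s hs θ φ).mul_const _)).add
      ((Hs 0 3 s hs θ φ).mul_const _)).add (hlin 1 2 _)).sub (hlin 1 3 _)).add (hlin 2 3 _)).neg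
  have HP : ∀ s ∈ Set.Icc (0 : ℝ) 1, ∀ θ φ, HasDerivAt (fun θ => P s θ φ) (P' s θ φ) θ := by
    intro s hs θ φ
    exact (hTθ θ φ).mul ((((Hθ 2 3 s hs θ φ).mul (hvφθ 0 θ φ)).sub
      ((Hθ 1 3 s hs θ φ).mul (hvφθ 1 θ φ))).add ((Hθ 1 2 s hs θ φ).mul (hvφθ 2 θ φ)))
  have HQ : ∀ s ∈ Set.Icc (0 : ℝ) 1, ∀ θ φ, HasDerivAt (fun φ => Q s θ φ) (Q' s θ φ) φ := by
    intro s hs θ φ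
    exact ((hTφ θ φ).mul ((((Hφ 2 3 s hs θ φ).mul (hvθφ 0 θ φ)).sub
      ((Hφ 1 3 s hs θ φ).mul (hvθφ 1 θ φ))).add ((Hφ 1 2 s hs θ φ).mul (hvθφ 2 θ φ)))).neg
  have c2 : ∀ {G : ℝ → ℝ → ℝ}, (Continuous fun p : ℝ × ℝ => G p.1 p.2) →
      ContinuousOn (fun p : ℝ × ℝ × ℝ => G p.2.1 p.2.2) (Set.Icc 0 1 ×ˢ Set.univ) :=
    fun hG => (hG.comp continuous_snd).continuousOn
  have cT := c2 hcT
  have cTθ := c2 hcTθ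
  have cTφ := c2 hcTφ
  have cvθ : ∀ i, ContinuousOn (fun p : ℝ × ℝ × ℝ => vθ i p.2.1 p.2.2)
      (Set.Icc 0 1 ×ˢ Set.univ) := fun i =>
    c2 ((EuclideanSpace.proj (𝕜 := ℝ) i).continuous.comp (continuous_sphereDθ R))
  have cvφ : ∀ i, ContinuousOn (fun p : ℝ × ℝ × ℝ => vφ i p.2.1 p.2.2)
      (Set.Icc 0 1 ×ˢ Set.univ) := fun i =>
    c2 ((EuclideanSpace.proj (𝕜 := ℝ) i).continuous.comp (continuous_sphereDφ R))
  have cw : ∀ i, ContinuousOn (fun p : ℝ × ℝ × ℝ => w i p.2.1 p.2.2)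
      (Set.Icc 0 1 ×ˢ Set.univ) := fun i =>
    c2 ((EuclideanSpace.proj (𝕜 := ℝ) i).continuous.comp
      (by fun_prop : Continuous fun p : ℝ × ℝ => (!₂[-(R * (Real.cos p.1 * Real.sin p.2)),
        R * (Real.cos p.1 * Real.cos p.2), 0] : Space3)))
  have cV : ∀ α β, ContinuousOn (fun p : ℝ × ℝ × ℝ => V α β (Γ p.1 p.2.1 p.2.2))
      (Set.Icc 0 1 ×ˢ Set.univ) := fun α β => hcomp (hV α β).continuousOn
  have cpd : ∀ μ α β, ContinuousOn (fun p : ℝ × ℝ × ℝ => pd μ (V α β) (Γ p.1 p.2.1 p.2.2))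
      (Set.Icc 0 1 ×ˢ Set.univ) := fun μ α β => hcomp (continuousOn_pd hΩ (hV α β) μ)
  have cs : ContinuousOn (fun p : ℝ × ℝ × ℝ => p.1) (Set.Icc (0 : ℝ) 1 ×ˢ Set.univ) :=
    continuousOn_fst
  have cds : ∀ α β, ContinuousOn (fun p : ℝ × ℝ × ℝ => ds α β p.1 p.2.1 p.2.2)
      (Set.Icc 0 1 ×ˢ Set.univ) := fun α β => cT.mul (cpd 0 α β)
  have cdθ : ∀ α β, ContinuousOn (fun p : ℝ × ℝ × ℝ => dθ α β p.1 p.2.1 p.2.2)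
      (Set.Icc 0 1 ×ˢ Set.univ) := fun α β =>
    ((((cs.mul cTθ).mul (cpd 0 α β)).add ((cvθ 0).mul (cpd 1 α β))).add
      ((cvθ 1).mul (cpd 2 α β))).add ((cvθ 2).mul (cpd 3 α β))
  have cdφ : ∀ α β, ContinuousOn (fun p : ℝ × ℝ × ℝ => dφ α β p.1 p.2.1 p.2.2)
      (Set.Icc 0 1 ×ˢ Set.univ) := fun α β =>
    ((((cs.mul cTφ).mul (cpd 0 α β)).add ((cvφ 0).mul (cpd 1 α β))).add
      ((cvφ 1).mul (cpd 2 α β))).add ((cvφ 2).mul (cpd 3 α β))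
  have cN : ∀ i j, ContinuousOn (fun p : ℝ × ℝ × ℝ => vθ i p.2.1 p.2.2 * vφ j p.2.1 p.2.2
      - vθ j p.2.1 p.2.2 * vφ i p.2.1 p.2.2) (Set.Icc 0 1 ×ˢ Set.univ) := fun i j =>
    ((cvθ i).mul (cvφ j)).sub ((cvθ j).mul (cvφ i))
  have cL : ∀ j, ContinuousOn (fun p : ℝ × ℝ × ℝ => Tθ p.2.1 p.2.2 * vφ j p.2.1 p.2.2
      - vθ j p.2.1 p.2.2 * Tφ p.2.1 p.2.2) (Set.Icc 0 1 ×ˢ Set.univ) := fun j =>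
    (cTθ.mul (cvφ j)).sub ((cvθ j).mul cTφ)
  have cK : ∀ α β j, ContinuousOn (fun p : ℝ × ℝ × ℝ => ds α β p.1 p.2.1 p.2.2
        * (p.1 * (Tθ p.2.1 p.2.2 * vφ j p.2.1 p.2.2 - vθ j p.2.1 p.2.2 * Tφ p.2.1 p.2.2))
      + V α β (Γ p.1 p.2.1 p.2.2)
        * (1 * (Tθ p.2.1 p.2.2 * vφ j p.2.1 p.2.2 - vθ j p.2.1 p.2.2 * Tφ p.2.1 p.2.2)))
      (Set.Icc 0 1 ×ˢ Set.univ) := fun α β j =>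
    ((cds α β).mul (cs.mul (cL j))).add ((cV α β).mul (continuousOn_const.mul (cL j)))
  have HcM : ContinuousOn (fun p : ℝ × ℝ × ℝ => M' p.1 p.2.1 p.2.2) (Set.Icc 0 1 ×ˢ Set.univ) :=
    (((((((cds 0 1).mul (cN 1 2)).sub ((cds 0 2).mul (cN 0 2))).add
      ((cds 0 3).mul (cN 0 1))).add (cK 1 2 2)).sub (cK 1 3 1)).add (cK 2 3 0)).neg
  have HcP : ContinuousOn (fun p : ℝ × ℝ × ℝ => P' p.1 p.2.1 p.2.2) (Set.Icc 0 1 ×ˢ Set.univ) :=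
    (cTθ.mul ((((cV 2 3).mul (cvφ 0)).sub ((cV 1 3).mul (cvφ 1))).add
      ((cV 1 2).mul (cvφ 2)))).add (cT.mul
      (((((cdθ 2 3).mul (cvφ 0)).add ((cV 2 3).mul (cw 0))).sub
      (((cdθ 1 3).mul (cvφ 1)).add ((cV 1 3).mul (cw 1)))).add
      (((cdθ 1 2).mul (cvφ 2)).add ((cV 1 2).mul (cw 2)))))
  have HcQ : ContinuousOn (fun p : ℝ × ℝ × ℝ => Q' p.1 p.2.1 p.2.2) (Set.Icc 0 1 ×ˢ Set.univ) :=
    ((cTφ.mul ((((cV 2 3).mul (cvθ 0)).sub ((cV 1 3).mul (cvθ 1))).add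
      ((cV 1 2).mul (cvθ 2)))).add (cT.mul
      (((((cdφ 2 3).mul (cvθ 0)).add ((cV 2 3).mul (cw 0))).sub
      (((cdφ 1 3).mul (cvθ 1)).add ((cV 1 3).mul (cw 1)))).add
      (((cdφ 1 2).mul (cvθ 2)).add ((cV 1 2).mul (cw 2)))))).neg
  have hPend : ∀ s φ, P s Real.pi φ = P s 0 φ := fun s φ => by
    simp only [hP, hvφ, sphereDφ_eq_zero Real.sin_pi, sphereDφ_eq_zero Real.sin_zero]
    simp
  have hQend : ∀ s θ, Q s θ (2 * Real.pi) = Q s θ 0 := fun s θ => by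
    have h1 : X θ (2 * Real.pi) = X θ 0 := by simp [X, spherePt]
    have h2 : sphereDθ R θ (2 * Real.pi) = sphereDθ R θ 0 := by simp [sphereDθ]
    simp only [hQ, hΓ, hT, hvθ, h1, h2]
  have key := integral_cylinder_divergence HM HP HQ HcM HcP HcQ hPend hQend
  have hΓ1 : ∀ θ φ, Γ 1 θ φ = event (τ (X θ φ)) (X θ φ) := fun θ φ => by
    simp only [hΓ, hT, one_mul]
  have hΓ0 : ∀ θ φ, Γ 0 θ φ = event 0 (X θ φ) := fun θ φ => by
    simp only [hΓ, zero_mul]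
  have hsurf1 : surfaceIntegral V τ R
      = ∫ θ in (0 : ℝ)..Real.pi, ∫ φ in (0 : ℝ)..(2 * Real.pi), M 1 θ φ := by
    have hpt : ∀ θ φ, ∑ α, ∑ β, V α β (event (τ (X θ φ)) (X θ φ)) *
        vol4 (coordVec β) (coordVec α) (deriv (fun s => event (τ (X s φ)) (X s φ)) θ)
          (deriv (fun s => event (τ (X θ s)) (X θ s)) φ) = 2 * M 1 θ φ := by
      intro θ φ
      rw [(hasDerivAt_event (hTθ θ φ) (hasDerivAt_spherePt_θ R θ φ)).deriv,
        (hasDerivAt_event (hTφ θ φ) (hasDerivAt_spherePt_φ R θ φ)).deriv,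
        sum_sum_vol4 (V := fun α β => V α β (event (τ (X θ φ)) (X θ φ)))
          (fun α β => hanti α β _), ← hΓ1]
      change -2 * (V 0 1 (Γ 1 θ φ) * (vθ 1 θ φ * vφ 2 θ φ - vθ 2 θ φ * vφ 1 θ φ)
        - V 0 2 (Γ 1 θ φ) * (vθ 0 θ φ * vφ 2 θ φ - vθ 2 θ φ * vφ 0 θ φ)
        + V 0 3 (Γ 1 θ φ) * (vθ 0 θ φ * vφ 1 θ φ - vθ 1 θ φ * vφ 0 θ φ)
        + V 1 2 (Γ 1 θ φ) * (Tθ θ φ * vφ 2 θ φ - vθ 2 θ φ * Tφ θ φ)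
        - V 1 3 (Γ 1 θ φ) * (Tθ θ φ * vφ 1 θ φ - vθ 1 θ φ * Tφ θ φ)
        + V 2 3 (Γ 1 θ φ) * (Tθ θ φ * vφ 0 θ φ - vθ 0 θ φ * Tφ θ φ)) = _
      simp only [hM]
      ring
    simp only [surfaceIntegral]
    simp_rw [show spherePt R = X from rfl, hpt, intervalIntegral.integral_const_mul]
    ring
  have hsurf0 : surfaceIntegral V (fun _ => 0) R
      = ∫ θ in (0 : ℝ)..Real.pi, ∫ φ in (0 : ℝ)..(2 * Real.pi), M 0 θ φ := by
    have hpt : ∀ θ φ, ∑ α, ∑ β, V α β (event 0 (X θ φ)) *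
        vol4 (coordVec β) (coordVec α) (deriv (fun s => event 0 (X s φ)) θ)
          (deriv (fun s => event 0 (X θ s)) φ) = 2 * M 0 θ φ := by
      intro θ φ
      rw [(hasDerivAt_event (hasDerivAt_const θ 0) (hasDerivAt_spherePt_θ R θ φ)).deriv,
        (hasDerivAt_event (hasDerivAt_const φ 0) (hasDerivAt_spherePt_φ R θ φ)).deriv,
        sum_sum_vol4 (V := fun α β => V α β (event 0 (X θ φ)))
          (fun α β => hanti α β _), ← hΓ0]
      change -2 * (V 0 1 (Γ 0 θ φ) * (vθ 1 θ φ * vφ 2 θ φ - vθ 2 θ φ * vφ 1 θ φ)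
        - V 0 2 (Γ 0 θ φ) * (vθ 0 θ φ * vφ 2 θ φ - vθ 2 θ φ * vφ 0 θ φ)
        + V 0 3 (Γ 0 θ φ) * (vθ 0 θ φ * vφ 1 θ φ - vθ 1 θ φ * vφ 0 θ φ)
        + V 1 2 (Γ 0 θ φ) * (0 * vφ 2 θ φ - vθ 2 θ φ * 0)
        - V 1 3 (Γ 0 θ φ) * (0 * vφ 1 θ φ - vθ 1 θ φ * 0)
        + V 2 3 (Γ 0 θ φ) * (0 * vφ 0 θ φ - vθ 0 θ φ * 0)) = _
      simp only [hM]
      ring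
    simp only [surfaceIntegral]
    simp_rw [show spherePt R = X from rfl, hpt, intervalIntegral.integral_const_mul]
    ring
  have hflux : cylinderFlux V τ R = ∫ θ in (0 : ℝ)..Real.pi, ∫ φ in (0 : ℝ)..(2 * Real.pi),
      ∫ s in (0 : ℝ)..1, (M' s θ φ + (P' s θ φ + Q' s θ φ)) := by
    have hself : ∀ μ α q, pd μ (V α α) q = 0 := fun μ α q => by
      have h : V α α = fun _ => 0 := by
        ext y; have := hanti α α y; linarith
      rw [h]; simp [pd]
    have hswap : ∀ μ α β q, pd μ (V α β) q = -pd μ (V β α) q := fun μ α β q => by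
      rw [← pd_neg]; congr 1; ext y; exact hanti α β y
    have hpt : ∀ θ φ s, ∑ β, (∑ α, pd α (V α β) (event s (X θ φ))) *
        vol4 (coordVec β) (deriv (fun r => event r (X θ φ)) s)
          (deriv (fun r => event s (X r φ)) θ) (deriv (fun r => event s (X θ r)) φ)
        = -((pd 0 (V 0 1) (event s (X θ φ)) - pd 2 (V 1 2) (event s (X θ φ))
              - pd 3 (V 1 3) (event s (X θ φ))) * (vθ 1 θ φ * vφ 2 θ φ - vθ 2 θ φ * vφ 1 θ φ)
          - (pd 0 (V 0 2) (event s (X θ φ)) + pd 1 (V 1 2) (event s (X θ φ))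
              - pd 3 (V 2 3) (event s (X θ φ))) * (vθ 0 θ φ * vφ 2 θ φ - vθ 2 θ φ * vφ 0 θ φ)
          + (pd 0 (V 0 3) (event s (X θ φ)) + pd 1 (V 1 3) (event s (X θ φ))
              + pd 2 (V 2 3) (event s (X θ φ)))
            * (vθ 0 θ φ * vφ 1 θ φ - vθ 1 θ φ * vφ 0 θ φ)) := by
      intro θ φ s
      have hd : deriv (fun r => event r (X θ φ)) s = coordVec 0 := by
        rw [(hasDerivAt_event (hasDerivAt_id' s) (hasDerivAt_const s (X θ φ))).deriv]
        ext i
        refine Fin.cases ?_ (fun j => ?_) i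
        · simp [event_zero, coordVec]
        · simp [event_succ, coordVec]
      rw [hd, (hasDerivAt_event (hasDerivAt_const θ s) (hasDerivAt_spherePt_θ R θ φ)).deriv,
        (hasDerivAt_event (hasDerivAt_const φ s) (hasDerivAt_spherePt_φ R θ φ)).deriv,
        sum_vol4_time _ _ (event_zero _ _) (event_zero _ _)]
      simp only [Fin.sum_univ_four, hself, hswap 2 2 1, hswap 3 3 1, hswap 3 3 2]
      change -((_) * (vθ 1 θ φ * vφ 2 θ φ - vθ 2 θ φ * vφ 1 θ φ)
          - (_) * (vθ 0 θ φ * vφ 2 θ φ - vθ 2 θ φ * vφ 0 θ φ)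
          + (_) * (vθ 0 θ φ * vφ 1 θ φ - vθ 1 θ φ * vφ 0 θ φ)) = _
      ring
    simp only [cylinderFlux]
    simp_rw [show spherePt R = X from rfl, hpt]
    refine intervalIntegral.integral_congr fun θ _ => intervalIntegral.integral_congr fun φ _ => ?_
    -- The substitution `t = s T(θ, φ)`, whose Jacobian `T` is the factor produced by `∂_s Γ = T
    -- ∂_t`.
    have hsub := intervalIntegral.mul_integral_comp_mul_right (a := 0) (b := 1)
      (f := fun s => -((pd 0 (V 0 1) (event s (X θ φ)) - pd 2 (V 1 2) (event s (X θ φ))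
              - pd 3 (V 1 3) (event s (X θ φ))) * (vθ 1 θ φ * vφ 2 θ φ - vθ 2 θ φ * vφ 1 θ φ)
          - (pd 0 (V 0 2) (event s (X θ φ)) + pd 1 (V 1 2) (event s (X θ φ))
              - pd 3 (V 2 3) (event s (X θ φ))) * (vθ 0 θ φ * vφ 2 θ φ - vθ 2 θ φ * vφ 0 θ φ)
          + (pd 0 (V 0 3) (event s (X θ φ)) + pd 1 (V 1 3) (event s (X θ φ))
              + pd 2 (V 2 3) (event s (X θ φ)))
            * (vθ 0 θ φ * vφ 1 θ φ - vθ 1 θ φ * vφ 0 θ φ))) (T θ φ)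
    rw [zero_mul, one_mul] at hsub
    rw [← hsub, ← intervalIntegral.integral_const_mul]
    refine intervalIntegral.integral_congr fun s _ => ?_
    simp only [hM', hP', hQ', hds, hdθ, hdφ, hΓ]
    ring
  have cJ : ∀ α β j, ContinuousOn (fun p : ℝ × ℝ × ℝ => V α β (Γ p.1 p.2.1 p.2.2)
        * (p.1 * (Tθ p.2.1 p.2.2 * vφ j p.2.1 p.2.2 - vθ j p.2.1 p.2.2 * Tφ p.2.1 p.2.2)))
      (Set.Icc 0 1 ×ˢ Set.univ) := fun α β j => (cV α β).mul (cs.mul (cL j))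
  have HcM0 : ContinuousOn (fun p : ℝ × ℝ × ℝ => M p.1 p.2.1 p.2.2)
      (Set.Icc 0 1 ×ˢ Set.univ) :=
    (((((((cV 0 1).mul (cN 1 2)).sub ((cV 0 2).mul (cN 0 2))).add
      ((cV 0 3).mul (cN 0 1))).add (cJ 1 2 2)).sub (cJ 1 3 1)).add (cJ 2 3 0)).neg
  have hcM : ∀ s ∈ Set.Icc (0 : ℝ) 1, Continuous fun p : ℝ × ℝ => M s p.1 p.2 := fun s hs =>
    HcM0.comp_continuous (f := fun p : ℝ × ℝ => (s, p.1, p.2)) (by fun_prop) fun p => ⟨hs, trivial⟩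
  have hsplit : ∫ θ in (0 : ℝ)..Real.pi, ∫ φ in (0 : ℝ)..(2 * Real.pi), (M 1 θ φ - M 0 θ φ)
      = (∫ θ in (0 : ℝ)..Real.pi, ∫ φ in (0 : ℝ)..(2 * Real.pi), M 1 θ φ)
        - ∫ θ in (0 : ℝ)..Real.pi, ∫ φ in (0 : ℝ)..(2 * Real.pi), M 0 θ φ :=
    integral_sphere_sub (hcM 1 ⟨zero_le_one, le_rfl⟩) (hcM 0 ⟨le_rfl, zero_le_one⟩)
  rw [hflux, key, hsplit, hsurf1, hsurf0]

end StokesForSuperpotentials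

/-! ### Smoothness of determinants and inverses -/

section MatrixCalculus

variable {E : Type*} [NormedAddCommGroup E] [NormedSpace ℝ E] {m : Type*} [Fintype m]
  [DecidableEq m]

lemma contDiffOn_det {k : WithTop ℕ∞} {M : E → Matrix m m ℝ} {s : Set E}
    (hM : ∀ i j, ContDiffOn ℝ k (fun y => M y i j) s) : ContDiffOn ℝ k (fun y => (M y).det) s := by
  simp only [Matrix.det_apply']
  exact ContDiffOn.sum fun σ _ => contDiffOn_const.mul (contDiffOn_prod fun i _ => hM _ _)

/-- Cramer's rule: the entries of the inverse are quotients of determinants. -/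
lemma contDiffOn_matrix_inv {k : WithTop ℕ∞} {M : E → Matrix m m ℝ} {s : Set E}
    (hM : ∀ i j, ContDiffOn ℝ k (fun y => M y i j) s) (hdet : ∀ y ∈ s, (M y).det ≠ 0) (i j : m) :
    ContDiffOn ℝ k (fun y => (M y)⁻¹ i j) s := by
  have h : ∀ y, (M y)⁻¹ i j = ((M y).det)⁻¹ * ((M y).updateRow j (Pi.single i 1)).det := by
    intro y
    rw [Matrix.inv_def, Matrix.smul_apply, Ring.inverse_eq_inv', Matrix.adjugate_apply, smul_eq_mul]
  simp only [h]
  refine ((contDiffOn_det hM).inv hdet).mul (contDiffOn_det fun a b => ?_)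
  by_cases hab : a = j
  · subst hab
    simp only [Matrix.updateRow_self]
    exact contDiffOn_const
  · simp only [Matrix.updateRow_ne hab]
    exact hM a b

end MatrixCalculus

/-! ### Lorentzian matrices -/

section Lorentzian

lemma det_minkowski : minkowski.det = -1 := by
  simp [minkowski, Matrix.det_diagonal, Fin.prod_univ_succ]

lemma IsLorentzian.det_neg {G : Matrix (Fin 4) (Fin 4) ℝ} (h : IsLorentzian G) : G.det < 0 := by
  obtain ⟨A, hA, rfl⟩ := h
  rw [Matrix.det_mul, Matrix.det_mul, Matrix.det_transpose, det_minkowski]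
  have : A.det ≠ 0 := hA.ne_zero
  have := mul_self_pos.2 this
  linarith

lemma IsLorentzian.symm {G : Matrix (Fin 4) (Fin 4) ℝ} (h : IsLorentzian G) (i j : Fin 4) :
    G i j = G j i := by
  obtain ⟨A, hA, rfl⟩ := h
  have : (A.transpose * minkowski * A).transpose = A.transpose * minkowski * A := by
    simp [Matrix.transpose_mul, minkowski, Matrix.mul_assoc]
  conv_rhs => rw [← this]
  rfl

end Lorentzian

/-! ### Antisymmetry and regularity of the superpotential -/

section Superpotential

lemma superpotential_translation (g : MetricField) (μ ν l : Fin 4) (q : Event) :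
    superpotential g (translation μ) ν l q = freud g ν l μ q := by
  simp [superpotential, translation, coordVec, pd, Pi.single_apply]

lemma freud_antisymm (g : MetricField) (ν l β : Fin 4) (q : Event) :
    freud g ν l β q = -freud g l ν β q := by
  simp only [freud]
  rw [← mul_neg, ← Finset.sum_neg_distrib]
  congr 1
  refine Finset.sum_congr rfl fun γ _ => ?_
  rw [← mul_neg, ← Finset.sum_neg_distrib]
  congr 1
  refine Finset.sum_congr rfl fun κ _ => ?_
  rw [← pd_neg]
  congr 1
  ext y
  ring

variable {Ω : Set Event} {g : MetricField}

lemma densityRatio_sq (h : ∀ q ∈ Ω, IsLorentzian (g q)) {q : Event} (hq : q ∈ Ω) :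
    densityRatio g q ^ 2 = -(g q).det := by
  have := (h q hq).det_neg
  rw [densityRatio, det_minkowski, div_pow, Real.sq_sqrt (abs_nonneg _),
    Real.sq_sqrt (abs_nonneg _), abs_of_neg this]
  norm_num

lemma contDiffOn_pd {F : Event → ℝ} (hΩ : IsOpen Ω) {k n : WithTop ℕ∞} (hF : ContDiffOn ℝ n F Ω)
    (hkn : k + 1 ≤ n) (μ : Fin 4) : ContDiffOn ℝ k (pd μ F) Ω :=
  (hF.fderiv_of_isOpen hΩ hkn).clm_apply contDiffOn_const

/-- Since `e² = -det g`, the differentiated quantity is rational in the components of `g`, and the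
signature keeps its denominator away from zero. One derivative of the C³ metric is used, and C¹ is
what Stokes' theorem needs. -/
lemma contDiffOn_freud (hΩ : IsOpen Ω) (hgC : ∀ μ ν, ContDiffOn ℝ 3 (fun q => g q μ ν) Ω)
    (hgL : ∀ q ∈ Ω, IsLorentzian (g q)) (ν l β : Fin 4) : ContDiffOn ℝ 1 (freud g ν l β) Ω := by
  have hdet : ∀ q ∈ Ω, (g q).det ≠ 0 := fun q hq => (hgL q hq).det_neg.ne
  have hdetC := contDiffOn_det hgC
  have hinv := contDiffOn_matrix_inv hgC hdet
  have hle : (1 : WithTop ℕ∞) ≤ 3 := by norm_num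
  unfold freud
  refine ContDiffOn.mul ?_ (ContDiffOn.sum fun γ _ => ((hgC β γ).of_le hle).mul
    (ContDiffOn.sum fun κ _ => contDiffOn_pd (n := 3) hΩ ?_ (by norm_num) κ))
  · have h1 : ContDiffOn ℝ 1 (fun q => √(-(g q).det)) Ω :=
      (hdetC.neg.of_le hle).sqrt fun q hq => by
        have := (hgL q hq).det_neg; simp only [ne_eq, neg_eq_zero]; exact this.ne
    refine ContDiffOn.congr (f := fun q => 2 * |minkowski.det| / (16 * Real.pi * √(-(g q).det)))
      (contDiffOn_const.div (contDiffOn_const.mul h1) fun q hq => ?_) fun q hq => ?_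
    · have := (hgL q hq).det_neg
      have h2 : 0 < √(-(g q).det) := Real.sqrt_pos.2 (by linarith)
      positivity
    · rw [abs_of_neg (hgL q hq).det_neg]
  · refine ContDiffOn.congr (f := fun y => -(g y).det * (((g y)⁻¹ γ ν * (g y)⁻¹ l κ
      - (g y)⁻¹ γ l * (g y)⁻¹ ν κ) / 2)) (hdetC.neg.mul ?_) fun q hq => by
        rw [densityRatio_sq hgL hq]
    exact (((hinv _ _).mul (hinv _ _)).sub ((hinv _ _).mul (hinv _ _))).div_const 2

end Superpotential

/-! ### Growth of `f`, and the comparison of charges by Stokes' theorem -/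

section RetardedTime

/-- Far out the radial derivative of `f` is at least `1/2`; integrate it along rays starting from a
sphere, where `f` is bounded below by compactness. The bound makes `u + f ≥ 0` on all large spheres,
so that the cylinder `T(R, u)` runs upward from `t = 0` and lies in `Ω`. -/
lemma exists_lower_bound_of_gradient {f : Space3 → ℝ} {R₀ : ℝ}
    (hfC : ContDiffOn ℝ 1 f (outside R₀))
    (hf : Tendsto (fun x => gradient f x - ‖x‖⁻¹ • x) (Bornology.cobounded Space3) (𝓝 0)) :
    ∃ C R₁ : ℝ, ∀ x : Space3, R₁ ≤ ‖x‖ → ‖x‖ / 2 - C ≤ f x := by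
  have hsmall : ∀ᶠ x in Bornology.cobounded Space3, ‖gradient f x - ‖x‖⁻¹ • x‖ < 1 / 2 := by
    have := hf.norm
    rw [norm_zero] at this
    exact this.eventually_lt_const (by norm_num)
  rw [← comap_norm_atTop, eventually_comap] at hsmall
  obtain ⟨r, hr⟩ := eventually_atTop.1 hsmall
  set R₁ := max (max r (R₀ + 1)) 1
  have hr1 : r ≤ R₁ := (le_max_left _ _).trans (le_max_left _ _)
  have hR01 : R₀ < R₁ := by
    have : R₀ + 1 ≤ R₁ := (le_max_right _ _).trans (le_max_left _ _)
    linarith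
  have hR1 : 1 ≤ R₁ := le_max_right _ _
  have hdiff : ∀ x : Space3, R₁ ≤ ‖x‖ → DifferentiableAt ℝ f x := fun x hx =>
    (hfC.differentiableOn (by norm_num)).differentiableAt
      ((isOpen_outside R₀).mem_nhds (hR01.trans_le hx))
  have hsph : ContinuousOn f (Metric.sphere 0 R₁) := hfC.continuousOn.mono fun x hx => by
    show R₀ < ‖x‖
    rw [mem_sphere_zero_iff_norm.1 hx]; exact hR01
  obtain ⟨c, hc⟩ := (isCompact_sphere (0 : Space3) R₁).bddBelow_image hsph
  refine ⟨R₁ / 2 - c, R₁, fun x hx => ?_⟩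
  have hx0 : 0 < ‖x‖ := by linarith
  set ω : Space3 := ‖x‖⁻¹ • x with hω
  have hxω : ‖x‖ • ω = x := by rw [hω, smul_smul, mul_inv_cancel₀ hx0.ne', one_smul]
  have hωn : ‖ω‖ = 1 := by
    rw [hω, norm_smul, norm_inv, norm_norm, inv_mul_cancel₀ hx0.ne']
  clear_value ω
  have hsn : ∀ s : ℝ, 0 < s → ‖s • ω‖ = s := fun s hs => by
    rw [norm_smul, hωn, mul_one, Real.norm_of_nonneg hs.le]
  have hder : ∀ s : ℝ, R₁ ≤ s → HasDerivAt (fun s : ℝ => f (s • ω) - s / 2)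
      (fderiv ℝ f (s • ω) ω - 1 / 2) s := by
    intro s hs
    have h1 : HasDerivAt (fun s : ℝ => s • ω) ω s := by
      simpa using (hasDerivAt_id s).smul_const ω
    refine HasDerivAt.sub ?_ ((hasDerivAt_id s).div_const 2)
    exact (hdiff (s • ω) (by rwa [hsn s (by linarith)])).hasFDerivAt.comp_hasDerivAt s h1
  have hnn : ∀ s : ℝ, R₁ ≤ s → 0 ≤ fderiv ℝ f (s • ω) ω - 1 / 2 := by
    intro s hs
    have hs0 : 0 < s := by linarith
    have h1 := (hdiff (s • ω) (by rwa [hsn s hs0])).hasGradientAt.hasFDerivAt.fderiv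
    have h2 := hr s (hr1.trans hs) (s • ω) (hsn s hs0)
    rw [hsn s hs0, smul_smul, inv_mul_cancel₀ hs0.ne', one_smul] at h2
    rw [h1, InnerProductSpace.toDual_apply_apply]
    have h3 : inner ℝ (gradient f (s • ω)) ω = inner ℝ (gradient f (s • ω) - ω) ω + 1 := by
      rw [inner_sub_left, real_inner_self_eq_norm_sq, hωn]; ring
    have h4 := abs_real_inner_le_norm (gradient f (s • ω) - ω) ω
    rw [hωn, mul_one] at h4
    have h5 := (abs_le.1 h4).1
    linarith
  have hmono : MonotoneOn (fun s : ℝ => f (s • ω) - s / 2) (Set.Ici R₁) := by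
    refine monotoneOn_of_deriv_nonneg (convex_Ici R₁)
      (fun s hs => (hder s hs).continuousAt.continuousWithinAt)
      (fun s hs => ?_) fun s hs => ?_
    all_goals rw [interior_Ici] at hs
    · exact (hder s (le_of_lt hs)).differentiableAt.differentiableWithinAt
    · rw [(hder s (le_of_lt hs)).deriv]
      exact hnn s (le_of_lt hs)
  have h := hmono (Set.mem_Ici.2 le_rfl) (Set.mem_Ici.2 hx) hx
  simp only [hxω] at h
  have hcx : c ≤ f (R₁ • ω) :=
    hc ⟨R₁ • ω, mem_sphere_zero_iff_norm.2 (hsn R₁ (by linarith)), rfl⟩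
  linarith

end RetardedTime

/-- The difference of the charges at retarded time `u` and on the initial hypersurface. -/
theorem eventually_charge_sub_eq_flux {Ω : Set Event} (hΩ : IsOpen Ω) {g : MetricField}
    (hgC : ∀ μ ν, ContDiffOn ℝ 3 (fun q => g q μ ν) Ω) (hgL : ∀ q ∈ Ω, IsLorentzian (g q))
    {f : Space3 → ℝ} {R₀ u₀ : ℝ} (hfC : ContDiffOn ℝ 1 f (outside R₀))
    (hf : Tendsto (fun x => gradient f x - ‖x‖⁻¹ • x) (Bornology.cobounded Space3) (𝓝 0))
    (hreg : ∀ (t : ℝ) (x : Space3), x ∈ outside R₀ →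
      (t = 0 ∨ (0 ≤ t ∧ t ≤ u₀ + f x)) → event t x ∈ Ω) (μ : Fin 4) {u : ℝ} (hu : u ≤ u₀) :
    ∀ᶠ R in atTop, charge g (translation μ) (fun x => u + f x) R
        - charge g (translation μ) (fun _ => 0) R
      = cylinderFlux (superpotential g (translation μ)) (fun x => u + f x) R := by
  obtain ⟨C, R₁, hC⟩ := exists_lower_bound_of_gradient hfC hf
  -- The last condition gives `R/2 - C ≥ -u`, hence `u + f ≥ 0` on the sphere of radius `R`.
  filter_upwards [eventually_gt_atTop R₀, eventually_ge_atTop R₁, eventually_ge_atTop 0,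
    eventually_ge_atTop (2 * (C - u))] with R h1 h2 h3 h4
  refine surfaceIntegral_sub_eq_cylinderFlux hΩ (fun α β => ?_) (fun α β q => ?_)
    (contDiffOn_const.add hfC) h3 h1 fun x hx s hs => ?_
  · rw [show superpotential g (translation μ) α β = freud g α β μ from
      funext (superpotential_translation g μ α β)]
    exact contDiffOn_freud hΩ hgC hgL _ _ _
  · rw [superpotential_translation, superpotential_translation, freud_antisymm]
  · have h5 := hC x (by rwa [hx])
    rw [hx] at h5
    have h6 : 0 ≤ u + f x := by linarith
    refine hreg _ x (by show R₀ < ‖x‖; rwa [hx]) (Or.inr ⟨mul_nonneg hs.1 h6, ?_⟩)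
    nlinarith [hs.2]

/-! ### Asymptotic calculus at spatial infinity -/

section Asymptotic

/-- The filter of neighbourhoods of spatial infinity. -/
abbrev spaceInfty : Filter Space3 := Bornology.cobounded Space3

/-- The power `r^α` as a function on space. -/
noncomputable abbrev radial (α : ℝ) : Space3 → ℝ := fun x => ‖x‖ ^ α

lemma tendsto_radial_neg {α : ℝ} (hα : 0 < α) : Tendsto (radial (-α)) spaceInfty (𝓝 0) :=
  (tendsto_rpow_neg_atTop hα).comp tendsto_norm_cobounded_atTop

lemma radial_mul (α β : ℝ) : (fun x => radial α x * radial β x) =ᶠ[spaceInfty] radial (α + β) := by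
  filter_upwards [(tendsto_norm_cobounded_atTop (E := Space3)).eventually_gt_atTop 0] with x hx
  exact (Real.rpow_add hx α β).symm

lemma isLittleO_mul_radial {F G : Space3 → ℝ} {α β : ℝ} (hF : F =o[spaceInfty] radial α)
    (hG : G =o[spaceInfty] radial β) : (fun x => F x * G x) =o[spaceInfty] radial (α + β) :=
  (hF.mul hG).congr' EventuallyEq.rfl (radial_mul α β)

lemma tendsto_of_sub_isLittleO {F : Space3 → ℝ} {c α : ℝ} (hα : 0 < α)
    (h : (fun x => F x - c) =o[spaceInfty] radial (-α)) : Tendsto F spaceInfty (𝓝 c) := by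
  have := h.isBigO.trans_tendsto (tendsto_radial_neg hα)
  simpa using this.add_const c

lemma isBigO_one_of_sub_isLittleO {F : Space3 → ℝ} {c α : ℝ} (hα : 0 < α)
    (h : (fun x => F x - c) =o[spaceInfty] radial (-α)) :
    F =O[spaceInfty] fun _ => (1 : ℝ) :=
  (tendsto_of_sub_isLittleO hα h).isBigO_one ℝ

/-- Replacing a factor with a limit changes a small product to higher order only. -/
lemma mul_sub_isLittleO {F D D₀ : Space3 → ℝ} {c α β : ℝ}
    (hα : 0 < α) (hF : (fun x => F x - c) =o[spaceInfty] radial (-α))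
    (hD : (fun x => D x - D₀ x) =o[spaceInfty] radial (-α + β))
    (hD₀ : D₀ =o[spaceInfty] radial β) :
    (fun x => F x * D x - c * D₀ x) =o[spaceInfty] radial (-α + β) := by
  have h1 : (fun x => (F x - c) * D₀ x) =o[spaceInfty] radial (-α + β) := isLittleO_mul_radial hF hD₀
  have h2 : (fun x => F x * (D x - D₀ x)) =o[spaceInfty] radial (-α + β) := by
    simpa using (isBigO_one_of_sub_isLittleO hα hF).mul_isLittleO hD
  refine (h1.add h2).congr_left fun x => ?_
  ring

/-- Differentiability at the limit gives `Φ(M) - Φ(M₀) = O(M - M₀)`. Thus inverse, determinant and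
similar functions of the metric approach their flat values at the rate of the metric. -/
lemma comp_sub_isLittleO {ι : Type*} [Fintype ι] {Φ : (ι → ι → ℝ) → ℝ} {M₀ : ι → ι → ℝ} (hΦ : DifferentiableAt ℝ Φ M₀)
    {M : Space3 → ι → ι → ℝ} {α : ℝ} (hα : 0 < α)
    (hM : ∀ i j, (fun x => M x i j - M₀ i j) =o[spaceInfty] radial (-α)) :
    (fun x => Φ (M x) - Φ M₀) =o[spaceInfty] radial (-α) := by
  have h1 : (fun x => M x - M₀) =o[spaceInfty] radial (-α) :=
    isLittleO_pi.2 fun i => isLittleO_pi.2 fun j => hM i j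
  have h2 : Tendsto M spaceInfty (𝓝 M₀) := by
    have := (h1.isBigO.trans_tendsto (tendsto_radial_neg hα)).add_const M₀
    simpa using this
  exact (hΦ.isBigO_sub.comp_tendsto h2).trans_isLittleO h1

variable {m : Type*} [Fintype m] [DecidableEq m]

lemma contDiff_det_of {k : WithTop ℕ∞} :
    ContDiff ℝ k fun A : m → m → ℝ => (Matrix.of A).det := by
  rw [← contDiffOn_univ]
  exact contDiffOn_det fun i j => (contDiff_apply_apply ℝ ℝ i j).contDiffOn

lemma differentiableAt_matrix_inv {M₀ : m → m → ℝ} (h : (Matrix.of M₀).det ≠ 0) (i j : m) :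
    DifferentiableAt ℝ (fun A : m → m → ℝ => (Matrix.of A)⁻¹ i j) M₀ := by
  have hopen : IsOpen {A : m → m → ℝ | (Matrix.of A).det ≠ 0} :=
    isOpen_ne_fun (contDiff_det_of (k := 0)).continuous continuous_const
  have h1 : ContDiffOn ℝ 1 (fun A : m → m → ℝ => (Matrix.of A)⁻¹ i j)
      {A : m → m → ℝ | (Matrix.of A).det ≠ 0} :=
    contDiffOn_matrix_inv (fun i j => (contDiff_apply_apply ℝ ℝ i j).contDiffOn)
      (fun y hy => hy) i j
  exact (h1.differentiableOn (by norm_num)).differentiableAt (hopen.mem_nhds h)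

lemma minkowski_inv : minkowski⁻¹ = minkowski := by
  refine Matrix.inv_eq_left_inv ?_
  rw [minkowski, Matrix.diagonal_mul_diagonal, ← Matrix.diagonal_one]
  congr 1
  ext i
  fin_cases i <;> simp

lemma inv_sub_minkowski_isLittleO {M : Space3 → Matrix (Fin 4) (Fin 4) ℝ} {α : ℝ} (hα : 0 < α)
    (hM : ∀ i j, (fun x => M x i j - minkowski i j) =o[spaceInfty] radial (-α)) (i j : Fin 4) :
    (fun x => (M x)⁻¹ i j - minkowski i j) =o[spaceInfty] radial (-α) := by
  have h := comp_sub_isLittleO (differentiableAt_matrix_inv (M₀ := minkowski)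
    (show minkowski.det ≠ 0 by rw [det_minkowski]; norm_num) i j) hα hM
  have e : (Matrix.of minkowski)⁻¹ = minkowski := minkowski_inv
  simp only [e] at h
  exact h

lemma inv_sub_one_isLittleO {M : Space3 → Matrix m m ℝ} {α : ℝ} (hα : 0 < α)
    (hM : ∀ i j, (fun x => M x i j - (1 : Matrix m m ℝ) i j) =o[spaceInfty] radial (-α)) (i j : m) :
    (fun x => (M x)⁻¹ i j - (1 : Matrix m m ℝ) i j) =o[spaceInfty] radial (-α) := by
  have h := comp_sub_isLittleO (differentiableAt_matrix_inv (M₀ := (1 : Matrix m m ℝ))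
    (show (1 : Matrix m m ℝ).det ≠ 0 by simp) i j) hα hM
  have e : (Matrix.of (1 : Matrix m m ℝ))⁻¹ = 1 := inv_one
  simp only [e] at h
  exact h

lemma inv_sqrt_det_sub_one_isLittleO {M : Space3 → Matrix (Fin 4) (Fin 4) ℝ} {α : ℝ} (hα : 0 < α)
    (hM : ∀ i j, (fun x => M x i j - minkowski i j) =o[spaceInfty] radial (-α)) :
    (fun x => (√|(M x).det|)⁻¹ - 1) =o[spaceInfty] radial (-α) := by
  have e : (Matrix.of minkowski).det = -1 := det_minkowski
  have hd : DifferentiableAt ℝ (fun A : Fin 4 → Fin 4 → ℝ => (√|(Matrix.of A).det|)⁻¹)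
      minkowski := by
    have h1 : DifferentiableAt ℝ (fun A : Fin 4 → Fin 4 → ℝ => (Matrix.of A).det) minkowski :=
      (contDiff_det_of (k := 1)).differentiable (by norm_num) _
    refine ((h1.abs ?_).sqrt ?_).inv ?_ <;> rw [e] <;> norm_num
  have h := comp_sub_isLittleO hd hα hM
  simp only [e, abs_neg, abs_one, Real.sqrt_one, inv_one] at h
  exact h

lemma lapse_sub_one_isLittleO {F : Space3 → ℝ} {α : ℝ} (hα : 0 < α)
    (hF : (fun x => F x - (-1)) =o[spaceInfty] radial (-α)) :
    (fun x => (√(-F x))⁻¹ - 1) =o[spaceInfty] radial (-α) := by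
  have hd : DifferentiableAt ℝ (fun y : ℝ => (√(-y))⁻¹) (-1) := by
    refine ((differentiableAt_id.neg).sqrt ?_).inv ?_ <;> norm_num
  have h := (hd.isBigO_sub.comp_tendsto (tendsto_of_sub_isLittleO hα hF)).trans_isLittleO hF
  simpa [Function.comp_def] using h

end Asymptotic

/-! ### Complementary minors of a matrix and of its inverse -/

section Minors

/-- Jacobi's identity for complementary `2 × 2` minors. -/
lemma det_mul_vol4_inv {M : Matrix (Fin 4) (Fin 4) ℝ} (hM : M.det ≠ 0)
    (i a b : Fin 4) :
    M.det * vol4 (M⁻¹ 0) (M⁻¹ i) (coordVec a) (coordVec b)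
      = vol4 (coordVec 0) (coordVec i) (M a) (M b) := by
  -- Right multiplication by `M` sends rows of the inverse to coordinate vectors and coordinate
  -- vectors to rows of `M`; taking determinants yields the identity.
  have h1 : Matrix.of ![M⁻¹ 0, M⁻¹ i, coordVec a, coordVec b] * M
      = Matrix.of ![coordVec 0, coordVec i, M a, M b] := by
    have hMM : M⁻¹ * M = 1 := Matrix.nonsing_inv_mul _ (isUnit_iff_ne_zero.2 hM)
    have hrow : ∀ c, (fun d => ∑ e, M⁻¹ c e * M e d) = coordVec c := fun c => by
      ext d
      have : (M⁻¹ * M) c d = (1 : Matrix (Fin 4) (Fin 4) ℝ) c d := by rw [hMM]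
      rw [Matrix.mul_apply] at this
      rw [this, coordVec, Matrix.one_apply, Pi.single_apply]
      simp [eq_comm]
    ext r d
    fin_cases r
    · exact congrFun (hrow 0) d
    · exact congrFun (hrow i) d
    · simp [Matrix.mul_apply, coordVec, Pi.single_apply]
    · simp [Matrix.mul_apply, coordVec, Pi.single_apply]
  rw [vol4, vol4, ← h1, Matrix.det_mul, mul_comm]

end Minors

/-! ### The components `U^{0i}` and their linearization on the initial hypersurface -/

section FreudAtTimeZero

/-- The `2 × 2` minor of the metric with rows `a`, `b` and columns `j`, `k`. -/
noncomputable def metricMinor (g : MetricField) (j k a b : Fin 4) (y : Event) : ℝ :=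
  g y a j * g y b k - g y a k * g y b j

/-- The additions in `Fin 3` are cyclic, so `(i, i+1, i+2)` is always an even permutation and no
sign appears. -/
lemma vol4_coordVec_zero_succ (i : Fin 3) (v w : Event) :
    vol4 (coordVec 0) (coordVec i.succ) v w
      = v (i + 1).succ * w (i + 2).succ - v (i + 2).succ * w (i + 1).succ := by
  rw [vol4_eq]
  fin_cases i <;> simp [coordVec]

/-- The sum `∑ g_{μγ} ∂_κ Φ_{γκ}` for the antisymmetric array `Φ` of complementary minors. -/
noncomputable def minorDivergence (c : Fin 4 → ℝ) (D : Fin 4 → Fin 4 → Fin 4 → ℝ) : ℝ :=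
  (c 0 * D 1 2 3 - c 1 * D 0 2 3) + (c 0 * D 2 3 1 - c 2 * D 0 3 1)
    + (c 0 * D 3 1 2 - c 3 * D 0 1 2) + (c 1 * D 2 0 3 - c 2 * D 1 0 3)
    + (c 1 * D 3 2 0 - c 3 * D 1 2 0) + (c 2 * D 3 0 1 - c 3 * D 2 0 1)

lemma pd_congr {F G : Event → ℝ} {q : Event} (h : F =ᶠ[𝓝 q] G) (κ : Fin 4) :
    pd κ F q = pd κ G q := by
  rw [pd, pd, h.fderiv_eq]

lemma pd_const_mul (c : ℝ) (F : Event → ℝ) (q : Event) (κ : Fin 4) :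
    pd κ (fun y => c * F y) q = c * pd κ F q := by
  rw [pd, pd, show (fun y => c * F y) = c • F from rfl, fderiv_const_smul_field]
  rfl

/-- The components `U^{0i}_μ` contain time derivatives of the spatial components of the metric
only. -/
lemma freud_zero_succ {g : MetricField} {q : Event} (hL : ∀ᶠ y in 𝓝 q, IsLorentzian (g y))
    (i : Fin 3) (μ : Fin 4) :
    freud g 0 i.succ μ q = -(1 / (16 * Real.pi)) * ((√|(g q).det|)⁻¹ * minorDivergence (g q μ)
      fun κ a b => pd κ (metricMinor g (i + 1).succ (i + 2).succ a b) q) := by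
  -- The factor `e² = -det g` in the superpotential is, up to sign, the one in Jacobi's identity. It
  -- converts minors of the inverse with rows `0, i` into minors of `g` whose columns are the two
  -- other spatial indices.
  have hJ : ∀ y, IsLorentzian (g y) → ∀ a b, (g y).det * vol4 ((g y)⁻¹ 0) ((g y)⁻¹ i.succ)
      (coordVec a) (coordVec b) = metricMinor g (i + 1).succ (i + 2).succ a b y := by
    intro y hy a b
    rw [det_mul_vol4_inv hy.det_neg.ne, vol4_coordVec_zero_succ]
    rfl
  have hsymm : ∀ y, IsLorentzian (g y) → ∀ a b, (g y)⁻¹ a b = (g y)⁻¹ b a := by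
    intro y hy a b
    have h1 : (g y).transpose = g y := by ext a b; exact hy.symm b a
    have h2 : ((g y)⁻¹).transpose = (g y)⁻¹ := by rw [Matrix.transpose_nonsing_inv, h1]
    conv_lhs => rw [← h2]
    rfl
  -- Here `(γ, κ, a, b)` will be a permutation of the four indices and `σ` its sign; the case `γ =
  -- κ` uses `σ = 0`. The factor `-(1/2)` combines `e² = -det g` with the antisymmetrization.
  have hpd : ∀ (γ κ a b : Fin 4) (σ : ℝ), (∀ G : Matrix (Fin 4) (Fin 4) ℝ,
      G 0 γ * G i.succ κ - G i.succ γ * G 0 κ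
        = σ * vol4 (G 0) (G i.succ) (coordVec a) (coordVec b)) →
      pd κ (fun y => densityRatio g y ^ 2 * (((g y)⁻¹ γ 0 * (g y)⁻¹ i.succ κ
        - (g y)⁻¹ γ i.succ * (g y)⁻¹ 0 κ) / 2)) q
      = -(1 / 2) * σ * pd κ (metricMinor g (i + 1).succ (i + 2).succ a b) q := by
    intro γ κ a b σ h
    rw [← pd_const_mul]
    refine pd_congr (hL.mono fun y hy => ?_) κ
    rw [densityRatio_sq (Ω := {y | IsLorentzian (g y)}) (fun _ h => h) hy, hsymm y hy γ 0,
      hsymm y hy γ i.succ, h, ← hJ y hy]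
    ring
  have hself : ∀ γ, pd γ (fun y => densityRatio g y ^ 2 * (((g y)⁻¹ γ 0 * (g y)⁻¹ i.succ γ
        - (g y)⁻¹ γ i.succ * (g y)⁻¹ 0 γ) / 2)) q = 0 := by
    intro γ
    rw [hpd γ γ 0 0 0 (fun G => by ring)]
    ring
  have h01 := hpd 0 1 2 3 1 fun G => by rw [vol4_eq]; simp [coordVec]; ring
  have h10 := hpd 1 0 2 3 (-1) fun G => by rw [vol4_eq]; simp [coordVec]; ring
  have h02 := hpd 0 2 3 1 1 fun G => by rw [vol4_eq]; simp [coordVec]; ring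
  have h20 := hpd 2 0 3 1 (-1) fun G => by rw [vol4_eq]; simp [coordVec]; ring
  have h03 := hpd 0 3 1 2 1 fun G => by rw [vol4_eq]; simp [coordVec]; ring
  have h30 := hpd 3 0 1 2 (-1) fun G => by rw [vol4_eq]; simp [coordVec]; ring
  have h12 := hpd 1 2 0 3 1 fun G => by rw [vol4_eq]; simp [coordVec]; ring
  have h21 := hpd 2 1 0 3 (-1) fun G => by rw [vol4_eq]; simp [coordVec]; ring
  have h13 := hpd 1 3 2 0 1 fun G => by rw [vol4_eq]; simp [coordVec]; ring
  have h31 := hpd 3 1 2 0 (-1) fun G => by rw [vol4_eq]; simp [coordVec]; ring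
  have h23 := hpd 2 3 0 1 1 fun G => by rw [vol4_eq]; simp [coordVec]; ring
  have h32 := hpd 3 2 0 1 (-1) fun G => by rw [vol4_eq]; simp [coordVec]; ring
  rw [freud]
  simp only [Fin.sum_univ_four]
  rw [hself 0, hself 1, hself 2, hself 3, h01, h10, h02, h20, h03, h30, h12, h21, h13, h31, h23,
    h32, det_minkowski, minorDivergence]
  rw [abs_neg, abs_one, mul_one, ← div_div, div_eq_mul_inv (2 / _)]
  ring

/-- The first derivatives of the metric on the initial hypersurface. -/
noncomputable def metricDeriv (g : MetricField) (κ a b : Fin 4) (x : Space3) : ℝ :=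
  pd κ (fun q => g q a b) (event 0 x)

lemma pd_metricMinor {g : MetricField} {q : Event}
    (hd : ∀ a b, DifferentiableAt ℝ (fun y => g y a b) q) (j k a b κ : Fin 4) :
    pd κ (metricMinor g j k a b) q =
      (g q b k * pd κ (fun y => g y a j) q + g q a j * pd κ (fun y => g y b k) q)
      - (g q b j * pd κ (fun y => g y a k) q + g q a k * pd κ (fun y => g y b j) q) := by
  have h := ((hd a j).hasFDerivAt.mul (hd b k).hasFDerivAt).sub
    ((hd a k).hasFDerivAt.mul (hd b j).hasFDerivAt)
  have h2 : HasFDerivAt (metricMinor g j k a b) _ q := h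
  rw [pd, h2.fderiv]
  simp only [pd]
  simp
  ring

/-- Decay of the metric and of its first derivatives on the initial hypersurface, except for the
time derivatives of lapse and shift. -/
structure FlatAtTimeZero (g : MetricField) : Prop where
  lorentzian : ∀ᶠ x in spaceInfty, ∀ᶠ q in 𝓝 (event 0 x), IsLorentzian (g q)
  differentiable : ∀ᶠ x in spaceInfty, ∀ a b, DifferentiableAt ℝ (fun q => g q a b) (event 0 x)
  metric : ∀ a b, (fun x => g (event 0 x) a b - minkowski a b) =o[spaceInfty] radial (-(1 / 2))
  spaceDeriv : ∀ (i : Fin 3) (a b : Fin 4),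
    metricDeriv g i.succ a b =o[spaceInfty] radial (-(3 / 2))
  timeDeriv : ∀ i j : Fin 3, metricDeriv g 0 i.succ j.succ =o[spaceInfty] radial (-(3 / 2))

/-- The derivative `∂_κ` of a minor of the metric, linearized at the Minkowski metric. -/
noncomputable def linMinor (g : MetricField) (j k κ a b : Fin 4) (x : Space3) : ℝ :=
  (minkowski b k * metricDeriv g κ a j x + minkowski a j * metricDeriv g κ b k x)
    - (minkowski b j * metricDeriv g κ a k x + minkowski a k * metricDeriv g κ b j x)

variable {g : MetricField}

lemma FlatAtTimeZero.deriv (hg : FlatAtTimeZero g) {κ a b : Fin 4} (h : κ ≠ 0 ∨ (a ≠ 0 ∧ b ≠ 0)) :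
    metricDeriv g κ a b =o[spaceInfty] radial (-(3 / 2)) := by
  by_cases hκ : κ = 0
  · obtain ⟨ha, hb⟩ := h.resolve_left (fun h => h hκ)
    obtain ⟨i, rfl⟩ := Fin.exists_succ_eq.2 ha
    obtain ⟨j, rfl⟩ := Fin.exists_succ_eq.2 hb
    rw [hκ]
    exact hg.timeDeriv i j
  · obtain ⟨i, rfl⟩ := Fin.exists_succ_eq.2 hκ
    exact hg.spaceDeriv i a b

lemma FlatAtTimeZero.linMinor_isLittleO (hg : FlatAtTimeZero g) (j k : Fin 3) {κ a b : Fin 4}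
    (h : κ ≠ 0 ∨ (a ≠ 0 ∧ b ≠ 0)) :
    linMinor g j.succ k.succ κ a b =o[spaceInfty] radial (-(3 / 2)) := by
  have ha : ∀ l : Fin 3, metricDeriv g κ a l.succ =o[spaceInfty] radial (-(3 / 2)) := fun l =>
    hg.deriv (h.imp id fun h => ⟨h.1, Fin.succ_ne_zero l⟩)
  have hb : ∀ l : Fin 3, metricDeriv g κ b l.succ =o[spaceInfty] radial (-(3 / 2)) := fun l =>
    hg.deriv (h.imp id fun h => ⟨h.2, Fin.succ_ne_zero l⟩)
  exact (((ha j).const_mul_left _).add ((hb k).const_mul_left _)).sub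
    (((ha k).const_mul_left _).add ((hb j).const_mul_left _))

/-- By Leibniz the error is a sum of terms `(g - η) ∂g`, of order `o(r^{-2})`. The condition on the
indices excludes the uncontrolled `∂_t g_{0ν}`: a time derivative falls only on minors with spatial
rows and columns. -/
lemma FlatAtTimeZero.pd_minor_sub_isLittleO (hg : FlatAtTimeZero g) (j k : Fin 3) {κ a b : Fin 4}
    (h : κ ≠ 0 ∨ (a ≠ 0 ∧ b ≠ 0)) :
    (fun x => pd κ (metricMinor g j.succ k.succ a b) (event 0 x)
      - linMinor g j.succ k.succ κ a b x) =o[spaceInfty] radial (-(1 / 2) + -(3 / 2)) := by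
  have ha : ∀ l : Fin 3, metricDeriv g κ a l.succ =o[spaceInfty] radial (-(3 / 2)) := fun l =>
    hg.deriv (h.imp id fun h => ⟨h.1, Fin.succ_ne_zero l⟩)
  have hb : ∀ l : Fin 3, metricDeriv g κ b l.succ =o[spaceInfty] radial (-(3 / 2)) := fun l =>
    hg.deriv (h.imp id fun h => ⟨h.2, Fin.succ_ne_zero l⟩)
  have hm : ∀ c d {D : Space3 → ℝ}, D =o[spaceInfty] radial (-(3 / 2)) →
      (fun x => (g (event 0 x) c d - minkowski c d) * D x) =o[spaceInfty]
        radial (-(1 / 2) + -(3 / 2)) := fun c d D hD => isLittleO_mul_radial (hg.metric c d) hD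
  refine ((((hm b k.succ (ha j)).add (hm a j.succ (hb k))).sub
    ((hm b j.succ (ha k)).add (hm a k.succ (hb j)))).congr' ?_ EventuallyEq.rfl)
  filter_upwards [hg.differentiable] with x hx
  rw [pd_metricMinor hx, linMinor]
  simp only [metricDeriv]
  ring

/-- The linearization of `U^{0i}_μ` on the initial hypersurface. -/
lemma FlatAtTimeZero.freud_sub_isLittleO (hg : FlatAtTimeZero g) (i : Fin 3) (μ : Fin 4) :
    (fun x => freud g 0 i.succ μ (event 0 x) - -(1 / (16 * Real.pi)) *
      minorDivergence (minkowski μ) fun κ a b => linMinor g (i + 1).succ (i + 2).succ κ a b x)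
      =o[spaceInfty] radial (-(1 / 2) + -(3 / 2)) := by
  have h12 : (0 : ℝ) < 1 / 2 := by norm_num
  -- The index condition holds for all twelve terms of `minorDivergence`, since in each of them `κ`,
  -- `a` and `b` are distinct.
  have hterm : ∀ γ κ a b : Fin 4, (κ ≠ 0 ∨ (a ≠ 0 ∧ b ≠ 0)) →
      (fun x => g (event 0 x) μ γ * pd κ (metricMinor g (i + 1).succ (i + 2).succ a b) (event 0 x)
        - minkowski μ γ * linMinor g (i + 1).succ (i + 2).succ κ a b x)
      =o[spaceInfty] radial (-(1 / 2) + -(3 / 2)) := fun γ κ a b h =>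
    mul_sub_isLittleO h12 (hg.metric μ γ) (hg.pd_minor_sub_isLittleO _ _ h)
      (hg.linMinor_isLittleO _ _ h)
  have hlin : ∀ γ κ a b : Fin 4, (κ ≠ 0 ∨ (a ≠ 0 ∧ b ≠ 0)) →
      (fun x => minkowski μ γ * linMinor g (i + 1).succ (i + 2).succ κ a b x)
      =o[spaceInfty] radial (-(3 / 2)) := fun γ κ a b h =>
    (hg.linMinor_isLittleO _ _ h).const_mul_left _
  have hsum : (fun x => minorDivergence (g (event 0 x) μ)
        (fun κ a b => pd κ (metricMinor g (i + 1).succ (i + 2).succ a b) (event 0 x))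
      - minorDivergence (minkowski μ) fun κ a b => linMinor g (i + 1).succ (i + 2).succ κ a b x)
      =o[spaceInfty] radial (-(1 / 2) + -(3 / 2)) := by
    refine (((((((hterm 0 1 2 3 (by decide)).sub (hterm 1 0 2 3 (by decide))).add
      ((hterm 0 2 3 1 (by decide)).sub (hterm 2 0 3 1 (by decide)))).add
      ((hterm 0 3 1 2 (by decide)).sub (hterm 3 0 1 2 (by decide)))).add
      ((hterm 1 2 0 3 (by decide)).sub (hterm 2 1 0 3 (by decide)))).add
      ((hterm 1 3 2 0 (by decide)).sub (hterm 3 1 2 0 (by decide)))).add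
      ((hterm 2 3 0 1 (by decide)).sub (hterm 3 2 0 1 (by decide)))).congr_left fun x => ?_
    simp only [minorDivergence]
    ring
  have hsum0 : (fun x => minorDivergence (minkowski μ) fun κ a b =>
      linMinor g (i + 1).succ (i + 2).succ κ a b x) =o[spaceInfty] radial (-(3 / 2)) :=
    ((((((hlin 0 1 2 3 (by decide)).sub (hlin 1 0 2 3 (by decide))).add
      ((hlin 0 2 3 1 (by decide)).sub (hlin 2 0 3 1 (by decide)))).add
      ((hlin 0 3 1 2 (by decide)).sub (hlin 3 0 1 2 (by decide)))).add
      ((hlin 1 2 0 3 (by decide)).sub (hlin 2 1 0 3 (by decide)))).add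
      ((hlin 1 3 2 0 (by decide)).sub (hlin 3 1 2 0 (by decide)))).add
      ((hlin 2 3 0 1 (by decide)).sub (hlin 3 2 0 1 (by decide)))
  have hall := (mul_sub_isLittleO h12 (inv_sqrt_det_sub_one_isLittleO h12 hg.metric)
    hsum hsum0).const_mul_left (-(1 / (16 * Real.pi)))
  refine hall.congr' ?_ EventuallyEq.rfl
  filter_upwards [hg.lorentzian] with x hx
  rw [freud_zero_succ hx]
  ring

end FreudAtTimeZero

/-! ### Initial data: linearized curvature, energy and momentum densities -/

section InitialData

lemma eventLinear_exists : ∃ L : Space3 →L[ℝ] Event, (∀ x, L x = event 0 x) ∧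
    ∀ i, L (EuclideanSpace.single i 1) = coordVec i.succ := by
  let L : Space3 →ₗ[ℝ] Event :=
    { toFun := fun x => event 0 x
      map_add' := fun x y => by
        ext i; refine Fin.cases ?_ (fun j => ?_) i
        · simp [event_zero]
        · simp [event_succ]
      map_smul' := fun c x => by
        ext i; refine Fin.cases ?_ (fun j => ?_) i
        · simp [event_zero]
        · simp [event_succ] }
  refine ⟨L.toContinuousLinearMap, fun x => rfl, fun i => ?_⟩
  ext j
  change event 0 _ j = _
  refine Fin.cases ?_ (fun j => ?_) j
  · simp [event_zero, coordVec]
  · simp [event_succ, coordVec, Pi.single_apply]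

lemma spd_atTimeZero {g : MetricField} {a b : Fin 4} {x : Space3}
    (h : DifferentiableAt ℝ (fun q => g q a b) (event 0 x)) (i : Fin 3) :
    spd i (atTimeZero g a b) x = metricDeriv g i.succ a b x := by
  obtain ⟨L, hL, hLi⟩ := eventLinear_exists
  have h1 : atTimeZero g a b = (fun q => g q a b) ∘ L := by
    ext y; simp [atTimeZero, hL]
  have h2 : DifferentiableAt ℝ (fun q => g q a b) (L x) := by rwa [hL]
  have h3 := h2.hasFDerivAt.comp x L.hasFDerivAt
  rw [spd, h1, h3.fderiv, metricDeriv, pd, ← hLi, ← hL]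
  rfl

lemma isLittleO_spd {v : Space3 → ℝ} {α : ℝ} (h : fderiv ℝ v =o[spaceInfty] radial α) (i : Fin 3) :
    spd i v =o[spaceInfty] radial α := by
  refine IsBigO.trans_isLittleO (IsBigO.of_bound 1 (Eventually.of_forall fun x => ?_)) h
  have := (fderiv ℝ v x).le_opNorm (EuclideanSpace.single i 1)
  rw [show ‖EuclideanSpace.single i (1 : ℝ)‖ = 1 by simp, mul_one] at this
  rw [one_mul]
  exact this

variable {g : MetricField}

/-- The bracket `∂_i g_{σj} + ∂_j g_{σi} - ∂_σ g_{ij}`. -/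
noncomputable def christoffelBracket (g : MetricField) (σ : Fin 4) (i j : Fin 3) (x : Space3) : ℝ :=
  metricDeriv g i.succ σ j.succ x + metricDeriv g j.succ σ i.succ x
    - metricDeriv g σ i.succ j.succ x

/-- The extrinsic curvature, linearized at the flat initial data. -/
noncomputable def linCurvature (g : MetricField) (i j : Fin 3) (x : Space3) : ℝ :=
  -(1 / 2) * christoffelBracket g 0 i j x

lemma christoffelTime_eq (i j : Fin 3) (x : Space3) :
    christoffelTime g i j (event 0 x) = 1 / 2 * ((g (event 0 x))⁻¹ 0 0 * christoffelBracket g 0 i j x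
      + ∑ k : Fin 3, (g (event 0 x))⁻¹ 0 k.succ * christoffelBracket g k.succ i j x) := by
  rw [christoffelTime, Fin.sum_univ_succ]
  rfl

lemma zero_lt_half : (0 : ℝ) < 1 / 2 := by norm_num

lemma christoffel_spatial_isLittleO
    (hm : ∀ a b, (fun x => g (event 0 x) a b - minkowski a b) =o[spaceInfty] radial (-(1 / 2)))
    (hs : ∀ (i : Fin 3) (a b : Fin 4), metricDeriv g i.succ a b =o[spaceInfty] radial (-(3 / 2)))
    (i j : Fin 3) :
    (fun x => ∑ k : Fin 3, (g (event 0 x))⁻¹ 0 k.succ * christoffelBracket g k.succ i j x)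
      =o[spaceInfty] radial (-(1 / 2) + -(3 / 2)) := by
  refine IsLittleO.fun_sum fun k _ => isLittleO_mul_radial ?_
    (((hs i _ _).add (hs j _ _)).sub (hs k _ _))
  have h := inv_sub_minkowski_isLittleO zero_lt_half hm 0 k.succ
  have h0 : minkowski 0 k.succ = 0 := Matrix.diagonal_apply_ne _ (Fin.succ_ne_zero k).symm
  simpa only [h0, sub_zero] using h

lemma radial_mono {α β : ℝ} (h : α ≤ β) : radial α =O[spaceInfty] radial β := by
  refine IsBigO.of_bound 1 ?_
  filter_upwards [(tendsto_norm_cobounded_atTop (E := Space3)).eventually_ge_atTop 1] with x hx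
  rw [one_mul, Real.norm_of_nonneg (by positivity), Real.norm_of_nonneg (by positivity)]
  exact Real.rpow_le_rpow_of_exponent_le hx h

lemma tendsto_inv_zero_zero
    (hm : ∀ a b, (fun x => g (event 0 x) a b - minkowski a b) =o[spaceInfty] radial (-(1 / 2))) :
    Tendsto (fun x => (g (event 0 x))⁻¹ 0 0) spaceInfty (𝓝 (-1)) := by
  have h := inv_sub_minkowski_isLittleO zero_lt_half hm 0 0
  have h0 : minkowski 0 0 = -1 := by simp [minkowski]
  rw [h0] at h
  exact tendsto_of_sub_isLittleO zero_lt_half h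

/-- The formula `K_{ij} = N Γ^0_{ij}` is linear in `∂_t g_{ij}` with a coefficient proportional to
`g^{00}`, up to the lapse. As `g^{00} → -1`, it can be solved for `∂_t g_{ij}`. -/
lemma timeDeriv_isLittleO
    (hm : ∀ a b, (fun x => g (event 0 x) a b - minkowski a b) =o[spaceInfty] radial (-(1 / 2)))
    (hs : ∀ (i : Fin 3) (a b : Fin 4), metricDeriv g i.succ a b =o[spaceInfty] radial (-(3 / 2)))
    {i j : Fin 3} (hK : extrinsicCurvature g i j =o[spaceInfty] radial (-(3 / 2))) :
    metricDeriv g 0 i.succ j.succ =o[spaceInfty] radial (-(3 / 2)) := by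
  have hG := tendsto_inv_zero_zero hm
  have hsp : (fun x => ∑ k : Fin 3, (g (event 0 x))⁻¹ 0 k.succ * christoffelBracket g k.succ i j x)
      =o[spaceInfty] radial (-(3 / 2)) :=
    (christoffel_spatial_isLittleO hm hs i j).trans_isBigO (radial_mono (by norm_num))
  have hsqrt : (fun x => √(-(g (event 0 x))⁻¹ 0 0)) =O[spaceInfty] fun _ => (1 : ℝ) :=
    (hG.neg.sqrt).isBigO_one ℝ
  have hsK : (fun x => √(-(g (event 0 x))⁻¹ 0 0) * extrinsicCurvature g i j x)
      =o[spaceInfty] radial (-(3 / 2)) := by simpa using hsqrt.mul_isLittleO hK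
  have hGinv : (fun x => ((g (event 0 x))⁻¹ 0 0)⁻¹) =O[spaceInfty] fun _ => (1 : ℝ) :=
    (hG.inv₀ (by norm_num)).isBigO_one ℝ
  have hrest : (fun x => ((g (event 0 x))⁻¹ 0 0)⁻¹ *
      ((∑ k : Fin 3, (g (event 0 x))⁻¹ 0 k.succ * christoffelBracket g k.succ i j x)
      - 2 * (√(-(g (event 0 x))⁻¹ 0 0) * extrinsicCurvature g i j x)))
      =o[spaceInfty] radial (-(3 / 2)) := by
    simpa using hGinv.mul_isLittleO (hsp.sub (hsK.const_mul_left 2))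
  refine (((hs i 0 j.succ).add (hs j 0 i.succ)).add hrest).congr' ?_ EventuallyEq.rfl
  filter_upwards [hG.eventually_lt_const (show (-1 : ℝ) < 0 by norm_num)] with x hx
  have hs0 : √(-(g (event 0 x))⁻¹ 0 0) ≠ 0 := (Real.sqrt_pos.2 (by linarith)).ne'
  rw [extrinsicCurvature, mul_inv_cancel_left₀ hs0, christoffelTime_eq]
  have := hx.ne
  simp only [christoffelBracket]
  field_simp
  ring

lemma FlatAtTimeZero.linCurvature_isLittleO (hg : FlatAtTimeZero g) (i j : Fin 3) :
    linCurvature g i j =o[spaceInfty] radial (-(3 / 2)) :=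
  (((hg.spaceDeriv i _ _).add (hg.spaceDeriv j _ _)).sub (hg.timeDeriv i j)).const_mul_left _

lemma FlatAtTimeZero.extrinsicCurvature_sub_isLittleO (hg : FlatAtTimeZero g) (i j : Fin 3) :
    (fun x => extrinsicCurvature g i j x - linCurvature g i j x)
      =o[spaceInfty] radial (-(1 / 2) + -(3 / 2)) := by
  have hG := inv_sub_minkowski_isLittleO zero_lt_half hg.metric 0 0
  have h0 : minkowski 0 0 = -1 := by simp [minkowski]
  rw [h0] at hG
  have hB : christoffelBracket g 0 i j =o[spaceInfty] radial (-(3 / 2)) :=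
    ((hg.spaceDeriv i _ _).add (hg.spaceDeriv j _ _)).sub (hg.timeDeriv i j)
  have hΓ : (fun x => christoffelTime g i j (event 0 x) - linCurvature g i j x)
      =o[spaceInfty] radial (-(1 / 2) + -(3 / 2)) := by
    refine (((isLittleO_mul_radial hG hB).add
      (christoffel_spatial_isLittleO hg.metric hg.spaceDeriv i j)).const_mul_left (1 / 2)).congr_left
      fun x => ?_
    rw [christoffelTime_eq, linCurvature]
    ring
  refine (mul_sub_isLittleO zero_lt_half (lapse_sub_one_isLittleO zero_lt_half hG) hΓ
    (hg.linCurvature_isLittleO i j)).congr_left fun x => ?_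
  rw [extrinsicCurvature, one_mul]

lemma minkowski_succ_succ (i j : Fin 3) :
    minkowski i.succ j.succ = (1 : Matrix (Fin 3) (Fin 3) ℝ) i j := by
  fin_cases i <;> fin_cases j <;> simp [minkowski]

lemma FlatAtTimeZero.spatialMetric_sub_isLittleO (hg : FlatAtTimeZero g) (i j : Fin 3) :
    (fun x => spatialMetric g x i j - (1 : Matrix (Fin 3) (Fin 3) ℝ) i j)
      =o[spaceInfty] radial (-(1 / 2)) := by
  rw [← minkowski_succ_succ]
  exact hg.metric i.succ j.succ

lemma FlatAtTimeZero.meanCurvature_sub_isLittleO (hg : FlatAtTimeZero g) :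
    (fun x => meanCurvature g x - ∑ i, linCurvature g i i x)
      =o[spaceInfty] radial (-(1 / 2) + -(3 / 2)) := by
  have h : (fun x => ∑ i, ∑ j, ((spatialMetric g x)⁻¹ i j * extrinsicCurvature g i j x
      - (1 : Matrix (Fin 3) (Fin 3) ℝ) i j * linCurvature g i j x))
      =o[spaceInfty] radial (-(1 / 2) + -(3 / 2)) :=
    IsLittleO.fun_sum fun i _ => IsLittleO.fun_sum fun j _ => mul_sub_isLittleO zero_lt_half
      (inv_sub_one_isLittleO zero_lt_half hg.spatialMetric_sub_isLittleO i j)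
      (hg.extrinsicCurvature_sub_isLittleO i j) (hg.linCurvature_isLittleO i j)
  refine h.congr_left fun x => ?_
  simp only [meanCurvature, Finset.sum_sub_distrib, Matrix.one_apply, ite_mul, one_mul, zero_mul,
    Finset.sum_ite_eq, Finset.mem_univ, if_true]

/-- The linearization of the ADM momentum density. -/
lemma FlatAtTimeZero.momentum_sub_isLittleO (hg : FlatAtTimeZero g) (i j : Fin 3) :
    (fun x => (extrinsicCurvature g i j x - meanCurvature g x * spatialMetric g x i j)
      - (linCurvature g i j x - (∑ k, linCurvature g k k x) * (1 : Matrix (Fin 3) (Fin 3) ℝ) i j))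
      =o[spaceInfty] radial (-(1 / 2) + -(3 / 2)) := by
  have h := mul_sub_isLittleO zero_lt_half (hg.spatialMetric_sub_isLittleO i j)
    hg.meanCurvature_sub_isLittleO
    (IsLittleO.fun_sum fun k _ => hg.linCurvature_isLittleO k k)
  refine ((hg.extrinsicCurvature_sub_isLittleO i j).sub h).congr_left fun x => ?_
  ring

lemma metricDeriv_symm {x : Space3} (hL : ∀ᶠ q in 𝓝 (event 0 x), IsLorentzian (g q))
    (κ a b : Fin 4) : metricDeriv g κ a b x = metricDeriv g κ b a x :=
  pd_congr (hL.mono fun _ hy => hy.symm a b) κ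

/-- Only the coefficient `c 0 = -1` survives, leaving spatial derivatives of spatial minors;
expanding these about the identity gives the ADM energy density. -/
lemma minorDivergence_zero {x : Space3} (hL : ∀ᶠ q in 𝓝 (event 0 x), IsLorentzian (g q))
    (i : Fin 3) :
    minorDivergence (minkowski 0) (fun κ a b => linMinor g (i + 1).succ (i + 2).succ κ a b x)
      = ∑ j : Fin 3, (metricDeriv g j.succ i.succ j.succ x
        - metricDeriv g i.succ j.succ j.succ x) := by
  have hs := metricDeriv_symm hL
  fin_cases i <;>
    simp [minorDivergence, linMinor, minkowski, Fin.sum_univ_three, hs _ 2 1, hs _ 3 1, hs _ 3 2] <;> ring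

/-- Besides twice the linearized momentum density, spatial derivatives of the shift `g_{0c}` remain.
They need not be small enough to discard, being only `o(r^{-3/2})`, but they form the curl of `e_k ×
(g_{0c})`. -/
lemma minorDivergence_succ {x : Space3} (hL : ∀ᶠ q in 𝓝 (event 0 x), IsLorentzian (g q))
    (i k : Fin 3) :
    minorDivergence (minkowski k.succ)
        (fun κ a b => linMinor g (i + 1).succ (i + 2).succ κ a b x)
      = 2 * (linCurvature g k i x
          - (∑ l, linCurvature g l l x) * (1 : Matrix (Fin 3) (Fin 3) ℝ) k i)
        - ((∑ c : Fin 3, metricDeriv g c.succ 0 c.succ x) * (1 : Matrix (Fin 3) (Fin 3) ℝ) k i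
          - metricDeriv g k.succ 0 i.succ x) := by
  have hs := metricDeriv_symm hL
  fin_cases i <;> fin_cases k <;>
    simp [minorDivergence, linMinor, linCurvature, christoffelBracket, minkowski,
      Fin.sum_univ_three, hs _ 2 1, hs _ 3 1, hs _ 3 2] <;> ring

end InitialData

/-! ### Fluxes through large spheres -/

section SphereFlux

/-- The flux `∫_{|x| = R} G_i (x^i / R) dA`. -/
noncomputable def sphereFlux (G : Fin 3 → Space3 → ℝ) (R : ℝ) : ℝ :=
  sphereIntegral (fun x => ∑ i, G i x * (x i / R)) R

lemma continuous_comp_spherePt {F : Space3 → ℝ} {R₀ R : ℝ} (hF : ContinuousOn F (outside R₀))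
    (hR0 : 0 ≤ R) (hR : R₀ < R) : Continuous fun p : ℝ × ℝ => F (spherePt R p.1 p.2) :=
  hF.comp_continuous (continuous_spherePt R) fun p => by
    show R₀ < ‖_‖; rwa [norm_spherePt hR0]

lemma continuous_spherePt_apply (R : ℝ) (i : Fin 3) :
    Continuous fun p : ℝ × ℝ => spherePt R p.1 p.2 i :=
  (EuclideanSpace.proj (𝕜 := ℝ) i).continuous.comp (continuous_spherePt R)

lemma continuous_sphereFlux_integrand {G : Fin 3 → Space3 → ℝ} {R₀ R : ℝ}
    (hG : ∀ i, ContinuousOn (G i) (outside R₀)) (hR0 : 0 ≤ R) (hR : R₀ < R) :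
    Continuous fun p : ℝ × ℝ => (∑ i, G i (spherePt R p.1 p.2) * (spherePt R p.1 p.2 i / R))
      * (R ^ 2 * Real.sin p.1) :=
  (continuous_finsetSum _ fun i _ => (continuous_comp_spherePt (hG i) hR0 hR).mul
    ((continuous_spherePt_apply R i).div_const R)).mul (by fun_prop)

lemma sphereFlux_sub {G H : Fin 3 → Space3 → ℝ} {R₀ R : ℝ}
    (hG : ∀ i, ContinuousOn (G i) (outside R₀)) (hH : ∀ i, ContinuousOn (H i) (outside R₀))
    (hR0 : 0 ≤ R) (hR : R₀ < R) :
    sphereFlux (fun i x => G i x - H i x) R = sphereFlux G R - sphereFlux H R := by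
  simp only [sphereFlux, sphereIntegral]
  rw [← integral_sphere_sub
    (F := fun θ φ => (∑ i, G i (spherePt R θ φ) * (spherePt R θ φ i / R)) * (R ^ 2 * Real.sin θ))
    (G := fun θ φ => (∑ i, H i (spherePt R θ φ) * (spherePt R θ φ i / R)) * (R ^ 2 * Real.sin θ))
    (continuous_sphereFlux_integrand hG hR0 hR) (continuous_sphereFlux_integrand hH hR0 hR)]
  simp only [sub_mul, Finset.sum_sub_distrib]

lemma sphereFlux_const_mul (c : ℝ) (G : Fin 3 → Space3 → ℝ) (R : ℝ) :
    sphereFlux (fun i x => c * G i x) R = c * sphereFlux G R := by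
  simp only [sphereFlux, sphereIntegral, mul_assoc, ← Finset.mul_sum,
    intervalIntegral.integral_const_mul]

lemma tendsto_sphereFlux_zero {G : Fin 3 → Space3 → ℝ}
    (hG : ∀ i, G i =o[spaceInfty] radial (-(1 / 2) + -(3 / 2))) :
    Tendsto (sphereFlux G) atTop (𝓝 0) := by
  rw [Metric.tendsto_nhds]
  intro ε hε
  -- The integrand is bounded by `3δ` on a parameter rectangle of area `2π²`, so the flux is at most
  -- `6π² δ = 6ε/8 < ε`.
  set δ := ε / (8 * Real.pi ^ 2) with hδ
  have hπ := Real.pi_pos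
  have hδ0 : 0 < δ := by positivity
  have hb : ∀ᶠ x in spaceInfty, ∀ i, ‖G i x‖ ≤ δ * ‖radial (-(1 / 2) + -(3 / 2)) x‖ :=
    eventually_all.2 fun i => (hG i).def hδ0
  rw [spaceInfty, ← comap_norm_atTop, eventually_comap] at hb
  filter_upwards [hb, eventually_gt_atTop 0] with R hR hR0
  have hpt : ∀ θ φ, ‖(∑ i, G i (spherePt R θ φ) * (spherePt R θ φ i / R)) *
      (R ^ 2 * Real.sin θ)‖ ≤ 3 * δ := by
    intro θ φ
    have hn := norm_spherePt hR0.le θ φ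
    have h1 : ∀ i, ‖G i (spherePt R θ φ) * (spherePt R θ φ i / R)‖ ≤ δ * (R ^ 2)⁻¹ := by
      intro i
      have h2 := hR _ hn i
      rw [Real.norm_of_nonneg (by positivity : 0 ≤ radial (-(1 / 2) + -(3 / 2)) (spherePt R θ φ)),
        radial, hn, show (-(1 / 2) + -(3 / 2) : ℝ) = -((2 : ℕ) : ℝ) by norm_num,
        Real.rpow_neg hR0.le, Real.rpow_natCast] at h2
      have h3 : ‖spherePt R θ φ i / R‖ ≤ 1 := by
        rw [norm_div, Real.norm_of_nonneg hR0.le, div_le_one hR0]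
        exact (PiLp.norm_apply_le _ i).trans hn.le
      rw [norm_mul]
      calc _ ≤ δ * (R ^ 2)⁻¹ * 1 := by gcongr
        _ = _ := mul_one _
    have h4 : ‖∑ i, G i (spherePt R θ φ) * (spherePt R θ φ i / R)‖ ≤ 3 * (δ * (R ^ 2)⁻¹) := by
      refine (norm_sum_le _ _).trans ((Finset.sum_le_sum fun i _ => h1 i).trans_eq ?_)
      simp
    have h5 : ‖R ^ 2 * Real.sin θ‖ ≤ R ^ 2 := by
      rw [norm_mul, Real.norm_of_nonneg (sq_nonneg R)]
      exact mul_le_of_le_one_right (sq_nonneg R) (Real.abs_sin_le_one θ)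
    rw [norm_mul]
    calc _ ≤ 3 * (δ * (R ^ 2)⁻¹) * R ^ 2 := by gcongr
      _ = 3 * δ := by field_simp
  have hin : ∀ θ, ‖∫ φ in (0 : ℝ)..(2 * Real.pi),
      (∑ i, G i (spherePt R θ φ) * (spherePt R θ φ i / R)) * (R ^ 2 * Real.sin θ)‖
        ≤ 3 * δ * (2 * Real.pi) := by
    intro θ
    have := intervalIntegral.norm_integral_le_of_norm_le_const (a := 0) (b := 2 * Real.pi)
      fun φ _ => hpt θ φ
    rwa [sub_zero, abs_of_pos (by positivity)] at this
  have hout := intervalIntegral.norm_integral_le_of_norm_le_const (a := 0) (b := Real.pi)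
      fun θ _ => hin θ
  rw [sub_zero, abs_of_pos hπ] at hout
  rw [dist_zero_right]
  refine lt_of_le_of_lt hout ?_
  have : 3 * δ * (2 * Real.pi) * Real.pi = 6 / 8 * ε := by
    rw [hδ]; field_simp; norm_num
  rw [this]; linarith

/-- The area element: `x_θ × x_φ = R² sin θ (x / R)`. -/
lemma sphere_normal_zero {R : ℝ} (hR : R ≠ 0) (θ φ : ℝ) :
    sphereDθ R θ φ 1 * sphereDφ R θ φ 2 - sphereDθ R θ φ 2 * sphereDφ R θ φ 1
      = spherePt R θ φ 0 / R * (R ^ 2 * Real.sin θ) := by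
  simp [sphereDθ, sphereDφ, spherePt]
  field_simp

lemma sphere_normal_one {R : ℝ} (hR : R ≠ 0) (θ φ : ℝ) :
    sphereDθ R θ φ 0 * sphereDφ R θ φ 2 - sphereDθ R θ φ 2 * sphereDφ R θ φ 0
      = -(spherePt R θ φ 1 / R * (R ^ 2 * Real.sin θ)) := by
  simp [sphereDθ, sphereDφ, spherePt]
  field_simp

lemma sphere_normal_two {R : ℝ} (hR : R ≠ 0) (θ φ : ℝ) :
    sphereDθ R θ φ 0 * sphereDφ R θ φ 1 - sphereDθ R θ φ 1 * sphereDφ R θ φ 0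
      = spherePt R θ φ 2 / R * (R ^ 2 * Real.sin θ) := by
  simp [sphereDθ, sphereDφ, spherePt]
  field_simp
  linear_combination (Real.sin θ * Real.cos θ) * Real.sin_sq_add_cos_sq φ

lemma hasDerivAt_comp_space {F : Space3 → ℝ} {x : ℝ → Space3} {s : ℝ} {x' : Space3}
    (hF : DifferentiableAt ℝ F (x s)) (hx : HasDerivAt x x' s) :
    HasDerivAt (fun s => F (x s)) (∑ c, x' c * spd c F (x s)) s := by
  have h := hF.hasFDerivAt.comp_hasDerivAt s hx
  have e : fderiv ℝ F (x s) x' = ∑ c, x' c * spd c F (x s) := by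
    have hx' : x' = ∑ c, x' c • EuclideanSpace.single c (1 : ℝ) := by
      ext j; simp [Pi.single_apply]
    conv_lhs => rw [hx']
    simp [map_sum, spd]
  rwa [e] at h

/-- The flux of the curl of `e_k × h` through a sphere vanishes. -/
lemma sphereFlux_curl_eq_zero {h : Fin 3 → Space3 → ℝ} {R₀ R : ℝ}
    (hh : ∀ i, ContDiffOn ℝ 1 (h i) (outside R₀)) (hR0 : 0 < R) (hR : R₀ < R) (k : Fin 3) :
    sphereFlux (fun i x => (∑ c, spd c (h c) x) * (1 : Matrix (Fin 3) (Fin 3) ℝ) k i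
      - spd k (h i) x) R = 0 := by
  have hx : ∀ θ φ, spherePt R θ φ ∈ outside R₀ := fun θ φ => by
    show R₀ < ‖_‖; rwa [norm_spherePt hR0.le]
  have hd : ∀ i θ φ, DifferentiableAt ℝ (h i) (spherePt R θ φ) := fun i θ φ =>
    ((hh i).differentiableOn (by norm_num)).differentiableAt
      ((isOpen_outside R₀).mem_nhds (hx θ φ))
  set H : Fin 3 → ℝ → ℝ → ℝ := fun i θ φ => h i (spherePt R θ φ) with hH
  set S : Fin 3 → Fin 3 → ℝ → ℝ → ℝ := fun c i θ φ => spd c (h i) (spherePt R θ φ) with hS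
  set v : Fin 3 → ℝ → ℝ → ℝ := fun i θ φ => sphereDθ R θ φ i with hv
  set w : Fin 3 → ℝ → ℝ → ℝ := fun i θ φ => sphereDφ R θ φ i with hw
  set z : Fin 3 → ℝ → ℝ → ℝ := fun i θ φ =>
    (!₂[-(R * (Real.cos θ * Real.sin φ)), R * (Real.cos θ * Real.cos φ), 0] : Space3) i with hz
  have hHθ : ∀ i θ φ, HasDerivAt (fun θ => H i θ φ) (∑ c, v c θ φ * S c i θ φ) θ :=
    fun i θ φ => hasDerivAt_comp_space (hd i θ φ) (hasDerivAt_spherePt_θ R θ φ)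
  have hHφ : ∀ i θ φ, HasDerivAt (fun φ => H i θ φ) (∑ c, w c θ φ * S c i θ φ) φ :=
    fun i θ φ => hasDerivAt_comp_space (hd i θ φ) (hasDerivAt_spherePt_φ R θ φ)
  have hwθ : ∀ i θ φ, HasDerivAt (fun θ => w i θ φ) (z i θ φ) θ := fun i θ φ =>
    hasDerivAt_coord (hasDerivAt_sphereDφ_θ R θ φ) i
  have hvφ : ∀ i θ φ, HasDerivAt (fun φ => v i θ φ) (z i θ φ) φ := fun i θ φ =>
    hasDerivAt_coord (hasDerivAt_sphereDθ_φ R θ φ) i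
  have hcH : ∀ i, Continuous fun p : ℝ × ℝ => H i p.1 p.2 := fun i =>
    continuous_comp_spherePt (hh i).continuousOn hR0.le hR
  have hcS : ∀ c i, Continuous fun p : ℝ × ℝ => S c i p.1 p.2 := fun c i =>
    continuous_comp_spherePt (((hh i).continuousOn_fderiv_of_isOpen (isOpen_outside R₀)
      le_rfl).clm_apply continuousOn_const) hR0.le hR
  have hcv : ∀ i, Continuous fun p : ℝ × ℝ => v i p.1 p.2 := fun i =>
    (EuclideanSpace.proj (𝕜 := ℝ) i).continuous.comp (continuous_sphereDθ R)
  have hcw : ∀ i, Continuous fun p : ℝ × ℝ => w i p.1 p.2 := fun i =>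
    (EuclideanSpace.proj (𝕜 := ℝ) i).continuous.comp (continuous_sphereDφ R)
  have hcz : ∀ i, Continuous fun p : ℝ × ℝ => z i p.1 p.2 := fun i =>
    (EuclideanSpace.proj (𝕜 := ℝ) i).continuous.comp
      (by fun_prop : Continuous fun p : ℝ × ℝ => (!₂[-(R * (Real.cos p.1 * Real.sin p.2)),
        R * (Real.cos p.1 * Real.cos p.2), 0] : Space3))
  -- With `A = e_k × h`, these are `P = A · x_φ` and `Q = -A · x_θ`, the components of the
  -- pulled-back 1-form `A · dx`; moreover `curl A = (div h) e_k - ∂_k h`.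
  have key := integral_sphere_divergence_eq_zero
    (P := fun θ φ => H (k + 1) θ φ * w (k + 2) θ φ - H (k + 2) θ φ * w (k + 1) θ φ)
    (Q := fun θ φ => -(H (k + 1) θ φ * v (k + 2) θ φ - H (k + 2) θ φ * v (k + 1) θ φ))
    (P' := fun θ φ =>
      ((∑ c, v c θ φ * S c (k + 1) θ φ) * w (k + 2) θ φ + H (k + 1) θ φ * z (k + 2) θ φ)
      - ((∑ c, v c θ φ * S c (k + 2) θ φ) * w (k + 1) θ φ + H (k + 2) θ φ * z (k + 1) θ φ))
    (Q' := fun θ φ => -(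
      ((∑ c, w c θ φ * S c (k + 1) θ φ) * v (k + 2) θ φ + H (k + 1) θ φ * z (k + 2) θ φ)
      - ((∑ c, w c θ φ * S c (k + 2) θ φ) * v (k + 1) θ φ + H (k + 2) θ φ * z (k + 1) θ φ)))
    (fun θ φ => ((hHθ _ θ φ).mul (hwθ _ θ φ)).sub ((hHθ _ θ φ).mul (hwθ _ θ φ)))
    (fun θ φ => (((hHφ _ θ φ).mul (hvφ _ θ φ)).sub ((hHφ _ θ φ).mul (hvφ _ θ φ))).neg)
    ((((continuous_finsetSum _ fun c _ => (hcv c).mul (hcS c _)).mul (hcw _)).add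
      ((hcH _).mul (hcz _))).sub
      (((continuous_finsetSum _ fun c _ => (hcv c).mul (hcS c _)).mul (hcw _)).add
      ((hcH _).mul (hcz _))))
    (((((continuous_finsetSum _ fun c _ => (hcw c).mul (hcS c _)).mul (hcv _)).add
      ((hcH _).mul (hcz _))).sub
      (((continuous_finsetSum _ fun c _ => (hcw c).mul (hcS c _)).mul (hcv _)).add
      ((hcH _).mul (hcz _)))).neg)
    (fun φ => by
      simp only [hw, sphereDφ_eq_zero Real.sin_pi, sphereDφ_eq_zero Real.sin_zero]
      simp)
    (fun θ => by
      have h1 : spherePt R θ (2 * Real.pi) = spherePt R θ 0 := by simp [spherePt]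
      have h2 : sphereDθ R θ (2 * Real.pi) = sphereDθ R θ 0 := by simp [sphereDθ]
      simp only [hH, hv, h1, h2])
  rw [← key, sphereFlux, sphereIntegral]
  refine intervalIntegral.integral_congr fun θ _ => intervalIntegral.integral_congr fun φ _ => ?_
  have n0 := sphere_normal_zero hR0.ne' θ φ
  have n1 := sphere_normal_one hR0.ne' θ φ
  have n2 := sphere_normal_two hR0.ne' θ φ
  have hdist : ∀ G : Fin 3 → ℝ, (∑ i, G i * (spherePt R θ φ i / R)) * (R ^ 2 * Real.sin θ)
      = G 0 * (v 1 θ φ * w 2 θ φ - v 2 θ φ * w 1 θ φ)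
        - G 1 * (v 0 θ φ * w 2 θ φ - v 2 θ φ * w 0 θ φ)
        + G 2 * (v 0 θ φ * w 1 θ φ - v 1 θ φ * w 0 θ φ) := by
    intro G
    rw [Fin.sum_univ_three]
    simp only [hv, hw]
    rw [n0, n1, n2]
    ring
  change (∑ i, ((∑ c, S c c θ φ) * (1 : Matrix (Fin 3) (Fin 3) ℝ) k i - S k i θ φ)
    * (spherePt R θ φ i / R)) * (R ^ 2 * Real.sin θ) = _
  rw [hdist fun i => (∑ c, S c c θ φ) * (1 : Matrix (Fin 3) (Fin 3) ℝ) k i - S k i θ φ]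
  clear_value H S v w z
  simp only [Fin.sum_univ_three]
  fin_cases k <;> simp [Matrix.one_apply] <;> ring

/-- On `{t = 0}` the tangent vectors have no time component, so only the components `U^{0i}` are
integrated. The sign comes from the order of the indices in `dS_{αβ}`. -/
lemma charge_zero_eq_sphereFlux (g : MetricField) (μ : Fin 4) {R : ℝ} (hR : 0 < R) :
    charge g (translation μ) (fun _ => 0) R
      = sphereFlux (fun i x => -freud g 0 i.succ μ (event 0 x)) R := by
  rw [charge, surfaceIntegral, sphereFlux, sphereIntegral, ← intervalIntegral.integral_const_mul]
  refine intervalIntegral.integral_congr fun θ _ => ?_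
  rw [← intervalIntegral.integral_const_mul]
  refine intervalIntegral.integral_congr fun φ _ => ?_
  simp only [superpotential_translation]
  rw [(hasDerivAt_event (hasDerivAt_const θ 0) (hasDerivAt_spherePt_θ R θ φ)).deriv,
    (hasDerivAt_event (hasDerivAt_const φ 0) (hasDerivAt_spherePt_φ R θ φ)).deriv,
    sum_sum_vol4 (V := fun α β => freud g α β μ (event 0 (spherePt R θ φ)))
      (fun α β => freud_antisymm g α β μ _)]
  have n0 := sphere_normal_zero hR.ne' θ φ
  have n1 := sphere_normal_one hR.ne' θ φ
  have n2 := sphere_normal_two hR.ne' θ φ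
  set F := fun α β => freud g α β μ (event 0 (spherePt R θ φ))
  change 1 / 2 * (-2 * (F 0 1 *
      (sphereDθ R θ φ 1 * sphereDφ R θ φ 2 - sphereDθ R θ φ 2 * sphereDφ R θ φ 1)
    - F 0 2 * (sphereDθ R θ φ 0 * sphereDφ R θ φ 2 - sphereDθ R θ φ 2 * sphereDφ R θ φ 0)
    + F 0 3 * (sphereDθ R θ φ 0 * sphereDφ R θ φ 1 - sphereDθ R θ φ 1 * sphereDφ R θ φ 0)
    + F 1 2 * (0 * sphereDφ R θ φ 2 - sphereDθ R θ φ 2 * 0)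
    - F 1 3 * (0 * sphereDφ R θ φ 1 - sphereDθ R θ φ 1 * 0)
    + F 2 3 * (0 * sphereDφ R θ φ 0 - sphereDθ R θ φ 0 * 0)))
    = (∑ i : Fin 3, -F 0 i.succ * (spherePt R θ φ i / R)) * (R ^ 2 * Real.sin θ)
  rw [n0, n1, n2, Fin.sum_univ_three]
  change _ = (-F 0 1 * _ + -F 0 2 * _ + -F 0 3 * _) * _
  ring

end SphereFlux

/-! ### Convergence of the charges on the initial hypersurface to the ADM four-momentum -/

section ADMLimit

variable {Ω : Set Event} {g : MetricField} {R₀ : ℝ}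

lemma contDiffOn_atTimeZero (hgC : ∀ μ ν, ContDiffOn ℝ 3 (fun q => g q μ ν) Ω)
    (hsub : ∀ x ∈ outside R₀, event 0 x ∈ Ω) (a b : Fin 4) :
    ContDiffOn ℝ 3 (atTimeZero g a b) (outside R₀) := by
  obtain ⟨L, hL, -⟩ := eventLinear_exists
  have h := (hgC a b).comp (L.contDiff (n := 3)).contDiffOn (s := outside R₀) fun x hx => by
    show L x ∈ Ω
    rw [hL]; exact hsub x hx
  refine h.congr fun x _ => ?_
  simp [atTimeZero, hL]

lemma continuousOn_comp_event {F : Event → ℝ} (hF : ContinuousOn F Ω)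
    (hsub : ∀ x ∈ outside R₀, event 0 x ∈ Ω) :
    ContinuousOn (fun x => F (event 0 x)) (outside R₀) :=
  hF.comp (continuous_event.comp (Continuous.prodMk continuous_const continuous_id)).continuousOn
    hsub

lemma differentiableAt_metric (hΩ : IsOpen Ω)
    (hgC : ∀ μ ν, ContDiffOn ℝ 3 (fun q => g q μ ν) Ω)
    (hsub : ∀ x ∈ outside R₀, event 0 x ∈ Ω) {x : Space3} (hx : x ∈ outside R₀) (a b : Fin 4) :
    DifferentiableAt ℝ (fun q => g q a b) (event 0 x) :=
  ((hgC a b).differentiableOn (by norm_num)).differentiableAt (hΩ.mem_nhds (hsub x hx))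

lemma flatAtTimeZero (hΩ : IsOpen Ω) (hgC : ∀ μ ν, ContDiffOn ℝ 3 (fun q => g q μ ν) Ω)
    (hgL : ∀ q ∈ Ω, IsLorentzian (g q)) (hsub : ∀ x ∈ outside R₀, event 0 x ∈ Ω)
    (hdecay_g : ∀ μ ν, IsOSobolev 3 (-1 / 2) (fun x => atTimeZero g μ ν x - minkowski μ ν))
    (hdecay_K : ∀ i j, IsOSobolev 2 (-3 / 2) (extrinsicCurvature g i j)) :
    FlatAtTimeZero g := by
  have hm : ∀ a b, (fun x => g (event 0 x) a b - minkowski a b)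
      =o[spaceInfty] radial (-(1 / 2)) := fun a b => by
    have h := ((hdecay_g a b).of_le (show 2 ≤ 3 by norm_num)).isLittleO
    rwa [neg_div] at h
  have hs : ∀ (i : Fin 3) (a b : Fin 4),
      metricDeriv g i.succ a b =o[spaceInfty] radial (-(3 / 2)) := fun i a b => by
    have h := isLittleO_spd (hdecay_g a b).fderiv_isLittleO i
    rw [show (-1 / 2 - 1 : ℝ) = -(3 / 2) by norm_num] at h
    refine h.congr' ?_ EventuallyEq.rfl
    filter_upwards [outside_mem_cobounded R₀] with x hx
    rw [← spd_atTimeZero (differentiableAt_metric hΩ hgC hsub hx a b), spd, spd,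
      fderiv_sub_const]
  have hK : ∀ i j, extrinsicCurvature g i j =o[spaceInfty] radial (-(3 / 2)) := fun i j => by
    have h := (hdecay_K i j).isLittleO
    rwa [neg_div] at h
  refine ⟨?_, ?_, hm, hs, fun i j => timeDeriv_isLittleO hm hs (hK i j)⟩
  · filter_upwards [outside_mem_cobounded R₀] with x hx
    filter_upwards [hΩ.mem_nhds (hsub x hx)] with q hq using hgL q hq
  · filter_upwards [outside_mem_cobounded R₀] with x hx a b
    exact differentiableAt_metric hΩ hgC hsub hx a b

/-- The density of the ADM energy. -/
noncomputable def energyDensity (g : MetricField) (i : Fin 3) (x : Space3) : ℝ :=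
  ∑ j : Fin 3, (spd j (fun y => spatialMetric g y i j) x - spd i (fun y => spatialMetric g y j j) x)

/-- The density of the ADM momentum. -/
noncomputable def momentumDensity (g : MetricField) (k i : Fin 3) (x : Space3) : ℝ :=
  extrinsicCurvature g k i x - meanCurvature g x * spatialMetric g x k i

lemma admEnergy_eq_sphereFlux (g : MetricField) (R : ℝ) :
    admEnergy g R = 1 / (16 * Real.pi) * sphereFlux (energyDensity g) R := by
  simp only [admEnergy, sphereFlux, energyDensity, Finset.sum_mul]

lemma admMomentum_eq_sphereFlux (g : MetricField) (k : Fin 3) (R : ℝ) :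
    admMomentum g k R = 1 / (8 * Real.pi) * sphereFlux (momentumDensity g k) R := rfl

lemma continuousOn_spd_atTimeZero (hgC : ∀ μ ν, ContDiffOn ℝ 3 (fun q => g q μ ν) Ω)
    (hsub : ∀ x ∈ outside R₀, event 0 x ∈ Ω) (i : Fin 3) (a b : Fin 4) :
    ContinuousOn (spd i (atTimeZero g a b)) (outside R₀) :=
  ((contDiffOn_atTimeZero hgC hsub a b).continuousOn_fderiv_of_isOpen (isOpen_outside R₀)
    (by norm_num)).clm_apply continuousOn_const

lemma continuousOn_freud (hΩ : IsOpen Ω) (hgC : ∀ μ ν, ContDiffOn ℝ 3 (fun q => g q μ ν) Ω)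
    (hgL : ∀ q ∈ Ω, IsLorentzian (g q)) (hsub : ∀ x ∈ outside R₀, event 0 x ∈ Ω)
    (ν l β : Fin 4) : ContinuousOn (fun x => freud g ν l β (event 0 x)) (outside R₀) :=
  continuousOn_comp_event (contDiffOn_freud hΩ hgC hgL ν l β).continuousOn hsub

/-- Continuity is what permits splitting the flux integrals into sums. It holds only far out, where
the extrinsic curvature is known to be regular and the determinant of the induced metric is nonzero.
-/
lemma exists_continuousOn_momentumDensity
    (hgC : ∀ μ ν, ContDiffOn ℝ 3 (fun q => g q μ ν) Ω) (hsub : ∀ x ∈ outside R₀, event 0 x ∈ Ω)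
    (hflat : FlatAtTimeZero g)
    (hdecay_K : ∀ i j, IsOSobolev 2 (-3 / 2) (extrinsicCurvature g i j)) :
    ∃ R₁ ≥ R₀, ∀ k i, ContinuousOn (momentumDensity g k i) (outside R₁) := by
  have hdet : ∀ᶠ x in spaceInfty, (spatialMetric g x).det ≠ 0 := by
    have h : Tendsto (fun x => (spatialMetric g x).det) spaceInfty (𝓝 1) := by
      have h1 := comp_sub_isLittleO (Φ := fun A : Fin 3 → Fin 3 → ℝ => (Matrix.of A).det)
        (M₀ := (1 : Matrix (Fin 3) (Fin 3) ℝ))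
        ((contDiff_det_of (k := 1)).differentiable (by norm_num) _) zero_lt_half
        hflat.spatialMetric_sub_isLittleO
      have e : (Matrix.of (1 : Matrix (Fin 3) (Fin 3) ℝ)).det = 1 := Matrix.det_one
      simp only [e] at h1
      exact tendsto_of_sub_isLittleO zero_lt_half h1
    exact h.eventually_ne one_ne_zero
  rw [spaceInfty, ← comap_norm_atTop, eventually_comap] at hdet
  obtain ⟨r, hr⟩ := eventually_atTop.1 hdet
  choose RK hRK using hdecay_K
  -- The sum of absolute values dominates each of the nine radii beyond which the `K_{ij}` are
  -- regular.
  set R₁ := max (max R₀ r) (∑ i, ∑ j, |RK i j|)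
  have hR0 : R₀ ≤ R₁ := (le_max_left _ _).trans (le_max_left _ _)
  have hr1 : r ≤ R₁ := (le_max_right _ _).trans (le_max_left _ _)
  have hRK1 : ∀ i j, RK i j ≤ R₁ := fun i j =>
    calc RK i j ≤ |RK i j| := le_abs_self _
      _ ≤ ∑ j, |RK i j| := Finset.single_le_sum (f := fun j => |RK i j|)
          (fun _ _ => abs_nonneg _) (Finset.mem_univ j)
      _ ≤ ∑ i, ∑ j, |RK i j| := Finset.single_le_sum (f := fun i => ∑ j, |RK i j|)
          (fun _ _ => Finset.sum_nonneg fun _ _ => abs_nonneg _) (Finset.mem_univ i)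
      _ ≤ R₁ := le_max_right _ _
  refine ⟨R₁, hR0, fun k i => ?_⟩
  have hK : ∀ i j, ContinuousOn (extrinsicCurvature g i j) (outside R₁) := fun i j =>
    (hRK i j).1.continuousOn.mono (outside_antitone (hRK1 i j))
  have hγ : ∀ i j, ContDiffOn ℝ 3 (fun x => spatialMetric g x i j) (outside R₁) := fun i j =>
    (contDiffOn_atTimeZero hgC hsub i.succ j.succ).mono (outside_antitone hR0)
  have hinv := contDiffOn_matrix_inv hγ fun x hx => hr ‖x‖ (hr1.trans (le_of_lt hx)) x rfl
  refine (hK k i).sub (ContinuousOn.mul ?_ (hγ k i).continuousOn)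
  exact continuousOn_finsetSum _ fun a _ => continuousOn_finsetSum _ fun b _ =>
    (hinv a b).continuousOn.mul (hK a b)

/-- On the initial hypersurface the charges of the time translation converge to the ADM energy. -/
lemma tendsto_charge_zero_energy (hΩ : IsOpen Ω)
    (hgC : ∀ μ ν, ContDiffOn ℝ 3 (fun q => g q μ ν) Ω)
    (hgL : ∀ q ∈ Ω, IsLorentzian (g q)) (hsub : ∀ x ∈ outside R₀, event 0 x ∈ Ω)
    (hflat : FlatAtTimeZero g) {P : ℝ} (hP : Tendsto (admEnergy g) atTop (𝓝 P)) :
    Tendsto (charge g (translation 0) fun _ => 0) atTop (𝓝 P) := by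
  have herr : ∀ i : Fin 3, (fun x => -freud g 0 i.succ 0 (event 0 x)
      - 1 / (16 * Real.pi) * energyDensity g i x)
      =o[spaceInfty] radial (-(1 / 2) + -(3 / 2)) := by
    intro i
    refine (hflat.freud_sub_isLittleO i 0).neg_left.congr' ?_ EventuallyEq.rfl
    filter_upwards [hflat.lorentzian, hflat.differentiable] with x hL hd
    have he : energyDensity g i x = ∑ j : Fin 3, (metricDeriv g j.succ i.succ j.succ x
        - metricDeriv g i.succ j.succ j.succ x) :=
      Finset.sum_congr rfl fun j _ => by
        rw [← spd_atTimeZero (hd _ _), ← spd_atTimeZero (hd _ _)]; rfl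
    rw [minorDivergence_zero hL, he]
    ring
  have hcE : ∀ i, ContinuousOn (energyDensity g i) (outside R₀) := fun i =>
    continuousOn_finsetSum _ fun j _ => (continuousOn_spd_atTimeZero hgC hsub j _ _).sub
      (continuousOn_spd_atTimeZero hgC hsub i _ _)
  have h := hP.add (tendsto_sphereFlux_zero herr)
  rw [add_zero] at h
  refine h.congr' ?_
  filter_upwards [eventually_gt_atTop R₀, eventually_gt_atTop 0] with R h1 h2
  rw [sphereFlux_sub (G := fun i x => -freud g 0 i.succ 0 (event 0 x))
    (H := fun i x => 1 / (16 * Real.pi) * energyDensity g i x)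
    (fun i => (continuousOn_freud hΩ hgC hgL hsub _ _ _).neg)
    (fun i => continuousOn_const.mul (hcE i)) h2.le h1, sphereFlux_const_mul,
    charge_zero_eq_sphereFlux g 0 h2, admEnergy_eq_sphereFlux]
  ring

/-- On the initial hypersurface the charges of the space translations converge to the ADM
momentum. -/
lemma tendsto_charge_zero_momentum (hΩ : IsOpen Ω)
    (hgC : ∀ μ ν, ContDiffOn ℝ 3 (fun q => g q μ ν) Ω)
    (hgL : ∀ q ∈ Ω, IsLorentzian (g q)) (hsub : ∀ x ∈ outside R₀, event 0 x ∈ Ω)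
    (hflat : FlatAtTimeZero g)
    (hdecay_K : ∀ i j, IsOSobolev 2 (-3 / 2) (extrinsicCurvature g i j)) (k : Fin 3) {P : ℝ}
    (hP : Tendsto (admMomentum g k) atTop (𝓝 P)) :
    Tendsto (charge g (translation k.succ) fun _ => 0) atTop (𝓝 P) := by
  -- The curl of `e_k × (g_{0c})`. Its flux vanishes exactly on each large sphere, so no decay of
  -- the shift derivatives beyond `o(r^{-3/2})` is needed.
  set C : Fin 3 → Space3 → ℝ := fun i x =>
    (∑ c : Fin 3, spd c (atTimeZero g 0 c.succ) x) * (1 : Matrix (Fin 3) (Fin 3) ℝ) k i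
      - spd k (atTimeZero g 0 i.succ) x with hC
  have herr : ∀ i : Fin 3, (fun x => -freud g 0 i.succ k.succ (event 0 x)
      - 1 / (8 * Real.pi) * momentumDensity g k i x - -(1 / (16 * Real.pi)) * C i x)
      =o[spaceInfty] radial (-(1 / 2) + -(3 / 2)) := by
    intro i
    refine ((hflat.freud_sub_isLittleO i k.succ).neg_left.sub
      ((hflat.momentum_sub_isLittleO k i).const_mul_left (1 / (8 * Real.pi)))).congr' ?_
      EventuallyEq.rfl
    filter_upwards [hflat.lorentzian, hflat.differentiable] with x hL hd
    have he : C i x = (∑ c : Fin 3, metricDeriv g c.succ 0 c.succ x)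
        * (1 : Matrix (Fin 3) (Fin 3) ℝ) k i - metricDeriv g k.succ 0 i.succ x := by
      simp only [hC, spd_atTimeZero (hd _ _)]
    rw [minorDivergence_succ hL, he, momentumDensity, show 16 * Real.pi = 2 * (8 * Real.pi) by ring,
      ← div_div]
    ring
  obtain ⟨R₁, hR₁, hcM⟩ := exists_continuousOn_momentumDensity hgC hsub hflat hdecay_K
  have hcC : ∀ i, ContinuousOn (C i) (outside R₁) := fun i =>
    (((continuousOn_finsetSum _ fun c _ => continuousOn_spd_atTimeZero hgC hsub c _ _).mul
      continuousOn_const).sub (continuousOn_spd_atTimeZero hgC hsub k _ _)).mono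
      (outside_antitone hR₁)
  have hcF : ∀ i : Fin 3, ContinuousOn (fun x => -freud g 0 i.succ k.succ (event 0 x))
      (outside R₁) := fun i =>
    ((continuousOn_freud hΩ hgC hgL hsub _ _ _).mono (outside_antitone hR₁)).neg
  have h := hP.add (tendsto_sphereFlux_zero herr)
  rw [add_zero] at h
  refine h.congr' ?_
  filter_upwards [eventually_gt_atTop R₁, eventually_gt_atTop 0] with R h1 h2
  have hcurl : sphereFlux C R = 0 := sphereFlux_curl_eq_zero
    (fun i => (contDiffOn_atTimeZero hgC hsub 0 i.succ).of_le (by norm_num)) h2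
    (lt_of_le_of_lt hR₁ h1) k
  rw [sphereFlux_sub (G := fun i x => -freud g 0 i.succ k.succ (event 0 x)
      - 1 / (8 * Real.pi) * momentumDensity g k i x)
    (H := fun i x => -(1 / (16 * Real.pi)) * C i x)
    (fun i => (hcF i).sub (continuousOn_const.mul (hcM k i)))
    (fun i => continuousOn_const.mul (hcC i)) h2.le h1,
    sphereFlux_sub (G := fun i x => -freud g 0 i.succ k.succ (event 0 x))
    (H := fun i x => 1 / (8 * Real.pi) * momentumDensity g k i x) hcF
    (fun i => continuousOn_const.mul (hcM k i)) h2.le h1,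
    sphereFlux_const_mul, sphereFlux_const_mul, hcurl,
    charge_zero_eq_sphereFlux g k.succ h2, admMomentum_eq_sphereFlux]
  ring

/-- The charges on the initial hypersurface converge to the ADM four-momentum. -/
theorem tendsto_charge_zero (hΩ : IsOpen Ω) (hgC : ∀ μ ν, ContDiffOn ℝ 3 (fun q => g q μ ν) Ω)
    (hgL : ∀ q ∈ Ω, IsLorentzian (g q)) (hsub : ∀ x ∈ outside R₀, event 0 x ∈ Ω)
    (hdecay_g : ∀ μ ν, IsOSobolev 3 (-1 / 2) (fun x => atTimeZero g μ ν x - minkowski μ ν))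
    (hdecay_K : ∀ i j, IsOSobolev 2 (-3 / 2) (extrinsicCurvature g i j))
    {p : Fin 4 → ℝ} (hp : IsADMFourMomentum g p) (μ : Fin 4) :
    Tendsto (charge g (translation μ) fun _ => 0) atTop (𝓝 (p μ)) := by
  have hflat := flatAtTimeZero hΩ hgC hgL hsub hdecay_g hdecay_K
  refine Fin.cases ?_ (fun k => ?_) μ
  · exact tendsto_charge_zero_energy hΩ hgC hgL hsub hflat hp.1
  · exact tendsto_charge_zero_momentum hΩ hgC hgL hsub hflat hdecay_K k (hp.2 k)

end ADMLimit

/-! ### The equivalence -/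

theorem proposition3p1
    -- the metric, on an open set of space-time
    (Ω : Set Event) (hΩ : IsOpen Ω) (g : MetricField)
    (hgC : ∀ μ ν, ContDiffOn ℝ 3 (fun q => g q μ ν) Ω)
    (hgL : ∀ q ∈ Ω, IsLorentzian (g q))
    -- the retarded time `u = t - f(x)`, with `du` asymptotic to `dt - dr`
    (f : Space3 → ℝ) (R₀ u₀ : ℝ)
    (hfC : ContDiffOn ℝ 1 f (outside R₀))
    (hf : Tendsto (fun x => gradient f x - ‖x‖⁻¹ • x) (Bornology.cobounded Space3) (𝓝 0))
    -- the region `t ≥ 0`, `u ≤ u₀` near infinity, and the initial hypersurface, are covered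
    (hΩ_region : ∀ (t : ℝ) (x : Space3), x ∈ outside R₀ →
      (t = 0 ∨ (0 ≤ t ∧ t ≤ u₀ + f x)) → event t x ∈ Ω)
    -- decay on the initial hypersurface `{t = 0}`
    (hdecay_g : ∀ μ ν, IsOSobolev 3 (-1 / 2) (fun x => atTimeZero g μ ν x - minkowski μ ν))
    (hdecay_K : ∀ i j, IsOSobolev 2 (-3 / 2) (extrinsicCurvature g i j))
    -- the ADM four-momentum
    (p : Fin 4 → ℝ) (hp : IsADMFourMomentum g p)
    (μ : Fin 4) :
    (∃ pT : ℝ → ℝ, (∀ u ≤ u₀, IsTrautmanMomentum g f μ u (pT u)) ∧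
        Tendsto pT atBot (𝓝 (p μ))) ↔
      (∃ Φ : ℝ → ℝ, (∀ u ≤ u₀, IsLimitFlux g f μ u (Φ u)) ∧
        Tendsto Φ atBot (𝓝 0)) := by
  have h0 : Tendsto (charge g (translation μ) fun _ => 0) atTop (𝓝 (p μ)) :=
    tendsto_charge_zero hΩ hgC hgL (fun x hx => hΩ_region 0 x hx (Or.inl rfl)) hdecay_g hdecay_K
      hp μ
  have hstokes : ∀ u ≤ u₀, _ := fun u hu =>
    eventually_charge_sub_eq_flux hΩ hgC hgL hfC hf hΩ_region μ hu
  constructor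
  · rintro ⟨pT, hpT, hlim⟩
    -- Passing to the limit `R → ∞` in Stokes' identity forces the limiting flux to be the Trautman
    -- momentum minus the ADM momentum; the converse adds it back.
    refine ⟨fun u => pT u - p μ, fun u hu => ?_, ?_⟩
    · exact ((hpT u hu).sub h0).congr' (hstokes u hu)
    · simpa using hlim.sub_const (p μ)
  · rintro ⟨Φ, hΦ, hlim⟩
    refine ⟨fun u => Φ u + p μ, fun u hu => ?_, ?_⟩
    · refine ((hΦ u hu).add h0).congr' ?_
      filter_upwards [hstokes u hu] with R hR
      rw [← hR, sub_add_cancel]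
    · simpa using hlim.add_const (p μ)
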